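/- **Setting.** Fix $n\ge 2$, a constant $c\neq 0$ and the rational functions $$g(u,v)=\frac{c}{u-v},\qquad h(u,v)=\frac{u-v+c}{c},\qquad f(u,v)=g(u,v)\,h(u,v).$$ The parameters lie in a field of characteristic $0$ with a non-trivial absolute value (for example $\mathbb C$, or a field of formal Laurent series). A generic $\mathfrak{gl}_n$-invariant model is given by operators $T_{i,j}(u)$, $1\le i,j\le n$, on a Hausdorff topological vector space (continuous, and defined for $u$ in a domain that contains a neighbourhood of $\infty$), such that $$[T_{i,j}(u),T_{k,l}(v)]=\frac{c}{u-v}\bigl(T_{k,j}(v)T_{i,l}(u)-T_{k,j}(u)T_{i,l}(v)\bigr)\quad(u\ne v),\qquad T_{i,j}(u)=\delta_{ij}+\sum_{m\ge0}T_{i,j}[m]\,(u/c)^{-m-1}\quad (u\to\infty),$$ where the expansion is understood as an asymptotic one on each vector, and by a vacuum vector $|0\rangle\ne0$ with $T_{i,j}(u)|0\rangle=0$ for $i>j$ and $T_{i,i}(u)|0\rangle=\lambda_i(u)|0\rangle$; the spectral parameters are taken where no $\lambda_i$ vanishes. Put $\alpha_a=\lambda_a/\lambda_{a+1}$. Let $\bar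 t=(\bar t^1,\dots,\bar t^{n-1})$ be a collection of finite sets ($\bar t^0=\bar t^n=\varnothing$). For a function $F$ of two variables and sets $X,Y$ write $F(X,Y)=\prod_{x\in X,\,y\in Y}F(x,y)$, with empty products equal to $1$. Put $$\gamma_a^b(u,v)=\begin{cases} g(u,v)/h(v,u), & b=a,\\ g(v,u)^{-1}+1, & b=a+1,\\ g(u,v)^{-1}, & b=a-1,\\ 1, & |a-b|>1,\end{cases}\qquad \Omega(\bar x,\bar y)=\prod_{a,b=1}^{n-1}\gamma_a^b(\bar x^a,\bar y^b),$$ $$\Omega(\bar x,\bar y,\bar w)=\Omega(\bar x,\bar y)\,\Omega(\bar x,\bar w)\,\Omega(\bar y,\bar w),\qquad \alpha(\bar x)=\prod_a\prod_{x\in\bar x^a}\alpha_a(x),$$ $$\psi_\ell(z;\bar t)=h(\bar t^\ell,z)\,g(z,\bar t^{\ell-1}),\qquad \phi_\ell(z;\bar t)=g(\bar t^\ell,z)\,h(z,\bar t^{\ell-1}),\qquad \mu^k_\ell(z;\bar t)=\psi_\ell(z;\bar t)\,\phi_k(z;\bar t).$$ Let $\mathcal Z^k_\ell\,\mathbb B(\bar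 t)$ be $\mathbb B$ evaluated at the collection in which $\bar t^s$ is replaced by $\{\bar t^s,z\}$ for $\ell\le s\le k-1$, and let $\Theta(m)=1$ for $m\ge0$ and $\Theta(m)=0$ for $m<0$. Off-shell Bethe vectors are vectors $\mathbb B(\bar t)$, defined when no two parameters of the same color differ by $c$, with $\mathbb B(\varnothing)=|0\rangle$ and $$T_{1,n}(z)\,\mathbb B(\bar t)=\lambda_n(z)\,h(\bar t^1,z)\,h(z,\bar t^{n-1})\,\mathcal Z_1^n\,\mathbb B(\bar t),$$ $$T_{a+1,a}[0]\,\mathbb B(\bar t)=\sum_{x\in\bar t^a}\Bigl(\alpha_a(x)\,\Omega(\bar t\setminus x,x)-\Omega(x,\bar t\setminus x)\Bigr)\mathbb B(\bar t\setminus x),\qquad 1\le a\le n-1,$$ where $x$ is removed from $\bar t^a$ and counts as a collection with one parameter of color $a$; the first relation is required when $z$ occurs in no $\bar t^s$ and both sides are defined. **Statement.** Let $\mathbb B$ be a family of off-shell Bethe vectors. Let the Bethe parameters $\bar t$ be generic (admissible, and any two of them, of whatever colors, are distinct and do not differ by $\pm c$), and let $z$ be admissible and generic with respect to $\bar t$ in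 the same sense. 1. For every $1\le i\le n$, $$T_{i,i}(z)\,\mathbb B(\bar t)=\lambda_n(z)\,\mu^n_1(z;\bar t)\sum_{\bar u\dashv\{\bar u_{\rm I},\bar u_{\rm II},\bar u_{\rm III}\}}\frac{\Omega(\bar u_{\rm I},\bar u_{\rm II},\bar u_{\rm III})\,\alpha(\bar u_{\rm III})}{\psi_1(z;\bar u_{\rm I})\,\phi_n(z;\bar u_{\rm III})}\,\mathbb B(\bar u_{\rm II}),$$ where the sum is over partitions of $\bar u^s=\{\bar t^s,z\}$ with $|\bar u^s_{\rm I}|=\Theta(i-1-s)$ and $|\bar u^s_{\rm III}|=\Theta(s-i)$, and the right-hand side equals $$\sum_{\ell=1}^{i}\sum_{k=i}^{n}\ \sum_{\bar t\dashv\{\bar t_{\rm I},\bar t_{\rm II},\bar t_{\rm III}\}}\lambda_k(z)\,\mu^k_\ell(z;\bar t_{\rm II})\;\mathcal Z^k_\ell\,\mathbb B(\bar t_{\rm II})\;\Upsilon_i^{\ell,k}(z;\bar t_{\rm I},\bar t_{\rm II},\bar t_{\rm III}),$$ where the sum is over partitions with $|\bar t^s_{\rm I}|=\Theta(s-\ell)\,\Theta(i-s-1)$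 and $|\bar t^s_{\rm III}|=\Theta(k-1-s)\,\Theta(s-i)$, and $$\Upsilon_i^{\ell,k}(z;\bar t_{\rm I},\bar t_{\rm II},\bar t_{\rm III})=\frac{\lambda_n(z)}{\lambda_k(z)}\,\frac{\mu^n_1(z;\bar t)}{\mu^k_\ell(z;\bar t_{\rm II})}\,\frac{\Omega(\bar u_{\rm I},\bar u_{\rm II},\bar u_{\rm III})\,\alpha(\bar u_{\rm III})}{\psi_1(z;\bar u_{\rm I})\,\phi_n(z;\bar u_{\rm III})},$$ with $\bar u_{\rm I},\bar u_{\rm II},\bar u_{\rm III}$ obtained from $\bar t_{\rm I},\bar t_{\rm II},\bar t_{\rm III}$ by adding $z$ to $\bar t_{\rm I}^s$ for $s<\ell$, to $\bar t_{\rm II}^s$ for $\ell\le s<k$, and to $\bar t_{\rm III}^s$ for $s\ge k$. 2. With $\tau(z;\bar t)=\sum_{i=1}^n\lambda_i(z)\,f(z,\bar t^{i-1})\,f(\bar t^i,z)$, $$\sum_{i=1}^nT_{i,i}(z)\,\mathbb B(\bar t)=\tau(z;\bar t)\,\mathbb B(\bar t)+\sum_{1\le\ell<k\le n}U_{\ell,k},\qquad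 U_{\ell,k}=\sum_{i=\ell}^k\ \sum_{\bar t\dashv\{\bar t_{\rm I},\bar t_{\rm II},\bar t_{\rm III}\}}\lambda_k(z)\,\mu^k_\ell(z;\bar t_{\rm II})\,\Upsilon_i^{\ell,k}(z;\bar t_{\rm I},\bar t_{\rm II},\bar t_{\rm III})\;\mathcal Z^k_\ell\,\mathbb B(\bar t_{\rm II}),$$ with the partitions as in part 1. 3. Suppose that the Bethe equations hold, that is, $\alpha_a(x)=\Omega(x,\bar t\setminus x)/\Omega(\bar t\setminus x,x)$ for every $a$ and every $x\in\bar t^a$. Then for all $1\le\ell<k\le n$ and every subcollection $\bar r\subseteq\bar t$ with exactly one parameter of each color $\ell,\dots,k-1$ and none of the other colors, $$\sum_{i=\ell}^k\Upsilon_i^{\ell,k}\bigl(z;\{\bar r^s\}_{s<i},\,\bar t\setminus\bar r,\,\{\bar r^s\}_{s\ge i}\bigr)=0 .$$ Hence $U_{\ell,k}=0$, and $$\sum_{i=1}^nT_{i,i}(z)\,\mathbb B(\bar t)=\tau(z;\bar t)\,\mathbb B(\bar t).$$ -/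

import Mathlib

open Filter Topology
open scoped Classical

namespace GLBethe

/-! ### Rational functions -/

section Rational

variable {𝕜 : Type*} [Field 𝕜]

/-- `g(u,v) = c / (u - v)`. -/
def g (c u v : 𝕜) : 𝕜 := c / (u - v)

/-- `h(u,v) = (u - v + c) / c`. -/
def h (c u v : 𝕜) : 𝕜 := (u - v + c) / c

/-- `f(u,v) = h(u,v) g(u,v)`. -/
def f (c u v : 𝕜) : 𝕜 := h c u v * g c u v

/-- The function `γ_a^b(u,v)` attached to two nodes `a`, `b` of the `A_{n-1}` Dynkin diagram;
`u` has color `a` and `v` has color `b`. (At `u = v` the value `(g u v)⁻¹` is `0`, which is the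
value of the polynomial `1 / g(u,v) = (u - v) / c`.) -/
def gam (c : 𝕜) (a b : ℕ) (u v : 𝕜) : 𝕜 :=
  if a = b then g c u v / h c v u
  else if b = a + 1 then (g c v u)⁻¹ + 1
  else if a = b + 1 then (g c u v)⁻¹
  else 1

/-- The shorthand `F(X, Y) = ∏_{x ∈ X} ∏_{y ∈ Y} F(x, y)`. -/
def setProd (F : 𝕜 → 𝕜 → 𝕜) (X Y : Finset 𝕜) : 𝕜 := ∏ x ∈ X, ∏ y ∈ Y, F x y

/-- A collection `t̄ = (t̄^1, …, t̄^{n-1})` of finite sets of Bethe parameters, as the finite set of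
the colored parameters `(s, x)`, `x ∈ t̄^s`. -/
abbrev Coll (𝕜 : Type*) := Finset (ℕ × 𝕜)

/-- The set `t̄^s` of the parameters of color `s`; it is empty for `s = 0` and `s = n` when the
collection has colors in `{1, …, n-1}`. -/
noncomputable def color (t : Coll 𝕜) (s : ℕ) : Finset 𝕜 :=
  (t.filter fun p => p.1 = s).image Prod.snd

/-- The collection in which each `t̄^s`, `ℓ ≤ s ≤ k - 1`, is replaced by `{t̄^s, z}`. -/
noncomputable def extend (t : Coll 𝕜) (l k : ℕ) (z : 𝕜) : Coll 𝕜 :=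
  t ∪ Finset.Ico l k ×ˢ ({z} : Finset 𝕜)

/-- `Ω(X, Y) = ∏_{a,b} γ_a^b(X^a, Y^b)`. If `X` is one parameter of color `a`, this is
`Ω^R_a(X, Y)`; if `Y` is one parameter of color `a`, it is `Ω^L_a(X, Y)`. -/
def Omega (c : 𝕜) (X Y : Coll 𝕜) : 𝕜 := ∏ p ∈ X, ∏ q ∈ Y, gam c p.1 q.1 p.2 q.2

/-- `Ω(X, Y, Z) = Ω(X, Y) Ω(X, Z) Ω(Y, Z)`. -/
def Omega₃ (c : 𝕜) (X Y Z : Coll 𝕜) : 𝕜 := Omega c X Y * Omega c X Z * Omega c Y Z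

/-- `ψ_ℓ(z; t̄) = h(t̄^ℓ, z) g(z, t̄^{ℓ-1})`, for `ℓ ≥ 1`. -/
noncomputable def psi (c : 𝕜) (l : ℕ) (z : 𝕜) (t : Coll 𝕜) : 𝕜 :=
  setProd (h c) (color t l) {z} * setProd (g c) {z} (color t (l - 1))

/-- `φ_ℓ(z; t̄) = g(t̄^ℓ, z) h(z, t̄^{ℓ-1})`, for `ℓ ≥ 1`. -/
noncomputable def phi (c : 𝕜) (l : ℕ) (z : 𝕜) (t : Coll 𝕜) : 𝕜 :=
  setProd (g c) (color t l) {z} * setProd (h c) {z} (color t (l - 1))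

/-- `μ^k_ℓ(z; t̄) = ψ_ℓ(z; t̄) φ_k(z; t̄)`. -/
noncomputable def mu (c : 𝕜) (l k : ℕ) (z : 𝕜) (t : Coll 𝕜) : 𝕜 := psi c l z t * phi c k z t

/-- The Heaviside step function on `ℤ`, with `Θ(0) = 1`. -/
def Theta (m : ℤ) : ℕ := if 0 ≤ m then 1 else 0

/-- The partitions `t̄^s ⊣ {t̄_I^s, t̄_II^s, t̄_III^s}` of a collection with colors in
`{1, …, n-1}` into three disjoint parts, with `|t̄_I^s| = r₁ s` and `|t̄_III^s| = r₃ s` for every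
color `s`; such a partition is the triple `(t̄_I, t̄_II, t̄_III)`. -/
noncomputable def partitions (n : ℕ) (t : Coll 𝕜) (r₁ r₃ : ℕ → ℕ) :
    Finset (Coll 𝕜 × Coll 𝕜 × Coll 𝕜) :=
  (t.powerset ×ˢ t.powerset ×ˢ t.powerset).filter fun p =>
    p.1 ∪ p.2.1 ∪ p.2.2 = t ∧
    Disjoint p.1 p.2.1 ∧ Disjoint p.1 p.2.2 ∧ Disjoint p.2.1 p.2.2 ∧
    ∀ s ∈ Finset.Icc 1 (n - 1), (color p.1 s).card = r₁ s ∧ (color p.2.2 s).card = r₃ s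

end Rational

/-! ### The generic `gl_n`-invariant model -/

/-- A generic `gl_n`-invariant integrable model on the representation space `H`: a monodromy
matrix `T(u) = (T_{i,j}(u))`, `1 ≤ i, j ≤ n`, that satisfies the `RTT` relation for the rational
`R`-matrix and has an expansion `T_{i,j}(u) = δ_{i,j} + ∑_{m ≥ 0} T_{i,j}[m] (u/c)^{-m-1}`
at infinity, together with a vacuum vector. Values of `T`, `mode`, `lam` at indices outside
`{1, …, n}` and at parameters outside `dom` are irrelevant. -/
structure Model (𝕜 : Type*) [NontriviallyNormedField 𝕜] (H : Type*) [AddCommGroup H]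
    [Module 𝕜 H] [TopologicalSpace H] (n : ℕ) (c : 𝕜) where
  /-- the admissible spectral parameters: `T(u)` is defined and no `λ_i(u)` vanishes -/
  dom : Set 𝕜
  dom_mem : dom ∈ Bornology.cobounded 𝕜
  /-- the entries `T_{i,j}(u)` -/
  T : ℕ → ℕ → 𝕜 → H →L[𝕜] H
  /-- the modes `T_{i,j}[m]` -/
  mode : ℕ → ℕ → ℕ → H →ₗ[𝕜] H
  /-- the vacuum vector -/
  vac : H
  /-- the functional parameters `λ_i(u)` -/
  lam : ℕ → 𝕜 → 𝕜
  rtt : ∀ i ∈ Finset.Icc 1 n, ∀ j ∈ Finset.Icc 1 n, ∀ k ∈ Finset.Icc 1 n, ∀ l ∈ Finset.Icc 1 n,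
    ∀ u ∈ dom, ∀ v ∈ dom, u ≠ v → ∀ x : H,
      T i j u (T k l v x) - T k l v (T i j u x) =
        (c / (u - v)) • (T k j v (T i l u x) - T k j u (T i l v x))
  /-- the expansion at infinity, on each vector and to each order `N` -/
  expansion : ∀ i ∈ Finset.Icc 1 n, ∀ j ∈ Finset.Icc 1 n, ∀ N : ℕ, ∀ x : H,
    Tendsto (fun u : 𝕜 => (u / c) ^ N • (T i j u x - (if i = j then x else 0)
        - ∑ m ∈ Finset.range N, ((u / c) ^ (m + 1))⁻¹ • mode i j m x))
      (Bornology.cobounded 𝕜) (𝓝 0)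
  vac_ne : vac ≠ 0
  vac_lower : ∀ i ∈ Finset.Icc 1 n, ∀ j ∈ Finset.Icc 1 n, j < i → ∀ u ∈ dom, T i j u vac = 0
  vac_diag : ∀ i ∈ Finset.Icc 1 n, ∀ u ∈ dom, T i i u vac = lam i u • vac
  lam_ne : ∀ i ∈ Finset.Icc 1 n, ∀ u ∈ dom, lam i u ≠ 0

namespace Model

variable {𝕜 : Type*} [NontriviallyNormedField 𝕜] {H : Type*} [AddCommGroup H]
    [Module 𝕜 H] [TopologicalSpace H] {n : ℕ} {c : 𝕜} (M : Model 𝕜 H n c)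

/-- `α_a(x) = λ_a(x) / λ_{a+1}(x)`. -/
def alpha (a : ℕ) (x : 𝕜) : 𝕜 := M.lam a x / M.lam (a + 1) x

/-- `α(X) = ∏_a α_a(X^a)`. -/
def alphaProd (X : Coll 𝕜) : 𝕜 := ∏ p ∈ X, M.alpha p.1 p.2

/-- The collections at which Bethe vectors are defined: colors in `{1, …, n-1}`, admissible
parameters, and no two parameters of the same color that differ by `c` (there the functions
`γ_a^a` have poles). The same number may occur with several colors, as it does in the extended
sets `{t̄^s, z}`. -/
def Regular (t : Coll 𝕜) : Prop :=
  (∀ p ∈ t, p.1 ∈ Finset.Icc 1 (n - 1) ∧ p.2 ∈ M.dom) ∧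
  ∀ p ∈ t, ∀ q ∈ t, p.1 = q.1 → p.2 - q.2 ≠ c

/-- Generic Bethe parameters: moreover any two of them, of whatever colors, are distinct and do
not differ by `c`. -/
def Generic (t : Coll 𝕜) : Prop :=
  M.Regular t ∧ ∀ p ∈ t, ∀ q ∈ t, p ≠ q → p.2 ≠ q.2 ∧ p.2 - q.2 ≠ c

/-- An admissible `z` that is generic with respect to the Bethe parameters `t̄`. -/
def GenericAt (t : Coll 𝕜) (z : 𝕜) : Prop :=
  z ∈ M.dom ∧ ∀ p ∈ t, p.2 ≠ z ∧ p.2 - z ≠ c ∧ z - p.2 ≠ c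

/-- `B` is a family of off-shell Bethe vectors of the model: `B(∅)` is the vacuum, the highest
entry `T_{1,n}(z)` extends every set of parameters by `z`, and the zero modes
`T_{a+1,a}[0]` remove one parameter of color `a`. -/
structure IsOffShell (B : Coll 𝕜 → H) : Prop where
  vac : B ∅ = M.vac
  highest : ∀ (t : Coll 𝕜) (z : 𝕜), (∀ p ∈ t, p.2 ≠ z) → M.Regular (extend t 1 n z) →
    M.T 1 n z (B t) =
      (M.lam n z * setProd (h c) (color t 1) {z} * setProd (h c) {z} (color t (n - 1))) •
        B (extend t 1 n z)
  zeroMode : ∀ t : Coll 𝕜, M.Regular t → ∀ a ∈ Finset.Icc 1 (n - 1),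
    M.mode (a + 1) a 0 (B t) =
      ∑ p ∈ t.filter (fun p => p.1 = a),
        (M.alpha a p.2 * Omega c (t.erase p) {p} - Omega c {p} (t.erase p)) • B (t.erase p)

/-- The Bethe equations: `α_a(t̄^a_I) = Ω^R_a(t̄_I, t̄_II) / Ω^L_a(t̄_II, t̄_I)` for every color `a`
and every partition for which `t̄_I` consists of one parameter of color `a`. -/
def OnShell (t : Coll 𝕜) : Prop :=
  ∀ p ∈ t, M.alpha p.1 p.2 = Omega c {p} (t.erase p) / Omega c (t.erase p) {p}

/-- The right hand side of the action formula of `T_{i,j}(z)` as a sum over partitions of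
the extended sets `ū^s = {t̄^s, z}` with `|ū_I^s| = Θ(i-1-s)` and `|ū_III^s| = Θ(s-j)`. -/
noncomputable def action (B : Coll 𝕜 → H) (i j : ℕ) (z : 𝕜) (t : Coll 𝕜) : H :=
  (M.lam n z * mu c 1 n z t) •
    ∑ p ∈ partitions n (extend t 1 n z)
        (fun s => Theta ((i : ℤ) - 1 - s)) (fun s => Theta ((s : ℤ) - j)),
      (Omega₃ c p.1 p.2.1 p.2.2 * M.alphaProd p.2.2 / (psi c 1 z p.1 * phi c n z p.2.2)) •
        B p.2.1

/-- The function `Υ^{ℓ,k}(z; t̄_I, t̄_II, t̄_III)`, where `t̄ = t̄_I ∪ t̄_II ∪ t̄_III`, `z` is added to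
`t̄_I^s` for `s < ℓ`, to `t̄_II^s` for `ℓ ≤ s < k` and to `t̄_III^s` for `k ≤ s`. The index `i` of
`Υ_i^{ℓ,k}` enters only through the cardinalities of the parts. -/
noncomputable def Upsilon (l k : ℕ) (z : 𝕜) (tI tII tIII : Coll 𝕜) : 𝕜 :=
  M.lam n z / M.lam k z * (mu c 1 n z (tI ∪ tII ∪ tIII) / mu c l k z tII) *
    (Omega₃ c (extend tI 1 l z) (extend tII l k z) (extend tIII k n z) *
        M.alphaProd (extend tIII k n z) /
      (psi c 1 z (extend tI 1 l z) * phi c n z (extend tIII k n z)))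

/-- The sum over partitions of the original sets `t̄^s` with
`|t̄_I^s| = Θ(s-ℓ) Θ(i-s-1)` and `|t̄_III^s| = Θ(k-1-s) Θ(s-i)`. -/
noncomputable def diagTerm (B : Coll 𝕜 → H) (i l k : ℕ) (z : 𝕜) (t : Coll 𝕜) : H :=
  ∑ p ∈ partitions n t
      (fun s => Theta ((s : ℤ) - l) * Theta ((i : ℤ) - s - 1))
      (fun s => Theta ((k : ℤ) - 1 - s) * Theta ((s : ℤ) - i)),
    (M.lam k z * mu c l k z p.2.1 * M.Upsilon l k z p.1 p.2.1 p.2.2) • B (extend p.2.1 l k z)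

/-- The eigenvalue `τ(z; t̄) = ∑_i λ_i(z) f(z, t̄^{i-1}) f(t̄^i, z)`. -/
noncomputable def tau (z : 𝕜) (t : Coll 𝕜) : 𝕜 :=
  ∑ i ∈ Finset.Icc 1 n,
    M.lam i z * setProd (f c) {z} (color t (i - 1)) * setProd (f c) (color t i) {z}

end Model

end GLBethe

/-!
The two sides of the action formula for `T_{i,j}(z)` are compared through their commutators with
the zero modes `T_{a+1,a}[0]`; the difference of the two sides is called the defect.

*Commutators.* The leading order of the `RTT` relation at infinity gives the commutators of
`T_{i,j}(z)` with the zero modes (`commutator_zeroMode`). For the right hand side, `z` is placed in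
all colors `0, …, n`, with `z` of color `0` always in the first and `z` of color `n` always in the
third part. Then `ψ_1`, `φ_n` and `μ^n_1` become interactions `Ω` with the copies of `z`
(`mu_mul_weight`), and the right hand side is a plain sum of `Ω(I, II, III) α(III) B(II)` over
partitions in which `I` has one parameter of each color below `i` and `III` one of each color from
`j` on (`actSum`). Its commutator with a zero mode reduces to the antisymmetrised weights of `I`
and `III`, which are `0`, `1` or `-1` (`antisym_above`, `antisym_below`, `antisym_inside`,
`antisym_far`), and so it coincides with the commutator of `T_{i,j}(z)` (`actSum_commutator`).

*The defect.* The formula holds for `T_{1,n}(z)` by definition of off-shell Bethe vectors, and the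
commutators propagate it to all entries above the diagonal (`defect_eq_zero_of_lt`). On the
diagonal the defects are all equal, and for `n ≥ 3` some diagonal entry commutes with a given zero
mode, so their common value `D(z; t̄)` intertwines all zero modes (`defect_diag_commutator`). It
vanishes by induction on the number of parameters (`defect_last_eq_zero`). The exchange relation of
`T_{n,n}(z)` with `T_{1,n}(w)` carries `D = 0` from `t̄` to the collection in which `w` is added in
all colors `1, …, n - 1` (`defect_last_extend`). Zero modes then shorten this string of copies of
`w` from both ends to a single parameter of any color: the zero mode that removes an end of the
string does so with a non-zero coefficient, and its other terms, which remove a parameter of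
`t̄` and keep the whole string, vanish since the claim is carried along for all subcollections of
`t̄` (`defect_extend`).

*The rewriting.* A partition in which `z` of color `s + 1` lies in an earlier part than `z` of
color `s` has weight zero, since `γ_{s+1}^s(z, z) = 0`. Hence the copies of `z` are labelled
`I, …, I, II, …, II, III, …, III` along the colors (`exists_labels`), and the sum is regrouped by
the two places where the label changes (`action_eq_sum_diagTerm`). A string of copies of `z`
interacts with other parameters through its ends only, which turns `Υ^{ℓ,k}` into
`Ω(t̄_I, t̄_II, t̄_III) α(t̄_III) φ_ℓ(z; t̄_I) ψ_k(z; t̄_III)` (`Upsilon_eq`). The terms with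
`ℓ = k` add up to `τ(z; t̄) B(t̄)`.

*On shell.* The Bethe equations express `α(t̄_III)` as the ratio of the interactions of `t̄_III`
with the other parameters (`prod_onShell`). For a fixed second part there remains a sum over the
ways of cutting a collection with one parameter of each color `ℓ, …, k - 1` into a lower and an
upper half, and it telescopes to zero (`sum_cut_eq_zero`).
-/

namespace GLBethe

/-! ### Products over collections -/

section Products

variable {𝕜 : Type*} [Field 𝕜] {c : 𝕜}

lemma inv_g_add_one (hc : c ≠ 0) (u v : 𝕜) : (g c u v)⁻¹ + 1 = h c u v := by
  unfold g h
  rw [inv_div]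
  field_simp

lemma inv_g (u v : 𝕜) : (g c u v)⁻¹ = (u - v) / c := by
  unfold g
  rw [inv_div]

lemma h_self (hc : c ≠ 0) (u : 𝕜) : h c u u = 1 := by
  simp [h, hc]

lemma h_ne_zero (hc : c ≠ 0) {u v : 𝕜} (huv : v - u ≠ c) : h c u v ≠ 0 := by
  unfold h
  refine div_ne_zero (fun h0 => huv ?_) hc
  linear_combination -h0

lemma g_ne_zero (hc : c ≠ 0) {u v : 𝕜} (huv : u ≠ v) : g c u v ≠ 0 :=
  div_ne_zero hc (sub_ne_zero.2 huv)

lemma gam_same (a : ℕ) (u v : 𝕜) : gam c a a u v = g c u v / h c v u := by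
  simp [gam]

lemma gam_succ (hc : c ≠ 0) (a : ℕ) (u v : 𝕜) : gam c a (a + 1) u v = h c v u := by
  simp [gam, inv_g_add_one hc]

lemma gam_pred (a : ℕ) (u v : 𝕜) : gam c (a + 1) a u v = (u - v) / c := by
  have h1 : ¬a = a + 1 + 1 := by omega
  simp [gam, inv_g, h1]

lemma gam_far {a b : ℕ} (u v : 𝕜) (h1 : a ≠ b) (h2 : b ≠ a + 1) (h3 : a ≠ b + 1) :
    gam c a b u v = 1 := by
  simp [gam, h1, h2, h3]

lemma gam_ne_zero (hc : c ≠ 0) (a b : ℕ) {u v : 𝕜} (h1 : u ≠ v) (h2 : u - v ≠ c) :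
    gam c a b u v ≠ 0 := by
  unfold gam
  split_ifs
  · exact div_ne_zero (g_ne_zero hc h1) (h_ne_zero hc h2)
  · rw [inv_g_add_one hc]
    exact h_ne_zero hc h2
  · exact inv_ne_zero (g_ne_zero hc h1)
  · exact one_ne_zero

@[simp] lemma Omega_empty_left (Y : Coll 𝕜) : Omega c ∅ Y = 1 := by simp [Omega]

@[simp] lemma Omega_empty_right (X : Coll 𝕜) : Omega c X ∅ = 1 := by simp [Omega]

lemma Omega_union_left {X X' : Coll 𝕜} (hX : Disjoint X X') (Y : Coll 𝕜) :
    Omega c (X ∪ X') Y = Omega c X Y * Omega c X' Y :=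
  Finset.prod_union hX

lemma Omega_union_right (X : Coll 𝕜) {Y Y' : Coll 𝕜} (hY : Disjoint Y Y') :
    Omega c X (Y ∪ Y') = Omega c X Y * Omega c X Y' := by
  simp only [Omega, Finset.prod_union hY, Finset.prod_mul_distrib]

lemma Omega_insert_left {p : ℕ × 𝕜} {X : Coll 𝕜} (hp : p ∉ X) (Y : Coll 𝕜) :
    Omega c (insert p X) Y = Omega c {p} Y * Omega c X Y := by
  simp [Omega, Finset.prod_insert hp]

lemma Omega_insert_right (X : Coll 𝕜) {p : ℕ × 𝕜} {Y : Coll 𝕜} (hp : p ∉ Y) :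
    Omega c X (insert p Y) = Omega c X {p} * Omega c X Y := by
  simp [Omega, Finset.prod_insert hp, Finset.prod_mul_distrib]

lemma Omega_single_left (p : ℕ × 𝕜) (Y : Coll 𝕜) :
    Omega c {p} Y = ∏ q ∈ Y, gam c p.1 q.1 p.2 q.2 := by
  simp [Omega]

lemma Omega_single_right (X : Coll 𝕜) (q : ℕ × 𝕜) :
    Omega c X {q} = ∏ p ∈ X, gam c p.1 q.1 p.2 q.2 := by
  simp [Omega]

lemma Omega_eq_prod_left (X Y : Coll 𝕜) : Omega c X Y = ∏ p ∈ X, Omega c {p} Y := by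
  simp [Omega]

lemma Omega_eq_prod_right (X Y : Coll 𝕜) : Omega c X Y = ∏ q ∈ Y, Omega c X {q} := by
  simp only [Omega, Finset.prod_singleton]
  exact Finset.prod_comm

/-- The interactions vanish at equal numbers of neighbouring colors: `γ_{a+1}^a(z, z) = 0`. -/
lemma Omega_eq_zero {X Y : Coll 𝕜} {a : ℕ} {z : 𝕜} (hX : (a + 1, z) ∈ X) (hY : (a, z) ∈ Y) :
    Omega c X Y = 0 := by
  refine Finset.prod_eq_zero hX (Finset.prod_eq_zero hY ?_)
  simp [gam_pred]

lemma Omega_ne_zero (hc : c ≠ 0) {X Y : Coll 𝕜}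
    (hXY : ∀ p ∈ X, ∀ q ∈ Y, p.2 ≠ q.2 ∧ p.2 - q.2 ≠ c) : Omega c X Y ≠ 0 :=
  Finset.prod_ne_zero_iff.2 fun p hp => Finset.prod_ne_zero_iff.2 fun q hq =>
    gam_ne_zero hc _ _ (hXY p hp q hq).1 (hXY p hp q hq).2

end Products

/-! ### Collections with prescribed numbers of parameters -/

section Cards

variable {𝕜 : Type*}

/-- The collection `X` has exactly `r s` parameters of each color `s`. -/
def HasCards (r : ℕ → ℕ) (X : Coll 𝕜) : Prop :=
  ∀ s, (X.filter fun p => p.1 = s).card = r s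

/-- The indicator of the colors `lo, …, hi - 1`: a collection with these cardinalities has one
parameter of each of them. -/
def ind (lo hi : ℕ) : ℕ → ℕ := fun s => if lo ≤ s ∧ s < hi then 1 else 0

/-- The cardinalities after one parameter of color `a` is added. -/
def bump (r : ℕ → ℕ) (a : ℕ) : ℕ → ℕ := fun s => r s + if s = a then 1 else 0

/-- The partitions of `u` into `I`, `II`, `III` with prescribed cardinalities of `I` and `III`,
encoded as the pairs `(I, III)`. -/
noncomputable def parts (r₁ r₃ : ℕ → ℕ) (u : Coll 𝕜) : Finset (Coll 𝕜 × Coll 𝕜) :=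
  (u.powerset ×ˢ u.powerset).filter fun x =>
    Disjoint x.1 x.2 ∧ HasCards r₁ x.1 ∧ HasCards r₃ x.2

lemma mem_parts {r₁ r₃ : ℕ → ℕ} {u : Coll 𝕜} {x : Coll 𝕜 × Coll 𝕜} :
    x ∈ parts r₁ r₃ u ↔
      x.1 ⊆ u ∧ x.2 ⊆ u ∧ Disjoint x.1 x.2 ∧ HasCards r₁ x.1 ∧ HasCards r₃ x.2 := by
  simp [parts, and_assoc]

lemma hasCards_insert {r : ℕ → ℕ} {X : Coll 𝕜} {p : ℕ × 𝕜} (hp : p ∉ X) :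
    HasCards (bump r p.1) (insert p X) ↔ HasCards r X := by
  refine forall_congr' fun s => ?_
  rw [Finset.filter_insert]
  by_cases hs : p.1 = s
  · subst hs
    simp [bump, hp]
  · simp [hs, bump, Ne.symm hs]

lemma hasCards_erase {r : ℕ → ℕ} {X : Coll 𝕜} {p : ℕ × 𝕜} (hp : p ∈ X) :
    HasCards r (X.erase p) ↔ HasCards (bump r p.1) X := by
  rw [← hasCards_insert (Finset.notMem_erase p X), Finset.insert_erase hp]

lemma hasCards_zero {X : Coll 𝕜} : HasCards (fun _ => 0) X ↔ X = ∅ := by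
  constructor
  · intro hX
    rw [Finset.eq_empty_iff_forall_notMem]
    intro p hp
    have := hX p.1
    rw [Finset.card_eq_zero, Finset.filter_eq_empty_iff] at this
    exact this hp rfl
  · rintro rfl s
    simp

lemma ind_empty {lo hi : ℕ} (hle : hi ≤ lo) : ind lo hi = fun _ => 0 := by
  funext s
  simp only [ind]
  rw [if_neg]
  omega

lemma bump_ind_left (lo hi : ℕ) (hle : lo < hi) : bump (ind (lo + 1) hi) lo = ind lo hi := by
  funext s
  simp only [bump, ind]
  split_ifs <;> omega

lemma bump_ind_right (lo hi : ℕ) (hle : lo ≤ hi) : bump (ind lo hi) hi = ind lo (hi + 1) := by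
  funext s
  simp only [bump, ind]
  split_ifs <;> omega

lemma HasCards.mem_range {lo hi : ℕ} {X : Coll 𝕜} (hX : HasCards (ind lo hi) X) {p : ℕ × 𝕜}
    (hp : p ∈ X) : lo ≤ p.1 ∧ p.1 < hi := by
  by_contra hcon
  have := hX p.1
  rw [ind, if_neg hcon, Finset.card_eq_zero, Finset.filter_eq_empty_iff] at this
  exact this hp rfl

lemma filter_erase_ne (S : Coll 𝕜) {p : ℕ × 𝕜} {s : ℕ} (hs : p.1 ≠ s) :
    (S.erase p).filter (fun q => q.1 = s) = S.filter (fun q => q.1 = s) := by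
  rw [Finset.filter_erase, Finset.erase_eq_of_notMem]
  simp [hs]

lemma filter_eq_singleton {r : ℕ → ℕ} {S : Coll 𝕜} (hS : HasCards r S) {s : ℕ} (hs : r s = 1) :
    ∃ x : 𝕜, S.filter (fun q => q.1 = s) = {(s, x)} := by
  have h1 := hS s
  rw [hs, Finset.card_eq_one] at h1
  obtain ⟨p, hp⟩ := h1
  have hmem : p ∈ S.filter (fun p => p.1 = s) := by simp [hp]
  exact ⟨p.2, by rw [hp, ← (Finset.mem_filter.1 hmem).2]⟩

lemma filter_eq_empty {r : ℕ → ℕ} {S : Coll 𝕜} (hS : HasCards r S) {s : ℕ} (hs : r s = 0) :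
    S.filter (fun q => q.1 = s) = ∅ :=
  Finset.card_eq_zero.1 ((hS s).trans hs)

/-- A collection with one parameter of each color in an interval is the graph of a function. -/
lemma HasCards.exists_image [Nonempty 𝕜] {lo hi : ℕ} {X : Coll 𝕜} (hX : HasCards (ind lo hi) X) :
    ∃ x : ℕ → 𝕜, X = (Finset.Ico lo hi).image fun s => (s, x s) := by
  have hex : ∀ s, ∃ y : 𝕜, lo ≤ s ∧ s < hi → X.filter (fun p => p.1 = s) = {(s, y)} := by
    intro s
    by_cases hs : lo ≤ s ∧ s < hi
    · have := hX s
      rw [ind, if_pos hs, Finset.card_eq_one] at this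
      obtain ⟨p, hp⟩ := this
      have hmem : p ∈ X.filter (fun p => p.1 = s) := by simp [hp]
      refine ⟨p.2, fun _ => ?_⟩
      rw [hp, ← (Finset.mem_filter.1 hmem).2]
    · exact ⟨Classical.arbitrary 𝕜, fun h => absurd h hs⟩
  choose x hx using hex
  refine ⟨x, ?_⟩
  ext p
  simp only [Finset.mem_image, Finset.mem_Ico]
  constructor
  · intro hp
    have hr := hX.mem_range hp
    have hmem : p ∈ X.filter (fun q => q.1 = p.1) := by simp [hp]
    rw [hx _ hr, Finset.mem_singleton] at hmem
    exact ⟨p.1, hr, hmem.symm⟩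
  · rintro ⟨s, hs, rfl⟩
    have : (s, x s) ∈ X.filter (fun q => q.1 = s) := by rw [hx s hs]; simp
    exact (Finset.mem_filter.1 this).1

/-- Moving one parameter `p` of color `a` into the first part. -/
lemma sum_parts_erase_left {E : Type*} [AddCommMonoid E] (r₁ r₃ : ℕ → ℕ) (u : Coll 𝕜) (a : ℕ)
    (F : Coll 𝕜 → Coll 𝕜 → ℕ × 𝕜 → E) :
    ∑ p ∈ u.filter (fun p => p.1 = a), ∑ x ∈ parts r₁ r₃ (u.erase p), F x.1 x.2 p =
      ∑ x ∈ parts (bump r₁ a) r₃ u, ∑ p ∈ x.1.filter (fun p => p.1 = a),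
        F (x.1.erase p) x.2 p := by
  rw [Finset.sum_sigma', Finset.sum_sigma']
  refine Finset.sum_bij' (fun y _ => ⟨(insert y.1 y.2.1, y.2.2), y.1⟩)
    (fun y _ => ⟨y.2, (y.1.1.erase y.2, y.1.2)⟩) ?_ ?_ ?_ ?_ ?_
  · rintro ⟨p, I, III⟩ hy
    simp only [Finset.mem_sigma, Finset.mem_filter, mem_parts, Finset.subset_erase] at hy ⊢
    obtain ⟨⟨hp, rfl⟩, ⟨hI, hpI⟩, ⟨hIII, hpIII⟩, hd, h1, h3⟩ := hy
    refine ⟨⟨Finset.insert_subset hp hI, hIII, ?_, (hasCards_insert hpI).2 h1, h3⟩, by simp⟩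
    rw [Finset.disjoint_insert_left]
    exact ⟨hpIII, hd⟩
  · rintro ⟨⟨I, III⟩, p⟩ hy
    simp only [Finset.mem_sigma, Finset.mem_filter, mem_parts, Finset.subset_erase] at hy ⊢
    obtain ⟨⟨hI, hIII, hd, h1, h3⟩, hp, rfl⟩ := hy
    refine ⟨⟨hI hp, rfl⟩, ⟨(Finset.erase_subset _ _).trans hI, Finset.notMem_erase _ _⟩,
      ⟨hIII, Finset.disjoint_left.1 hd hp⟩, hd.mono_left (Finset.erase_subset _ _),
      (hasCards_erase hp).2 h1, h3⟩
  · rintro ⟨p, I, III⟩ hy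
    simp only [Finset.mem_sigma, mem_parts, Finset.subset_erase] at hy
    simp [Finset.erase_insert hy.2.1.2]
  · rintro ⟨⟨I, III⟩, p⟩ hy
    simp only [Finset.mem_sigma, Finset.mem_filter] at hy
    simp [Finset.insert_erase hy.2.1]
  · rintro ⟨p, I, III⟩ hy
    simp only [Finset.mem_sigma, mem_parts, Finset.subset_erase] at hy
    simp [Finset.erase_insert hy.2.1.2]

lemma sum_parts_swap {E : Type*} [AddCommMonoid E] (r₁ r₃ : ℕ → ℕ) (u : Coll 𝕜)
    (F : Coll 𝕜 → Coll 𝕜 → E) :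
    ∑ x ∈ parts r₁ r₃ u, F x.1 x.2 = ∑ x ∈ parts r₃ r₁ u, F x.2 x.1 := by
  refine Finset.sum_bij' (fun x _ => x.swap) (fun x _ => x.swap) ?_ ?_ ?_ ?_ ?_
  · rintro ⟨I, III⟩ hx
    simp only [mem_parts, Prod.swap] at hx ⊢
    exact ⟨hx.2.1, hx.1, hx.2.2.1.symm, hx.2.2.2.2, hx.2.2.2.1⟩
  · rintro ⟨I, III⟩ hx
    simp only [mem_parts, Prod.swap] at hx ⊢
    exact ⟨hx.2.1, hx.1, hx.2.2.1.symm, hx.2.2.2.2, hx.2.2.2.1⟩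
  all_goals simp

/-- Moving one parameter `p` of color `a` into the third part. -/
lemma sum_parts_erase_right {E : Type*} [AddCommMonoid E] (r₁ r₃ : ℕ → ℕ) (u : Coll 𝕜) (a : ℕ)
    (F : Coll 𝕜 → Coll 𝕜 → ℕ × 𝕜 → E) :
    ∑ p ∈ u.filter (fun p => p.1 = a), ∑ x ∈ parts r₁ r₃ (u.erase p), F x.1 x.2 p =
      ∑ x ∈ parts r₁ (bump r₃ a) u, ∑ p ∈ x.2.filter (fun p => p.1 = a),
        F x.1 (x.2.erase p) p := by
  rw [sum_parts_swap r₁ (bump r₃ a) u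
    (fun I III => ∑ p ∈ III.filter (fun p => p.1 = a), F I (III.erase p) p),
    ← sum_parts_erase_left r₃ r₁ u a (fun I III p => F III I p)]
  exact Finset.sum_congr rfl fun p _ => sum_parts_swap r₁ r₃ (u.erase p) (fun I III => F I III p)

/-- Taking one parameter of color `a` out of the second part. -/
lemma sum_parts_second {E : Type*} [AddCommMonoid E] (r₁ r₃ : ℕ → ℕ) (u : Coll 𝕜) (a : ℕ)
    (F : Coll 𝕜 → Coll 𝕜 → ℕ × 𝕜 → E) :
    ∑ x ∈ parts r₁ r₃ u, ∑ p ∈ (u \ (x.1 ∪ x.2)).filter (fun p => p.1 = a), F x.1 x.2 p =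
      ∑ p ∈ u.filter (fun p => p.1 = a), ∑ x ∈ parts r₁ r₃ (u.erase p), F x.1 x.2 p := by
  refine Finset.sum_comm' ?_
  rintro ⟨I, III⟩ p
  simp only [mem_parts, Finset.mem_filter, Finset.mem_sdiff, Finset.mem_union,
    Finset.subset_erase]
  tauto

/-- The second part of a partition when `p` is taken out of the collection, or moved into the
first or the third part. -/
lemma sdiff_facts {u I III : Coll 𝕜} {p : ℕ × 𝕜} (hI : I ⊆ u.erase p) (hIII : III ⊆ u.erase p) :
    (u \ (I ∪ III)).erase p = u.erase p \ (I ∪ III) ∧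
    u \ (I ∪ insert p III) = u.erase p \ (I ∪ III) ∧
    u \ (insert p I ∪ III) = u.erase p \ (I ∪ III) ∧
    u.erase p = I ∪ u.erase p \ (I ∪ III) ∪ III := by
  rw [Finset.subset_erase] at hI hIII
  refine ⟨?_, ?_, ?_, ?_⟩ <;> ext q <;>
    simp only [Finset.mem_erase, Finset.mem_sdiff, Finset.mem_union, Finset.mem_insert]
  · tauto
  · tauto
  · tauto
  · have h1 := @hI.1 q
    have h2 := @hIII.1 q
    have h3 : q ∈ I → q ≠ p := fun h h' => hI.2 (h' ▸ h)
    have h4 : q ∈ III → q ≠ p := fun h h' => hIII.2 (h' ▸ h)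
    tauto

lemma partition_sdiff {u I III : Coll 𝕜} (hI : I ⊆ u) (hIII : III ⊆ u) :
    I ∪ u \ (I ∪ III) ∪ III = u ∧ Disjoint I (u \ (I ∪ III)) ∧ Disjoint (u \ (I ∪ III)) III := by
  refine ⟨?_, Finset.disjoint_sdiff.mono_left Finset.subset_union_left,
    (Finset.disjoint_sdiff.mono_left Finset.subset_union_right).symm⟩
  ext q
  have e1 := @hI q
  have e2 := @hIII q
  simp only [Finset.mem_sdiff, Finset.mem_union] at e1 e2 ⊢
  tauto

end Cards

/-! ### Antisymmetrised weights -/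

section Exchange

variable {𝕜 : Type*} [Field 𝕜] {c : 𝕜}

/-- No two parameters of the same color differ by `c`; there the functions `γ_a^a` have poles. -/
def NoPoles (c : 𝕜) (t : Coll 𝕜) : Prop := ∀ p ∈ t, ∀ q ∈ t, p.1 = q.1 → p.2 - q.2 ≠ c

lemma NoPoles.mono {t t' : Coll 𝕜} (ht : NoPoles c t) (h : t' ⊆ t) : NoPoles c t' :=
  fun p hp q hq => ht p (h hp) q (h hq)

/-- Only the colors next to `b + 1` contribute to a product that is trivial elsewhere. -/
lemma prod_eq_neighbours (X : Coll 𝕜) (b : ℕ) (F : ℕ × 𝕜 → 𝕜)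
    (hF : ∀ q ∈ X, q.1 ≠ b → q.1 ≠ b + 1 → q.1 ≠ b + 2 → F q = 1) :
    ∏ q ∈ X, F q = (∏ q ∈ X.filter (fun q => q.1 = b), F q) *
      (∏ q ∈ X.filter (fun q => q.1 = b + 1), F q) *
      ∏ q ∈ X.filter (fun q => q.1 = b + 2), F q := by
  rw [Finset.prod_filter, Finset.prod_filter, Finset.prod_filter, ← Finset.prod_mul_distrib,
    ← Finset.prod_mul_distrib]
  refine Finset.prod_congr rfl fun q hq => ?_
  by_cases h0 : q.1 = b
  · simp [h0]
  by_cases h1 : q.1 = b + 1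
  · simp [h1]
  by_cases h2 : q.1 = b + 2
  · simp [h2]
  · simp [h0, h1, h2, hF q hq h0 h1 h2]

lemma Omega_single_right_eq (hc : c ≠ 0) (X : Coll 𝕜) (b : ℕ) (x : 𝕜) :
    Omega c X {(b + 1, x)} = (∏ q ∈ X.filter (fun q => q.1 = b), h c x q.2) *
      (∏ q ∈ X.filter (fun q => q.1 = b + 1), g c q.2 x / h c x q.2) *
      ∏ q ∈ X.filter (fun q => q.1 = b + 2), (q.2 - x) / c := by
  rw [Omega_single_right, prod_eq_neighbours X b]
  · congr 1
    · congr 1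
      · refine Finset.prod_congr rfl fun q hq => ?_
        rw [(Finset.mem_filter.1 hq).2, gam_succ hc]
      · refine Finset.prod_congr rfl fun q hq => ?_
        rw [(Finset.mem_filter.1 hq).2, gam_same]
    · refine Finset.prod_congr rfl fun q hq => ?_
      rw [(Finset.mem_filter.1 hq).2, gam_pred]
  · intro q _ h0 h1 h2
    exact gam_far _ _ h1 (fun h => h0 (by simpa using h.symm)) h2

lemma Omega_single_left_eq (hc : c ≠ 0) (X : Coll 𝕜) (b : ℕ) (x : 𝕜) :
    Omega c {(b + 1, x)} X = (∏ q ∈ X.filter (fun q => q.1 = b), (x - q.2) / c) *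
      (∏ q ∈ X.filter (fun q => q.1 = b + 1), g c x q.2 / h c q.2 x) *
      ∏ q ∈ X.filter (fun q => q.1 = b + 2), h c q.2 x := by
  rw [Omega_single_left, prod_eq_neighbours X b]
  · congr 1
    · congr 1
      · refine Finset.prod_congr rfl fun q hq => ?_
        rw [(Finset.mem_filter.1 hq).2, gam_pred]
      · refine Finset.prod_congr rfl fun q hq => ?_
        rw [(Finset.mem_filter.1 hq).2, gam_same]
    · refine Finset.prod_congr rfl fun q hq => ?_
      rw [(Finset.mem_filter.1 hq).2, gam_succ hc]
  · intro q _ h0 h1 h2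
    exact gam_far _ _ (Ne.symm h1) h2 (fun h => h0 (by simpa using h.symm))

/-- The antisymmetrised weight of taking one parameter of color `a` out of `S`. -/
noncomputable def antisym (c : 𝕜) (a : ℕ) (S : Coll 𝕜) : 𝕜 :=
  ∑ p ∈ S.filter (fun p => p.1 = a), (Omega c (S.erase p) {p} - Omega c {p} (S.erase p))

lemma antisym_eq_of_single (hc : c ≠ 0) {r : ℕ → ℕ} {b : ℕ} {S : Coll 𝕜} (hS : HasCards r S)
    (h1 : r (b + 1) = 1) :
    ∃ x : 𝕜, antisym c (b + 1) S =
      (∏ q ∈ S.filter (fun q => q.1 = b), h c x q.2) *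
          (∏ q ∈ S.filter (fun q => q.1 = b + 2), (q.2 - x) / c) -
        (∏ q ∈ S.filter (fun q => q.1 = b), (x - q.2) / c) *
          ∏ q ∈ S.filter (fun q => q.1 = b + 2), h c q.2 x := by
  obtain ⟨x, hx⟩ := filter_eq_singleton hS h1
  refine ⟨x, ?_⟩
  rw [antisym, hx, Finset.sum_singleton, Omega_single_right_eq hc, Omega_single_left_eq hc,
    filter_erase_ne S (show (b + 1, x).1 ≠ b by simp),
    filter_erase_ne S (show (b + 1, x).1 ≠ b + 2 by simp), Finset.filter_erase, hx]
  simp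

/-- In a collection with one parameter in each color of an interval of at least two colors, the
parameter of the lowest color has antisymmetrised weight `-1`. -/
lemma antisym_below (hc : c ≠ 0) {b hi : ℕ} {S : Coll 𝕜} (hlt : b + 2 < hi)
    (hS : HasCards (ind (b + 1) hi) S) : antisym c (b + 1) S = -1 := by
  obtain ⟨x, hx⟩ := antisym_eq_of_single hc hS (b := b) (by simp [ind]; omega)
  obtain ⟨w, hw⟩ := filter_eq_singleton hS (s := b + 2) (by simp [ind]; omega)
  rw [hx, hw, filter_eq_empty hS (s := b) (by simp [ind])]
  simp only [Finset.prod_empty, Finset.prod_singleton, h]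
  field_simp
  ring

/-- In a collection with one parameter in each color of an interval of at least two colors, the
parameter of the highest color has antisymmetrised weight `1`. -/
lemma antisym_above (hc : c ≠ 0) {b lo : ℕ} {S : Coll 𝕜} (hlt : lo ≤ b)
    (hS : HasCards (ind lo (b + 2)) S) : antisym c (b + 1) S = 1 := by
  obtain ⟨x, hx⟩ := antisym_eq_of_single hc hS (b := b) (by simp [ind]; omega)
  obtain ⟨w, hw⟩ := filter_eq_singleton hS (s := b) (by simp [ind]; omega)
  rw [hx, hw, filter_eq_empty hS (s := b + 2) (by simp [ind])]
  simp only [Finset.prod_empty, Finset.prod_singleton, h]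
  field_simp
  ring

/-- A single parameter without neighbouring colors has antisymmetrised weight `0`. -/
lemma antisym_far (hc : c ≠ 0) {b lo hi : ℕ} {S : Coll 𝕜} (hout : b + 2 < lo ∨ hi < b + 1)
    (hS : HasCards (bump (ind lo hi) (b + 1)) S) : antisym c (b + 1) S = 0 := by
  obtain ⟨x, hx⟩ := antisym_eq_of_single hc hS (b := b) (by simp [bump, ind]; omega)
  rw [hx, filter_eq_empty hS (s := b + 2) (by simp [bump, ind]; omega),
    filter_eq_empty hS (s := b) (by simp [bump, ind]; omega)]
  simp

/-- Two parameters of the same color, with at most one parameter in each neighbouring color: the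
two antisymmetrised weights cancel. -/
lemma antisym_inside (hc : c ≠ 0) {b lo hi : ℕ} {S : Coll 𝕜} (hin : lo ≤ b + 1 ∧ b + 1 < hi)
    (hS : HasCards (bump (ind lo hi) (b + 1)) S) (hp : NoPoles c S) :
    antisym c (b + 1) S = 0 := by
  have h2 := hS (b + 1)
  have h2' : bump (ind lo hi) (b + 1) (b + 1) = 2 := by simp [bump, ind, hin]
  rw [h2', Finset.card_eq_two] at h2
  obtain ⟨⟨a, x⟩, ⟨a', y⟩, hne, hxy⟩ := h2
  have hxm : (a, x) ∈ S.filter (fun p => p.1 = b + 1) := by simp [hxy]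
  have hym : (a', y) ∈ S.filter (fun p => p.1 = b + 1) := by simp [hxy]
  rw [Finset.mem_filter] at hxm hym
  obtain ⟨hxS, rfl : a = b + 1⟩ := hxm
  obtain ⟨hyS, rfl : a' = b + 1⟩ := hym
  have hne' : x ≠ y := fun h => hne (by rw [h])
  have e1 : x - y ≠ 0 := sub_ne_zero.2 hne'
  have e2 : y - x ≠ 0 := sub_ne_zero.2 hne'.symm
  have e3 : x - y + c ≠ 0 := fun h0 => hp _ hyS _ hxS rfl (by linear_combination -h0)
  have e4 : y - x + c ≠ 0 := fun h0 => hp _ hxS _ hyS rfl (by linear_combination -h0)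
  -- with at most one parameter in each of the colors `b` and `b + 2`, the vanishing of this sum is
  -- an identity of rational functions
  have key : antisym c (b + 1) S =
      ((∏ q ∈ S.filter (fun q => q.1 = b), h c x q.2) * (g c y x / h c x y) *
          (∏ q ∈ S.filter (fun q => q.1 = b + 2), (q.2 - x) / c) -
        (∏ q ∈ S.filter (fun q => q.1 = b), (x - q.2) / c) * (g c x y / h c y x) *
          ∏ q ∈ S.filter (fun q => q.1 = b + 2), h c q.2 x) +
      ((∏ q ∈ S.filter (fun q => q.1 = b), h c y q.2) * (g c x y / h c y x) *
          (∏ q ∈ S.filter (fun q => q.1 = b + 2), (q.2 - y) / c) -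
        (∏ q ∈ S.filter (fun q => q.1 = b), (y - q.2) / c) * (g c y x / h c x y) *
          ∏ q ∈ S.filter (fun q => q.1 = b + 2), h c q.2 y) := by
    rw [antisym, hxy, Finset.sum_pair hne]
    simp only [Omega_single_right_eq hc, Omega_single_left_eq hc]
    rw [filter_erase_ne S (show (b + 1, x).1 ≠ b by simp),
      filter_erase_ne S (show (b + 1, x).1 ≠ b + 2 by simp),
      filter_erase_ne S (show (b + 1, y).1 ≠ b by simp),
      filter_erase_ne S (show (b + 1, y).1 ≠ b + 2 by simp), Finset.filter_erase,
      Finset.filter_erase, hxy]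
    have hx1 : ({(b + 1, x), (b + 1, y)} : Coll 𝕜).erase (b + 1, x) = {(b + 1, y)} := by
      rw [Finset.erase_insert (by simpa using hne')]
    have hy1 : ({(b + 1, x), (b + 1, y)} : Coll 𝕜).erase (b + 1, y) = {(b + 1, x)} := by
      rw [Finset.pair_comm, Finset.erase_insert (by simpa using hne'.symm)]
    rw [hx1, hy1]
    simp only [Finset.prod_singleton]
  rw [key]
  have hv : (∃ v, S.filter (fun q => q.1 = b) = {(b, v)}) ∨ S.filter (fun q => q.1 = b) = ∅ := by
    by_cases hl : lo ≤ b
    · exact Or.inl (filter_eq_singleton hS (by simp [bump, ind]; omega))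
    · exact Or.inr (filter_eq_empty hS (by simp [bump, ind]; omega))
  have hw : (∃ w, S.filter (fun q => q.1 = b + 2) = {(b + 2, w)}) ∨
      S.filter (fun q => q.1 = b + 2) = ∅ := by
    by_cases hl : b + 2 < hi
    · exact Or.inl (filter_eq_singleton hS (by simp [bump, ind]; omega))
    · exact Or.inr (filter_eq_empty hS (by simp [bump, ind]; omega))
  rcases hv with ⟨v, hv⟩ | hv <;> rcases hw with ⟨w, hw⟩ | hw <;> rw [hv, hw] <;>
    simp only [Finset.prod_empty, Finset.prod_singleton, h, g] <;> field_simp <;> ring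

end Exchange

/-! ### Sums over partitions and their commutators -/

section Commutator

variable {𝕜 : Type*} [Field 𝕜] {H : Type*} [AddCommGroup H] [Module 𝕜 H]

/-- The coefficient with which a zero mode removes the parameter `p` and leaves `X`; the function
`al` plays the role of `α`. -/
noncomputable def coef (c : 𝕜) (al : ℕ × 𝕜 → 𝕜) (p : ℕ × 𝕜) (X : Coll 𝕜) : 𝕜 :=
  al p * Omega c X {p} - Omega c {p} X

/-- The weight `Ω(X, Y, W) α(W)` of a partition into the parts `X`, `Y`, `W`. -/
noncomputable def wt (c : 𝕜) (al : ℕ × 𝕜 → 𝕜) (X Y W : Coll 𝕜) : 𝕜 :=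
  Omega₃ c X Y W * ∏ p ∈ W, al p

/-- The sum over the partitions of `u` with given cardinalities of the first and the third
part. -/
noncomputable def partSum (c : 𝕜) (al : ℕ × 𝕜 → 𝕜) (B : Coll 𝕜 → H) (r₁ r₃ : ℕ → ℕ)
    (u : Coll 𝕜) : H :=
  ∑ x ∈ parts r₁ r₃ u, wt c al x.1 (u \ (x.1 ∪ x.2)) x.2 • B (u \ (x.1 ∪ x.2))

variable {c : 𝕜} {al : ℕ × 𝕜 → 𝕜} {B : Coll 𝕜 → H}

/-- The coefficient for removing `p` from the whole collection differs from the coefficient for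
removing it from the second part by the terms in which `p` lies in an outer part. -/
lemma coef_mul_wt_sub {p : ℕ × 𝕜} {X Y W : Coll 𝕜} (hX : p ∉ X) (hY : p ∉ Y) (hW : p ∉ W)
    (hXY : Disjoint X Y) (hXW : Disjoint X W) (hYW : Disjoint Y W) :
    coef c al p (X ∪ Y ∪ W) * wt c al X Y W - wt c al X (insert p Y) W * coef c al p Y =
      wt c al X Y (insert p W) * (Omega c W {p} - Omega c {p} W) +
        wt c al (insert p X) Y W * (Omega c X {p} - Omega c {p} X) := by
  have hd : Disjoint (X ∪ Y) W := Finset.disjoint_union_left.2 ⟨hXW, hYW⟩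
  simp only [coef, wt, Omega₃, Omega_union_left hd, Omega_union_left hXY, Omega_union_right _ hd,
    Omega_union_right _ hXY, Omega_insert_left hX, Omega_insert_left hY,
    Omega_insert_right _ hY, Omega_insert_right _ hW, Finset.prod_insert hW]
  ring

/-- The commutator of an operator that removes one parameter of color `a` with the sum over
partitions: the terms in which the removed parameter comes from the second part cancel up to the
antisymmetrised weights of the outer parts. -/
lemma partSum_commutator (Z : H →ₗ[𝕜] H) (a : ℕ) (r₁ r₃ : ℕ → ℕ) (u : Coll 𝕜)
    (hZ : ∀ x ∈ parts r₁ r₃ u, Z (B (u \ (x.1 ∪ x.2))) =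
      ∑ p ∈ (u \ (x.1 ∪ x.2)).filter (fun p => p.1 = a),
        coef c al p ((u \ (x.1 ∪ x.2)).erase p) • B ((u \ (x.1 ∪ x.2)).erase p)) :
    ∑ p ∈ u.filter (fun p => p.1 = a),
        coef c al p (u.erase p) • partSum c al B r₁ r₃ (u.erase p) -
      Z (partSum c al B r₁ r₃ u) =
    ∑ x ∈ parts r₁ (bump r₃ a) u,
        (wt c al x.1 (u \ (x.1 ∪ x.2)) x.2 * antisym c a x.2) • B (u \ (x.1 ∪ x.2)) +
      ∑ x ∈ parts (bump r₁ a) r₃ u,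
        (wt c al x.1 (u \ (x.1 ∪ x.2)) x.2 * antisym c a x.1) • B (u \ (x.1 ∪ x.2)) := by
  have hZS : Z (partSum c al B r₁ r₃ u) =
      ∑ p ∈ u.filter (fun p => p.1 = a), ∑ x ∈ parts r₁ r₃ (u.erase p),
        (wt c al x.1 (u \ (x.1 ∪ x.2)) x.2 * coef c al p ((u \ (x.1 ∪ x.2)).erase p)) •
          B ((u \ (x.1 ∪ x.2)).erase p) := by
    rw [← sum_parts_second r₁ r₃ u a (fun I III p =>
      (wt c al I (u \ (I ∪ III)) III * coef c al p ((u \ (I ∪ III)).erase p)) •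
          B ((u \ (I ∪ III)).erase p)), partSum, map_sum]
    refine Finset.sum_congr rfl fun x hx => ?_
    rw [map_smul, hZ x hx, Finset.smul_sum]
    simp only [smul_smul]
  have h3 := sum_parts_erase_right r₁ r₃ u a (fun I III p =>
    (wt c al I (u \ (I ∪ insert p III)) (insert p III) *
      (Omega c III {p} - Omega c {p} III)) • B (u \ (I ∪ insert p III)))
  have h1 := sum_parts_erase_left r₁ r₃ u a (fun I III p =>
    (wt c al (insert p I) (u \ (insert p I ∪ III)) III *
      (Omega c I {p} - Omega c {p} I)) • B (u \ (insert p I ∪ III)))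
  have e3 : ∑ x ∈ parts r₁ (bump r₃ a) u,
        (wt c al x.1 (u \ (x.1 ∪ x.2)) x.2 * antisym c a x.2) • B (u \ (x.1 ∪ x.2)) =
      ∑ x ∈ parts r₁ (bump r₃ a) u, ∑ p ∈ x.2.filter (fun p => p.1 = a),
        (wt c al x.1 (u \ (x.1 ∪ insert p (x.2.erase p))) (insert p (x.2.erase p)) *
      (Omega c (x.2.erase p) {p} - Omega c {p} (x.2.erase p))) •
          B (u \ (x.1 ∪ insert p (x.2.erase p))) := by
    refine Finset.sum_congr rfl fun x _ => ?_
    rw [antisym, Finset.mul_sum, Finset.sum_smul]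
    refine Finset.sum_congr rfl fun p hp => ?_
    rw [Finset.insert_erase (Finset.mem_filter.1 hp).1]
  have e1 : ∑ x ∈ parts (bump r₁ a) r₃ u,
        (wt c al x.1 (u \ (x.1 ∪ x.2)) x.2 * antisym c a x.1) • B (u \ (x.1 ∪ x.2)) =
      ∑ x ∈ parts (bump r₁ a) r₃ u, ∑ p ∈ x.1.filter (fun p => p.1 = a),
        (wt c al (insert p (x.1.erase p)) (u \ (insert p (x.1.erase p) ∪ x.2)) x.2 *
      (Omega c (x.1.erase p) {p} - Omega c {p} (x.1.erase p))) •
          B (u \ (insert p (x.1.erase p) ∪ x.2)) := by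
    refine Finset.sum_congr rfl fun x _ => ?_
    rw [antisym, Finset.mul_sum, Finset.sum_smul]
    refine Finset.sum_congr rfl fun p hp => ?_
    rw [Finset.insert_erase (Finset.mem_filter.1 hp).1]
  rw [e3, e1, ← h3, ← h1, hZS, ← Finset.sum_sub_distrib, ← Finset.sum_add_distrib]
  refine Finset.sum_congr rfl fun p hp => ?_
  rw [partSum, Finset.smul_sum, ← Finset.sum_sub_distrib, ← Finset.sum_add_distrib]
  refine Finset.sum_congr rfl fun x hx => ?_
  obtain ⟨hI, hIII, hd, -, -⟩ := mem_parts.1 hx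
  obtain ⟨f1, f2, f3, f4⟩ := sdiff_facts hI hIII
  have hpu : p ∈ u := (Finset.mem_filter.1 hp).1
  have hpI := (Finset.subset_erase.1 hI).2
  have hpIII := (Finset.subset_erase.1 hIII).2
  have f5 : u \ (x.1 ∪ x.2) = insert p (u.erase p \ (x.1 ∪ x.2)) := by
    rw [← f1, Finset.insert_erase]
    simp [hpu, hpI, hpIII]
  rw [f1, f2, f3, f5, smul_smul, ← sub_smul, ← add_smul]
  congr 1
  rw [← coef_mul_wt_sub hpI (by simp) hpIII _ hd, ← f4]
  · exact (Finset.disjoint_sdiff.mono_left Finset.subset_union_right).symm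
  · exact Finset.disjoint_sdiff.mono_left Finset.subset_union_left

/-- The sum over partitions that gives the action of `T_{i,j}`, in terms of the collection `u` with
colors `0, …, n`: the first part has one parameter of each color below `i`, the third part one
parameter of each color from `j` on. -/
noncomputable def actSum (c : 𝕜) (al : ℕ × 𝕜 → 𝕜) (B : Coll 𝕜 → H) (n i j : ℕ) (u : Coll 𝕜) : H :=
  partSum c al B (ind 0 i) (ind j (n + 1)) u

/-- The sums over partitions satisfy the commutation relations of the operators `T_{i,j}` with
the zero modes. -/
lemma actSum_commutator (hc : c ≠ 0) (Z : H →ₗ[𝕜] H) {n a i j : ℕ} (ha : 1 ≤ a) (han : a < n)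
    (hj : j ≤ n) {u : Coll 𝕜} (hu : NoPoles c u)
    (hZ : ∀ x ∈ parts (ind 0 i) (ind j (n + 1)) u, Z (B (u \ (x.1 ∪ x.2))) =
      ∑ p ∈ (u \ (x.1 ∪ x.2)).filter (fun p => p.1 = a),
        coef c al p ((u \ (x.1 ∪ x.2)).erase p) • B ((u \ (x.1 ∪ x.2)).erase p)) :
    ∑ p ∈ u.filter (fun p => p.1 = a),
        coef c al p (u.erase p) • actSum c al B n i j (u.erase p) -
      Z (actSum c al B n i j u) =
    (if i = a then actSum c al B n (a + 1) j u else 0) -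
      (if j = a + 1 then actSum c al B n i a u else 0) := by
  obtain ⟨b, rfl⟩ : ∃ b, a = b + 1 := ⟨a - 1, by omega⟩
  simp only [actSum]
  rw [partSum_commutator Z _ _ _ u hZ, add_comm, sub_eq_add_neg]
  congr 1
  · split_ifs with hi
    · subst hi
      rw [bump_ind_right _ _ (Nat.zero_le _), partSum]
      refine Finset.sum_congr rfl fun x hx => ?_
      rw [antisym_above hc (Nat.zero_le _) (mem_parts.1 hx).2.2.2.1, mul_one]
    · refine Finset.sum_eq_zero fun x hx => ?_
      obtain ⟨hI, -, -, h1, -⟩ := mem_parts.1 hx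
      have h0 : antisym c (b + 1) x.1 = 0 := by
        rcases lt_or_gt_of_ne hi with hlt | hlt
        · exact antisym_far hc (Or.inr hlt) h1
        · exact antisym_inside hc ⟨Nat.zero_le _, hlt⟩ h1 (hu.mono hI)
      rw [h0, mul_zero, zero_smul]
  · split_ifs with hi
    · subst hi
      rw [bump_ind_left _ _ (by omega), partSum, ← Finset.sum_neg_distrib]
      refine Finset.sum_congr rfl fun x hx => ?_
      rw [antisym_below hc (by omega) (mem_parts.1 hx).2.2.2.2, mul_neg_one, neg_smul]
    · rw [neg_zero]
      refine Finset.sum_eq_zero fun x hx => ?_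
      obtain ⟨-, hI, -, -, h1⟩ := mem_parts.1 hx
      have h0 : antisym c (b + 1) x.2 = 0 := by
        rcases lt_or_gt_of_ne hi with hlt | hlt
        · exact antisym_inside hc (by omega) h1 (hu.mono hI)
        · exact antisym_far hc (Or.inl hlt) h1
      rw [h0, mul_zero, zero_smul]

end Commutator

/-! ### Strings of equal parameters -/

section Strings

variable {𝕜 : Type*}

/-- The collection with the number `z` in each of the colors `l, …, k - 1`. -/
noncomputable def str (l k : ℕ) (z : 𝕜) : Coll 𝕜 := Finset.Ico l k ×ˢ ({z} : Finset 𝕜)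

lemma extend_eq (t : Coll 𝕜) (l k : ℕ) (z : 𝕜) : extend t l k z = t ∪ str l k z := rfl

lemma mem_str {l k : ℕ} {z : 𝕜} {p : ℕ × 𝕜} : p ∈ str l k z ↔ (l ≤ p.1 ∧ p.1 < k) ∧ p.2 = z := by
  rw [str, Finset.mem_product, Finset.mem_Ico, Finset.mem_singleton]

lemma mem_extend {t : Coll 𝕜} {l k : ℕ} {z : 𝕜} {p : ℕ × 𝕜} :
    p ∈ extend t l k z ↔ p ∈ t ∨ (l ≤ p.1 ∧ p.1 < k) ∧ p.2 = z := by
  rw [extend_eq, Finset.mem_union, mem_str]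

lemma str_succ {l k : ℕ} (hlk : l ≤ k) (z : 𝕜) : str l (k + 1) z = insert (k, z) (str l k z) := by
  ext ⟨s, x⟩
  simp only [mem_str, Finset.mem_insert, Prod.mk.injEq]
  constructor
  · rintro ⟨h1, rfl⟩
    by_cases hs : s = k
    · exact Or.inl ⟨hs, rfl⟩
    · exact Or.inr ⟨⟨h1.1, by omega⟩, rfl⟩
  · rintro (⟨rfl, rfl⟩ | ⟨h1, rfl⟩)
    · exact ⟨⟨hlk, by omega⟩, rfl⟩
    · exact ⟨⟨h1.1, by omega⟩, rfl⟩

lemma str_pred {l k : ℕ} (hlk : l < k) (z : 𝕜) : str l k z = insert (l, z) (str (l + 1) k z) := by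
  ext ⟨s, x⟩
  simp only [mem_str, Finset.mem_insert, Prod.mk.injEq]
  constructor
  · rintro ⟨h1, rfl⟩
    by_cases hs : s = l
    · exact Or.inl ⟨hs, rfl⟩
    · exact Or.inr ⟨⟨by omega, h1.2⟩, rfl⟩
  · rintro (⟨rfl, rfl⟩ | ⟨h1, rfl⟩)
    · exact ⟨⟨le_rfl, hlk⟩, rfl⟩
    · exact ⟨⟨by omega, h1.2⟩, rfl⟩

lemma str_self (l : ℕ) (z : 𝕜) : str l l z = ∅ := by
  simp [str]

lemma str_disjoint {l k l' k' : ℕ} (z : 𝕜) (h : k ≤ l') : Disjoint (str l k z) (str l' k' z) := by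
  refine Finset.disjoint_left.2 fun p hp hp' => ?_
  rw [mem_str] at hp hp'
  omega

lemma str_union {l k m : ℕ} (z : 𝕜) (h : l ≤ k) (h' : k ≤ m) :
    str l k z ∪ str k m z = str l m z := by
  ext p
  simp only [Finset.mem_union, mem_str]
  constructor
  · rintro (⟨h1, h2⟩ | ⟨h1, h2⟩) <;> exact ⟨by omega, h2⟩
  · rintro ⟨h1, h2⟩
    by_cases hp : p.1 < k
    · exact Or.inl ⟨by omega, h2⟩
    · exact Or.inr ⟨by omega, h2⟩

lemma disjoint_str {X : Coll 𝕜} {z : 𝕜} (hX : ∀ p ∈ X, p.2 ≠ z) (l k : ℕ) :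
    Disjoint X (str l k z) :=
  Finset.disjoint_left.2 fun p hp hp' => hX p hp (mem_str.1 hp').2

lemma card_color (X : Coll 𝕜) (s : ℕ) :
    (color X s).card = (X.filter fun p => p.1 = s).card := by
  refine Finset.card_image_of_injOn fun p hp q hq hpq => ?_
  simp only [Finset.coe_filter, Set.mem_ofPred_eq] at hp hq
  exact Prod.ext (hp.2.trans hq.2.symm) hpq

lemma mem_extend_of_mem_extend_full {n : ℕ} {t : Coll 𝕜} {z : 𝕜} {p : ℕ × 𝕜}
    (hp : p ∈ extend t 0 (n + 1) z) (h0 : p ≠ (0, z)) (hn : p ≠ (n, z)) :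
    p ∈ extend t 1 n z := by
  rw [mem_extend] at hp ⊢
  rcases hp with hp | ⟨hp, hz⟩
  · exact Or.inl hp
  · refine Or.inr ⟨⟨?_, ?_⟩, hz⟩
    · by_contra hcon
      exact h0 (Prod.ext (by simp; omega) hz)
    · by_contra hcon
      exact hn (Prod.ext (by simp; omega) hz)

lemma zero_mem_of_hasCards {i j : ℕ} (hi : 1 ≤ i) {z : 𝕜} {t I : Coll 𝕜}
    (ht : ∀ p ∈ t, 1 ≤ p.1) (hI : HasCards (ind 0 i) I) (hIt : I ⊆ extend t 0 j z) :
    (0, z) ∈ I := by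
  obtain ⟨x, hx⟩ := filter_eq_singleton hI (s := 0) (by simp [ind]; omega)
  have hm : (0, x) ∈ I := by
    have : (0, x) ∈ I.filter (fun q => q.1 = 0) := by rw [hx]; simp
    exact (Finset.mem_filter.1 this).1
  rcases mem_extend.1 (hIt hm) with h0 | h0
  · exact absurd (ht _ h0) (by simp)
  · obtain ⟨-, rfl⟩ := h0
    exact hm

lemma top_mem_of_hasCards {n j : ℕ} (hj : j ≤ n) {z : 𝕜} {t I : Coll 𝕜}
    (ht : ∀ p ∈ t, p.1 < n) (hI : HasCards (ind j (n + 1)) I) (hIt : I ⊆ extend t 0 (n + 1) z) :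
    (n, z) ∈ I := by
  obtain ⟨x, hx⟩ := filter_eq_singleton hI (s := n) (by simp [ind]; omega)
  have hm : (n, x) ∈ I := by
    have : (n, x) ∈ I.filter (fun q => q.1 = n) := by rw [hx]; simp
    exact (Finset.mem_filter.1 this).1
  rcases mem_extend.1 (hIt hm) with h0 | h0
  · exact absurd (ht _ h0) (by simp)
  · obtain ⟨-, rfl⟩ := h0
    exact hm

lemma color_eq_empty {X : Coll 𝕜} {s : ℕ} (hX : ∀ p ∈ X, p.1 ≠ s) : color X s = ∅ := by
  simp only [color, Finset.image_eq_empty, Finset.filter_eq_empty_iff]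
  exact fun p hp => hX p hp

lemma extend_comm (t : Coll 𝕜) (l k l' k' : ℕ) (z w : 𝕜) :
    extend (extend t l k z) l' k' w = extend (extend t l' k' w) l k z := by
  simp only [extend_eq, Finset.union_assoc]
  rw [Finset.union_comm (str l k z)]

lemma extend_erase_of_ne {t : Coll 𝕜} {l k : ℕ} {w : 𝕜} {p : ℕ × 𝕜} (hp : p.2 ≠ w) :
    (extend t l k w).erase p = extend (t.erase p) l k w := by
  rw [extend_eq, extend_eq, Finset.erase_union_distrib, Finset.erase_eq_of_notMem (s := str l k w)]
  exact fun h => hp (mem_str.1 h).2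

lemma extend_erase_self {t : Coll 𝕜} {a l k l' k' : ℕ} {w : 𝕜} (ht : ∀ p ∈ t, p.2 ≠ w)
    (hstr : str l k w = insert (a, w) (str l' k' w)) (hb : (a, w) ∉ str l' k' w) :
    (extend t l k w).erase (a, w) = extend t l' k' w := by
  have h1 : (a, w) ∉ t := fun h => ht _ h rfl
  rw [extend_eq, extend_eq, Finset.erase_union_distrib, Finset.erase_eq_of_notMem h1, hstr,
    Finset.erase_insert hb]

end Strings

/-! ### Interactions with strings of equal parameters -/

section StringProducts

variable {𝕜 : Type*} [Field 𝕜] {c : 𝕜}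

lemma prod_color (X : Coll 𝕜) (s : ℕ) (F : 𝕜 → 𝕜) :
    ∏ x ∈ color X s, F x = ∏ p ∈ X, if p.1 = s then F p.2 else 1 := by
  rw [color, Finset.prod_image, Finset.prod_filter]
  intro p hp q hq hpq
  simp only [Finset.coe_filter, Set.mem_ofPred_eq] at hp hq
  exact Prod.ext (hp.2.trans hq.2.symm) hpq

lemma psi_eq_prod (l : ℕ) (hl : 1 ≤ l) (z : 𝕜) (X : Coll 𝕜) :
    psi c l z X =
      ∏ q ∈ X, if q.1 = l then h c q.2 z else if q.1 + 1 = l then g c z q.2 else 1 := by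
  rw [psi, setProd, setProd, Finset.prod_singleton]
  simp only [Finset.prod_singleton]
  rw [prod_color X l (fun x => h c x z), prod_color X (l - 1) (fun x => g c z x),
    ← Finset.prod_mul_distrib]
  refine Finset.prod_congr rfl fun q _ => ?_
  split_ifs <;> first | omega | simp

lemma phi_eq_prod (k : ℕ) (hk : 1 ≤ k) (z : 𝕜) (X : Coll 𝕜) :
    phi c k z X =
      ∏ q ∈ X, if q.1 = k then g c q.2 z else if q.1 + 1 = k then h c z q.2 else 1 := by
  rw [phi, setProd, setProd, Finset.prod_singleton]
  simp only [Finset.prod_singleton]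
  rw [prod_color X k (fun x => g c x z), prod_color X (k - 1) (fun x => h c z x),
    ← Finset.prod_mul_distrib]
  refine Finset.prod_congr rfl fun q _ => ?_
  split_ifs <;> first | omega | simp

/-- The initial string of `z` acts on a parameter through its two ends only. -/
lemma Omega_str_left_single (hc : c ≠ 0) {q : ℕ × 𝕜} {z : 𝕜} (h1 : 1 ≤ q.1) (hz : q.2 ≠ z)
    (hz' : z - q.2 ≠ c) {l : ℕ} (hl : 1 ≤ l) :
    Omega c (str 0 l z) {q} =
      if q.1 = l then h c q.2 z else if q.1 + 1 = l then g c z q.2 else 1 := by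
  obtain ⟨a, x⟩ := q
  simp only at h1 hz hz' ⊢
  have hx0 : h c x z ≠ 0 := h_ne_zero hc hz'
  induction l, hl using Nat.le_induction with
  | base =>
    rw [str_succ le_rfl, str_self, insert_empty_eq, Omega_single_left, Finset.prod_singleton]
    by_cases ha : a = 1
    · subst ha
      simpa using gam_succ hc 0 z x
    · rw [if_neg ha, if_neg (by omega)]
      exact gam_far _ _ (by simp; omega) (by simpa using ha) (by simp)
  | succ l hl ih =>
    rw [str_succ (Nat.zero_le _), Omega_insert_left (by simp [mem_str]), ih,
      Omega_single_left, Finset.prod_singleton]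
    simp only
    by_cases e1 : a = l
    · subst e1
      rw [gam_same, if_pos rfl, if_neg (by omega), if_pos rfl]
      field_simp
    by_cases e2 : a = l + 1
    · subst e2
      rw [gam_succ hc, if_neg (by omega), if_neg (by omega), if_pos rfl, mul_one]
    by_cases e3 : a + 1 = l
    · subst e3
      have : z - x ≠ 0 := sub_ne_zero.2 hz.symm
      rw [gam_pred, if_neg (by omega), if_pos rfl, if_neg (by omega), if_neg (by omega), g]
      field_simp
    · rw [gam_far _ _ (Ne.symm e1) e2 (Ne.symm e3), if_neg e1, if_neg e3, if_neg e2,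
        if_neg (by omega), mul_one]

/-- The final string of `z` acts on a parameter through its two ends only. -/
lemma Omega_str_right_single (hc : c ≠ 0) {n : ℕ} {q : ℕ × 𝕜} {z : 𝕜} (h1 : q.1 < n)
    (hz : q.2 ≠ z) (hz' : q.2 - z ≠ c) {k : ℕ} (hk : k ≤ n) :
    Omega c {q} (str k (n + 1) z) =
      if q.1 = k then g c q.2 z else if q.1 + 1 = k then h c z q.2 else 1 := by
  obtain ⟨a, x⟩ := q
  simp only at h1 hz hz' ⊢
  have hx0 : h c z x ≠ 0 := h_ne_zero hc hz'
  induction hk using Nat.decreasingInduction with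
  | self =>
    rw [str_succ le_rfl, str_self, insert_empty_eq, Omega_single_left, Finset.prod_singleton]
    simp only
    rw [if_neg (by omega)]
    by_cases ha : a + 1 = n
    · subst ha
      rw [gam_succ hc, if_pos rfl]
    · rw [gam_far _ _ (by omega) (by omega) (by omega), if_neg ha]
  | of_succ k hk ih =>
    rw [str_pred (by omega), Omega_insert_right _ (by simp [mem_str]), ih,
      Omega_single_left, Finset.prod_singleton]
    simp only
    by_cases e1 : a = k
    · subst e1
      rw [gam_same, if_pos rfl, if_neg (by omega), if_pos rfl]
      field_simp
    by_cases e2 : a + 1 = k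
    · subst e2
      rw [gam_succ hc, if_neg (by omega), if_neg (by omega), if_pos rfl, mul_one,
        if_neg (by omega)]
    by_cases e3 : a = k + 1
    · subst e3
      have : x - z ≠ 0 := sub_ne_zero.2 hz
      rw [gam_pred, if_pos rfl, if_neg (by omega), if_neg (by omega), g]
      field_simp
    · rw [gam_far _ _ e1 (by omega) e3, if_neg e1, if_neg e2, if_neg e3,
        if_neg (by omega), mul_one]

/-- `X` has colors in `{1, …, n - 1}` and none of its parameters coincides with `z` or differs
from it by `c`. -/
def Away (c : 𝕜) (n : ℕ) (z : 𝕜) (X : Coll 𝕜) : Prop :=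
  ∀ p ∈ X, (1 ≤ p.1 ∧ p.1 < n) ∧ p.2 ≠ z ∧ p.2 - z ≠ c ∧ z - p.2 ≠ c

lemma Away.mono {n : ℕ} {z : 𝕜} {X Y : Coll 𝕜} (h : Away c n z Y) (hXY : X ⊆ Y) : Away c n z X :=
  fun p hp => h p (hXY hp)

lemma psi_eq_Omega (hc : c ≠ 0) {n l : ℕ} {z : 𝕜} {X : Coll 𝕜} (hX : Away c n z X) (hl : 1 ≤ l) :
    Omega c (str 0 l z) X = psi c l z X := by
  rw [psi_eq_prod l hl, Omega_eq_prod_right]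
  refine Finset.prod_congr rfl fun q hq => ?_
  obtain ⟨h1, h2, h3, h4⟩ := hX q hq
  exact Omega_str_left_single hc h1.1 h2 h4 hl

lemma phi_eq_Omega (hc : c ≠ 0) {n k : ℕ} {z : 𝕜} {X : Coll 𝕜} (hX : Away c n z X) (hk : 1 ≤ k)
    (hkn : k ≤ n) : Omega c X (str k (n + 1) z) = phi c k z X := by
  rw [phi_eq_prod k hk, Omega_eq_prod_left]
  refine Finset.prod_congr rfl fun q hq => ?_
  obtain ⟨h1, h2, h3, h4⟩ := hX q hq
  exact Omega_str_right_single hc h1.2 h2 h3 hkn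

/-- A string of all colors `0, …, n` does not interact with the parameters of the colors
`1, …, n - 1`. -/
lemma Omega_full_left (hc : c ≠ 0) {n : ℕ} {z : 𝕜} {X : Coll 𝕜} (hX : Away c n z X) :
    Omega c (str 0 (n + 1) z) X = 1 := by
  rw [psi_eq_Omega hc hX (by omega), psi_eq_prod _ (by omega)]
  refine Finset.prod_eq_one fun q hq => ?_
  have := (hX q hq).1
  rw [if_neg (by omega), if_neg (by omega)]

lemma Omega_full_right (hc : c ≠ 0) {n : ℕ} {z : 𝕜} {X : Coll 𝕜} (hX : Away c n z X) :
    Omega c X (str 0 (n + 1) z) = 1 := by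
  rw [Omega_eq_prod_left]
  refine Finset.prod_eq_one fun q hq => ?_
  obtain ⟨h1, h2, h3, h4⟩ := hX q hq
  rw [Omega_str_right_single hc h1.2 h2 h3 (Nat.zero_le n), if_neg (by omega), if_neg (by omega)]

/-- `ψ_1` is the interaction with `z` placed in color `0`. -/
lemma Omega_zero_left (hc : c ≠ 0) {z : 𝕜} {X : Coll 𝕜} (hX : ∀ p ∈ X, 1 ≤ p.1) :
    Omega c {(0, z)} X = psi c 1 z X := by
  rw [psi_eq_prod 1 le_rfl, Omega_single_left]
  refine Finset.prod_congr rfl fun q hq => ?_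
  have h1 := hX q hq
  by_cases e : q.1 = 1
  · rw [if_pos e, e]
    exact gam_succ hc 0 z q.2
  · rw [if_neg e, if_neg (by omega)]
    exact gam_far _ _ (by simp; omega) (by simpa using e) (by simp)

/-- `φ_n` is the interaction with `z` placed in color `n`. -/
lemma Omega_top_right (hc : c ≠ 0) {n : ℕ} {z : 𝕜} {X : Coll 𝕜} (hX : ∀ p ∈ X, 1 ≤ p.1 ∧ p.1 < n) :
    Omega c X {(n, z)} = phi c n z X := by
  by_cases hn : 1 ≤ n
  · rw [phi_eq_prod n hn, Omega_single_right]
    refine Finset.prod_congr rfl fun q hq => ?_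
    have h1 := hX q hq
    rw [if_neg (by omega)]
    by_cases e : q.1 + 1 = n
    · rw [if_pos e, ← e]
      exact gam_succ hc q.1 q.2 z
    · rw [if_neg e]
      exact gam_far _ _ (by simp; omega) (by simp; omega) (by simp; omega)
  · have : X = ∅ := Finset.eq_empty_iff_forall_notMem.2 fun p hp => by have := hX p hp; omega
    subst this
    simp [phi, setProd, color]

lemma psi_union (l : ℕ) (hl : 1 ≤ l) (z : 𝕜) {X Y : Coll 𝕜} (hXY : Disjoint X Y) :
    psi c l z (X ∪ Y) = psi c l z X * psi c l z Y := by
  simp only [psi_eq_prod l hl, Finset.prod_union hXY]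

lemma phi_union (l : ℕ) (hl : 1 ≤ l) (z : 𝕜) {X Y : Coll 𝕜} (hXY : Disjoint X Y) :
    phi c l z (X ∪ Y) = phi c l z X * phi c l z Y := by
  simp only [phi_eq_prod l hl, Finset.prod_union hXY]

/-- The copies of `z` do not contribute to `ψ_1(z)`, because `h(z, z) = 1`. -/
lemma psi_one_str (hc : c ≠ 0) (z : 𝕜) {n : ℕ} : psi c 1 z (str 1 n z) = 1 := by
  rw [psi_eq_prod 1 le_rfl]
  refine Finset.prod_eq_one fun q hq => ?_
  rw [mem_str] at hq
  split_ifs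
  · rw [hq.2, h_self hc]
  · omega
  · rfl

lemma phi_top_str (hc : c ≠ 0) (z : 𝕜) {n : ℕ} (hn : 1 ≤ n) : phi c n z (str 1 n z) = 1 := by
  rw [phi_eq_prod n hn]
  refine Finset.prod_eq_one fun q hq => ?_
  rw [mem_str] at hq
  split_ifs
  · omega
  · rw [hq.2, h_self hc]
  · rfl

@[simp] lemma psi_empty (l : ℕ) (z : 𝕜) : psi c l z ∅ = 1 := by
  simp [psi, setProd, color]

@[simp] lemma phi_empty (l : ℕ) (z : 𝕜) : phi c l z ∅ = 1 := by
  simp [phi, setProd, color]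

end StringProducts

/-! ### Commutators with the zero modes -/

namespace Model

variable {𝕜 : Type*} [NontriviallyNormedField 𝕜] {H : Type*} [AddCommGroup H]
    [Module 𝕜 H] [TopologicalSpace H] {n : ℕ} {c : 𝕜} (M : Model 𝕜 H n c)

section ZeroModes

variable [IsTopologicalAddGroup H]

lemma eventually_ne_at_infinity (u : 𝕜) : ∀ᶠ v in Bornology.cobounded 𝕜, v ≠ u :=
  Bornology.isBounded_def.1 (Bornology.isBounded_singleton (x := u))

lemma tendsto_T {i j : ℕ} (hi : i ∈ Finset.Icc 1 n) (hj : j ∈ Finset.Icc 1 n) (x : H) :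
    Tendsto (fun v => M.T i j v x) (Bornology.cobounded 𝕜) (𝓝 (if i = j then x else 0)) := by
  have h0 := M.expansion i hi j hj 0 x
  simp only [pow_zero, Finset.range_zero, Finset.sum_empty, sub_zero, one_smul] at h0
  simpa using h0.add_const (if i = j then x else 0)

/-- The first order of the expansion at infinity: the zero mode as a limit. -/
lemma tendsto_mode_zero (hc : c ≠ 0) {i j : ℕ} (hi : i ∈ Finset.Icc 1 n)
    (hj : j ∈ Finset.Icc 1 n) (x : H) :
    Tendsto (fun v => (v / c) • (M.T i j v x - if i = j then x else 0))
      (Bornology.cobounded 𝕜) (𝓝 (M.mode i j 0 x)) := by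
  have h0 := (M.expansion i hi j hj 1 x).add_const (M.mode i j 0 x)
  rw [zero_add] at h0
  refine h0.congr' ?_
  filter_upwards [eventually_ne_at_infinity (0 : 𝕜)] with v hv
  have hvc : v / c ≠ 0 := div_ne_zero hv hc
  rw [Finset.sum_range_one, zero_add, pow_one, smul_sub (v / c) (_ - _), smul_smul,
    mul_inv_cancel₀ hvc, one_smul, sub_add_cancel]

lemma tendsto_div_sub (u : 𝕜) :
    Tendsto (fun v : 𝕜 => v / (u - v)) (Bornology.cobounded 𝕜) (𝓝 (-1)) := by
  have h1 : Tendsto (fun v : 𝕜 => u - v) (Bornology.cobounded 𝕜) (Bornology.cobounded 𝕜) :=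
    tendsto_const_sub_cobounded u
  have h2 := ((tendsto_inv₀_cobounded (α := 𝕜)).comp h1).const_mul u |>.const_add (-1)
  rw [mul_zero, add_zero] at h2
  refine h2.congr' ?_
  filter_upwards [eventually_ne_at_infinity u] with v hv
  have : u - v ≠ 0 := sub_ne_zero.2 hv.symm
  simp only [Function.comp]
  field_simp
  ring

/-- The leading order of the `RTT` relation at infinity: the commutator of the monodromy matrix
with the zero modes. -/
lemma commutator_zeroMode [ContinuousSMul 𝕜 H] [T2Space H] (hc : c ≠ 0) {i j a : ℕ}
    (hi : i ∈ Finset.Icc 1 n)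
    (hj : j ∈ Finset.Icc 1 n) (ha : 1 ≤ a) (han : a < n) {u : 𝕜} (hu : u ∈ M.dom) (x : H) :
    M.T i j u (M.mode (a + 1) a 0 x) - M.mode (a + 1) a 0 (M.T i j u x) =
      (if i = a then M.T (a + 1) j u x else 0) - (if j = a + 1 then M.T i a u x else 0) := by
  have ha' : a ∈ Finset.Icc 1 n := Finset.mem_Icc.2 ⟨ha, han.le⟩
  have ha1 : a + 1 ∈ Finset.Icc 1 n := Finset.mem_Icc.2 ⟨by omega, han⟩
  have hL := (((M.T i j u).continuous.tendsto _).comp (M.tendsto_mode_zero hc ha1 ha' x)).sub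
    (M.tendsto_mode_zero hc ha1 ha' (M.T i j u x))
  have hR := (tendsto_div_sub u).smul ((M.tendsto_T ha1 hj (M.T i a u x)).sub
    (((M.T (a + 1) j u).continuous.tendsto _).comp (M.tendsto_T hi ha' x)))
  have hEq : ∀ᶠ v in Bornology.cobounded 𝕜,
      (M.T i j u ((v / c) • (M.T (a + 1) a v x - if a + 1 = a then x else 0)) -
        (v / c) • (M.T (a + 1) a v (M.T i j u x) - if a + 1 = a then M.T i j u x else 0)) =
      (v / (u - v)) • (M.T (a + 1) j v (M.T i a u x) - M.T (a + 1) j u (M.T i a v x)) := by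
    filter_upwards [M.dom_mem, eventually_ne_at_infinity u] with v hv hvu
    have hr := M.rtt i hi j hj (a + 1) ha1 a ha' u hu v hv hvu.symm x
    have huv : u - v ≠ 0 := sub_ne_zero.2 hvu.symm
    rw [if_neg (by omega), if_neg (by omega), sub_zero, sub_zero, map_smul, ← smul_sub, hr,
      smul_smul]
    congr 1
    field_simp
  have hlim := tendsto_nhds_unique (hL.congr' hEq) hR
  rw [hlim, neg_one_smul, neg_sub]
  congr 1
  · split_ifs <;> simp
  · simp only [eq_comm]

end ZeroModes

end Model

/-! ### The defect of the action formula -/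

namespace Model

variable {𝕜 : Type*} [NontriviallyNormedField 𝕜] {H : Type*} [AddCommGroup H]
    [Module 𝕜 H] [TopologicalSpace H] {n : ℕ} {c : 𝕜} (M : Model 𝕜 H n c)

/-- The collections `t̄` on which `T_{1,n}(z)` acts by the extension with `z`. -/
def Extendable (z : 𝕜) (t : Coll 𝕜) : Prop :=
  M.Regular (extend t 1 n z) ∧ ∀ p ∈ t, p.2 ≠ z

variable {M}

lemma Regular.mono {t t' : Coll 𝕜} (ht : M.Regular t) (h : t' ⊆ t) : M.Regular t' :=
  ⟨fun p hp => ht.1 p (h hp), fun p hp q hq => ht.2 p (h hp) q (h hq)⟩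

lemma Regular.color {t : Coll 𝕜} (ht : M.Regular t) {p : ℕ × 𝕜} (hp : p ∈ t) :
    1 ≤ p.1 ∧ p.1 < n := by
  have := Finset.mem_Icc.1 (ht.1 p hp).1
  omega

lemma Extendable.mono {z : 𝕜} {t t' : Coll 𝕜} (ht : M.Extendable z t) (h : t' ⊆ t) :
    M.Extendable z t' :=
  ⟨ht.1.mono (Finset.union_subset_union_left h), fun p hp => ht.2 p (h hp)⟩

lemma Extendable.color {z : 𝕜} {t : Coll 𝕜} (ht : M.Extendable z t) {p : ℕ × 𝕜} (hp : p ∈ t) :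
    1 ≤ p.1 ∧ p.1 < n :=
  ht.1.color (mem_extend.2 (Or.inl hp))

lemma Extendable.regular {z : 𝕜} {t : Coll 𝕜} (ht : M.Extendable z t) : M.Regular t :=
  ht.1.mono Finset.subset_union_left

lemma Extendable.mem_dom {z : 𝕜} {t : Coll 𝕜} (ht : M.Extendable z t) (hn : 2 ≤ n) : z ∈ M.dom :=
  (ht.1.1 (1, z) (mem_extend.2 (Or.inr ⟨⟨le_rfl, hn⟩, rfl⟩))).2

lemma Extendable.away {z : 𝕜} {t : Coll 𝕜} (ht : M.Extendable z t) : Away c n z t := by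
  intro p hp
  have h1 := ht.color hp
  have hz : (p.1, z) ∈ extend t 1 n z := mem_extend.2 (Or.inr ⟨h1, rfl⟩)
  have hp' : p ∈ extend t 1 n z := mem_extend.2 (Or.inl hp)
  exact ⟨h1, ht.2 p hp, ht.1.2 p hp' _ hz rfl, ht.1.2 _ hz p hp' rfl⟩

lemma Extendable.noPoles (hc : c ≠ 0) {z : 𝕜} {t : Coll 𝕜} (ht : M.Extendable z t) :
    NoPoles c (extend t 0 (n + 1) z) := by
  intro p hp q hq hpq
  rw [mem_extend] at hp hq
  rcases hp with hp | hp <;> rcases hq with hq | hq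
  · exact ht.regular.2 p hp q hq hpq
  · rw [hq.2]
    exact (ht.away p hp).2.2.1
  · rw [hp.2]
    exact (ht.away q hq).2.2.2
  · rw [hp.2, hq.2, sub_self]
    exact hc.symm

variable (M) in
/-- The function `α`, with the value `1` on the color `n`. -/
noncomputable def alphaHat (p : ℕ × 𝕜) : 𝕜 := if p.1 = n then 1 else M.alpha p.1 p.2

lemma prod_alphaHat {X : Coll 𝕜} (hX : ∀ p ∈ X, p.1 < n) :
    ∏ p ∈ X, M.alphaHat p = M.alphaProd X :=
  Finset.prod_congr rfl fun p hp => if_neg (hX p hp).ne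

lemma coef_extend (hc : c ≠ 0) {z : 𝕜} {t : Coll 𝕜} (ht : M.Extendable z t) {p : ℕ × 𝕜}
    (hp : p ∈ t) (al : ℕ × 𝕜 → 𝕜) :
    coef c al p ((extend t 0 (n + 1) z).erase p) = coef c al p (t.erase p) := by
  have hps : Away c n z {p} := ht.away.mono (Finset.singleton_subset_iff.2 hp)
  have hd : Disjoint (t.erase p) (str 0 (n + 1) z) :=
    disjoint_str (fun q hq => ht.2 q (Finset.mem_of_mem_erase hq)) _ _
  have he : (extend t 0 (n + 1) z).erase p = t.erase p ∪ str 0 (n + 1) z := by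
    rw [extend_eq, Finset.erase_union_distrib, Finset.erase_eq_of_notMem (s := str 0 (n + 1) z)]
    exact fun h => ht.2 p hp (mem_str.1 h).2
  rw [he, coef, coef, Omega_union_left hd, Omega_union_right _ hd, Omega_full_left hc hps,
    Omega_full_right hc hps, mul_one, mul_one]

/-- The added parameter `z` of color `a` is not removed by a zero mode: the neighbouring colors
contain `z` as well. -/
lemma coef_extend_self {z : 𝕜} {t : Coll 𝕜} {a : ℕ} (ha : 1 ≤ a) (han : a < n)
    (al : ℕ × 𝕜 → 𝕜) :
    coef c al (a, z) ((extend t 0 (n + 1) z).erase (a, z)) = 0 := by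
  obtain ⟨b, rfl⟩ : ∃ b, a = b + 1 := ⟨a - 1, by omega⟩
  have h1 : Omega c ((extend t 0 (n + 1) z).erase (b + 1, z)) {(b + 1, z)} = 0 :=
    Omega_eq_zero (a := b + 1) (z := z)
      (Finset.mem_erase.2 ⟨by simp, mem_extend.2 (Or.inr ⟨by simp; omega, rfl⟩)⟩) (by simp)
  have h2 : Omega c {(b + 1, z)} ((extend t 0 (n + 1) z).erase (b + 1, z)) = 0 :=
    Omega_eq_zero (a := b) (z := z) (by simp)
      (Finset.mem_erase.2 ⟨by simp, mem_extend.2 (Or.inr ⟨by simp; omega, rfl⟩)⟩)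
  rw [coef, h1, h2, mul_zero, sub_zero]

/-- The second part of a partition of the collection with `z` in all colors `0, …, n` consists of
Bethe parameters with colors in `{1, …, n - 1}`. -/
lemma second_subset {i j : ℕ} (hi : 1 ≤ i) (hj : j ≤ n) {z : 𝕜} {t : Coll 𝕜}
    (ht : M.Extendable z t) {x : Coll 𝕜 × Coll 𝕜}
    (hx : x ∈ parts (ind 0 i) (ind j (n + 1)) (extend t 0 (n + 1) z)) :
    extend t 0 (n + 1) z \ (x.1 ∪ x.2) ⊆ extend t 1 n z := by
  obtain ⟨hI, hIII, -, h1, h3⟩ := mem_parts.1 hx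
  intro p hp
  rw [Finset.mem_sdiff, Finset.mem_union, not_or] at hp
  refine mem_extend_of_mem_extend_full hp.1 ?_ ?_
  · rintro rfl
    exact hp.2.1 (zero_mem_of_hasCards hi (fun p hp => (ht.color hp).1) h1 hI)
  · rintro rfl
    exact hp.2.2 (top_mem_of_hasCards hj (fun p hp => (ht.color hp).2) h3 hIII)

variable {B : Coll 𝕜 → H}

lemma IsOffShell.zeroMode_eq (hB : M.IsOffShell B) {t : Coll 𝕜} (ht : M.Regular t) {a : ℕ}
    (ha : 1 ≤ a) (han : a < n) :
    M.mode (a + 1) a 0 (B t) = ∑ p ∈ t.filter (fun p => p.1 = a),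
      coef c M.alphaHat p (t.erase p) • B (t.erase p) := by
  rw [hB.zeroMode t ht a (Finset.mem_Icc.2 ⟨ha, by omega⟩)]
  refine Finset.sum_congr rfl fun p hp => ?_
  have hpa := (Finset.mem_filter.1 hp).2
  rw [coef, alphaHat, if_neg (by omega), hpa]

variable (M) in
/-- The right hand side of the action formula, in terms of the collection with `z` added to all
colors `0, …, n`. -/
noncomputable def actionHat (B : Coll 𝕜 → H) (i j : ℕ) (z : 𝕜) (t : Coll 𝕜) : H :=
  M.lam n z • actSum c M.alphaHat B n i j (extend t 0 (n + 1) z)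

lemma actionHat_commutator (hc : c ≠ 0) (hB : M.IsOffShell B) {i j a : ℕ} (hi : 1 ≤ i)
    (hj : j ≤ n) (ha : 1 ≤ a) (han : a < n) {z : 𝕜} {t : Coll 𝕜} (ht : M.Extendable z t) :
    ∑ p ∈ t.filter (fun p => p.1 = a),
        coef c M.alphaHat p (t.erase p) • M.actionHat B i j z (t.erase p) -
      M.mode (a + 1) a 0 (M.actionHat B i j z t) =
    (if i = a then M.actionHat B (a + 1) j z t else 0) -
      (if j = a + 1 then M.actionHat B i a z t else 0) := by
  have key := actSum_commutator (B := B) (al := M.alphaHat) (i := i) (j := j) hc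
    (M.mode (a + 1) a 0) ha han hj (ht.noPoles hc) fun x hx =>
      hB.zeroMode_eq (ht.1.mono (second_subset hi hj ht hx)) ha han
  have hsum : ∑ p ∈ (extend t 0 (n + 1) z).filter (fun p => p.1 = a),
        coef c M.alphaHat p ((extend t 0 (n + 1) z).erase p) •
          actSum c M.alphaHat B n i j ((extend t 0 (n + 1) z).erase p) =
      ∑ p ∈ t.filter (fun p => p.1 = a), coef c M.alphaHat p (t.erase p) •
          actSum c M.alphaHat B n i j (extend (t.erase p) 0 (n + 1) z) := by
    have hsub : t ⊆ extend t 0 (n + 1) z := Finset.subset_union_left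
    rw [← Finset.sum_subset (Finset.filter_subset_filter _ hsub)]
    · refine Finset.sum_congr rfl fun p hp => ?_
      have hpt := (Finset.mem_filter.1 hp).1
      rw [coef_extend hc ht hpt]
      congr 2
      rw [extend_eq, extend_eq, Finset.erase_union_distrib,
        Finset.erase_eq_of_notMem (s := str 0 (n + 1) z)]
      exact fun h => ht.2 p hpt (mem_str.1 h).2
    · intro p hp hpt
      rw [Finset.mem_filter] at hp hpt
      rcases mem_extend.1 hp.1 with h0 | h0
      · exact absurd ⟨h0, hp.2⟩ hpt
      · have : p = (a, z) := Prod.ext hp.2 h0.2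
        rw [this, coef_extend_self ha han, zero_smul]
  rw [hsum] at key
  have key' := congrArg (fun x => M.lam n z • x) key
  simp only [smul_sub, Finset.smul_sum, ← map_smul, smul_comm (M.lam n z), smul_ite,
    smul_zero] at key'
  exact key'

variable (M) in
/-- The defect of the action formula: the difference of its two sides. -/
noncomputable def defect (B : Coll 𝕜 → H) (i j : ℕ) (z : 𝕜) (t : Coll 𝕜) : H :=
  M.T i j z (B t) - M.actionHat B i j z t

/-- Both sides of the action formula have the same commutators with the zero modes. -/
lemma defect_commutator [IsTopologicalAddGroup H] [ContinuousSMul 𝕜 H] [T2Space H] (hc : c ≠ 0)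
    (hB : M.IsOffShell B) {i j a : ℕ} (hi : i ∈ Finset.Icc 1 n) (hj : j ∈ Finset.Icc 1 n)
    (ha : 1 ≤ a) (han : a < n) {z : 𝕜} {t : Coll 𝕜} (ht : M.Extendable z t) :
    ∑ p ∈ t.filter (fun p => p.1 = a),
        coef c M.alphaHat p (t.erase p) • M.defect B i j z (t.erase p) -
      M.mode (a + 1) a 0 (M.defect B i j z t) =
    (if i = a then M.defect B (a + 1) j z t else 0) -
      (if j = a + 1 then M.defect B i a z t else 0) := by
  have h1 := M.commutator_zeroMode hc hi hj ha han (ht.mem_dom (by omega)) (B t)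
  have h2 := actionHat_commutator hc hB (Finset.mem_Icc.1 hi).1 (Finset.mem_Icc.1 hj).2 ha han ht
  rw [hB.zeroMode_eq ht.regular ha han, map_sum] at h1
  simp only [map_smul] at h1
  have h3 := congrArg₂ (· - ·) h1 h2
  simp only [defect, smul_sub, Finset.sum_sub_distrib, map_sub]
  rw [sub_sub_sub_comm, h3, sub_sub_sub_comm]
  congr 1 <;> split_ifs <;> simp

end Model

/-! ### Partitions with prescribed cardinalities -/

section Partitions

variable {𝕜 : Type*}

lemma hasCards_union {r r' : ℕ → ℕ} {X Y : Coll 𝕜} (hXY : Disjoint X Y) (hY : HasCards r' Y) :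
    HasCards (fun s => r s + r' s) (X ∪ Y) ↔ HasCards r X := by
  refine forall_congr' fun s => ?_
  rw [Finset.filter_union, Finset.card_union_of_disjoint (Finset.disjoint_filter_filter hXY), hY s]
  exact Nat.add_right_cancel_iff

lemma hasCards_str (l k : ℕ) (z : 𝕜) : HasCards (ind l k) (str l k z) := by
  intro s
  by_cases hs : l ≤ s ∧ s < k
  · rw [ind, if_pos hs, Finset.card_eq_one]
    refine ⟨(s, z), ?_⟩
    ext p
    simp only [Finset.mem_filter, mem_str, Finset.mem_singleton]
    constructor
    · rintro ⟨⟨-, h2⟩, h3⟩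
      exact Prod.ext h3 h2
    · rintro rfl
      exact ⟨⟨hs, rfl⟩, rfl⟩
  · rw [ind, if_neg hs, Finset.card_eq_zero, Finset.filter_eq_empty_iff]
    intro p hp hps
    rw [mem_str, hps] at hp
    exact hs hp.1

lemma hasCards_union_str_zero {l i : ℕ} (hli : l ≤ i) {X : Coll 𝕜} {z : 𝕜}
    (hX : Disjoint X (str 0 l z)) :
    HasCards (ind 0 i) (X ∪ str 0 l z) ↔ HasCards (ind l i) X := by
  rw [← hasCards_union hX (hasCards_str 0 l z)]
  congr! 2 with s
  simp only [ind]
  split_ifs <;> omega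

lemma hasCards_union_str_top {j k n : ℕ} (hjk : j ≤ k) (hkn : k ≤ n) {X : Coll 𝕜} {z : 𝕜}
    (hX : Disjoint X (str k (n + 1) z)) :
    HasCards (ind j (n + 1)) (X ∪ str k (n + 1) z) ↔ HasCards (ind j k) X := by
  rw [← hasCards_union hX (hasCards_str k (n + 1) z)]
  congr! 2 with s
  simp only [ind]
  split_ifs <;> omega

lemma forall_card_color_iff {n : ℕ} {I : Coll 𝕜} (hI : ∀ p ∈ I, 1 ≤ p.1 ∧ p.1 < n) {r r' : ℕ → ℕ}
    (h : ∀ s, 1 ≤ s → s < n → r s = r' s) (h0 : ∀ s, ¬(1 ≤ s ∧ s < n) → r' s = 0) :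
    (∀ s ∈ Finset.Icc 1 (n - 1), (color I s).card = r s) ↔ HasCards r' I := by
  constructor
  · intro H s
    by_cases hs : 1 ≤ s ∧ s < n
    · rw [← card_color, H s (Finset.mem_Icc.2 (by omega)), h s hs.1 hs.2]
    · rw [h0 s hs, Finset.card_eq_zero, Finset.filter_eq_empty_iff]
      intro p hp hps
      exact hs (hps ▸ hI p hp)
  · intro H s hs
    have := Finset.mem_Icc.1 hs
    rw [card_color, H s, h s (by omega) (by omega)]

lemma theta_first {i s : ℕ} (hs : 1 ≤ s) : Theta ((i : ℤ) - 1 - s) = ind 1 i s := by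
  simp only [Theta, ind]
  split_ifs <;> omega

lemma theta_third {j n s : ℕ} (hs : s < n) : Theta ((s : ℤ) - j) = ind j n s := by
  simp only [Theta, ind]
  split_ifs <;> omega

lemma theta_mul (l k s : ℕ) : Theta ((s : ℤ) - l) * Theta ((k : ℤ) - s - 1) = ind l k s := by
  simp only [Theta, ind]
  split_ifs <;> omega

lemma theta_mul' (l k s : ℕ) : Theta ((k : ℤ) - 1 - s) * Theta ((s : ℤ) - l) = ind l k s := by
  simp only [Theta, ind]
  split_ifs <;> omega

/-- A sum over partitions into three parts as a sum over the pairs of outer parts. -/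
lemma sum_partitions {E : Type*} [AddCommMonoid E] {n : ℕ} {u : Coll 𝕜}
    (hu : ∀ p ∈ u, 1 ≤ p.1 ∧ p.1 < n) {r₁ r₃ r₁' r₃' : ℕ → ℕ}
    (h₁ : ∀ s, 1 ≤ s → s < n → r₁ s = r₁' s) (h₁' : ∀ s, ¬(1 ≤ s ∧ s < n) → r₁' s = 0)
    (h₃ : ∀ s, 1 ≤ s → s < n → r₃ s = r₃' s) (h₃' : ∀ s, ¬(1 ≤ s ∧ s < n) → r₃' s = 0)
    (F : Coll 𝕜 → Coll 𝕜 → Coll 𝕜 → E) :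
    ∑ p ∈ partitions n u r₁ r₃, F p.1 p.2.1 p.2.2 =
      ∑ x ∈ parts r₁' r₃' u, F x.1 (u \ (x.1 ∪ x.2)) x.2 := by
  have hsd : ∀ {I II III : Coll 𝕜}, I ∪ II ∪ III = u → Disjoint I II → Disjoint II III →
      u \ (I ∪ III) = II := by
    rintro I II III rfl h1 h2
    ext q
    have e1 : q ∈ I → q ∉ II := fun h => Finset.disjoint_left.1 h1 h
    have e2 : q ∈ II → q ∉ III := fun h => Finset.disjoint_left.1 h2 h
    simp only [Finset.mem_sdiff, Finset.mem_union]
    tauto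
  have hcards : ∀ {I III : Coll 𝕜}, I ⊆ u → III ⊆ u →
      ((∀ s ∈ Finset.Icc 1 (n - 1), (color I s).card = r₁ s ∧ (color III s).card = r₃ s) ↔
        HasCards r₁' I ∧ HasCards r₃' III) := by
    intro I III hI hIII
    rw [← forall_card_color_iff (fun p hp => hu p (hI hp)) h₁ h₁',
      ← forall_card_color_iff (fun p hp => hu p (hIII hp)) h₃ h₃']
    exact ⟨fun H => ⟨fun s hs => (H s hs).1, fun s hs => (H s hs).2⟩,
      fun H s hs => ⟨H.1 s hs, H.2 s hs⟩⟩
  refine Finset.sum_bij' (fun p _ => (p.1, p.2.2)) (fun x _ => (x.1, u \ (x.1 ∪ x.2), x.2))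
    ?_ ?_ ?_ ?_ ?_
  · rintro ⟨I, II, III⟩ hp
    simp only [partitions, Finset.mem_filter, Finset.mem_product, Finset.mem_powerset] at hp
    obtain ⟨⟨hI, hII, hIII⟩, -, -, hd, -, hcard⟩ := hp
    exact mem_parts.2 ⟨hI, hIII, hd, (hcards hI hIII).1 hcard⟩
  · rintro ⟨I, III⟩ hx
    obtain ⟨hI, hIII, hd, hcard⟩ := mem_parts.1 hx
    simp only [partitions, Finset.mem_filter, Finset.mem_product, Finset.mem_powerset]
    refine ⟨⟨hI, Finset.sdiff_subset, hIII⟩, ?_,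
      Finset.disjoint_sdiff.mono_left Finset.subset_union_left, hd,
      (Finset.disjoint_sdiff.mono_left Finset.subset_union_right).symm, (hcards hI hIII).2 hcard⟩
    ext q
    have e1 := @hI q
    have e2 := @hIII q
    simp only [Finset.mem_sdiff, Finset.mem_union] at e1 e2 ⊢
    tauto
  · rintro ⟨I, II, III⟩ hp
    simp only [partitions, Finset.mem_filter] at hp
    obtain ⟨-, hu', hd1, -, hd3, -⟩ := hp
    simp only [hsd hu' hd1 hd3]
  · intro x _
    rfl
  · rintro ⟨I, II, III⟩ hp
    simp only [partitions, Finset.mem_filter] at hp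
    obtain ⟨-, hu', hd1, -, hd3, -⟩ := hp
    simp only [hsd hu' hd1 hd3]

/-- The partitions of the collection with `z` in all colors `0, …, n`, when `z` of color `0` can
only be in the first part and `z` of color `n` only in the third part. -/
lemma sum_parts_extend_full {E : Type*} [AddCommMonoid E] {n i j : ℕ} (hn : 1 ≤ n) (hi : 1 ≤ i)
    (hj : j ≤ n) {t : Coll 𝕜} (ht : ∀ p ∈ t, 1 ≤ p.1 ∧ p.1 < n) (z : 𝕜) (F : Coll 𝕜 → Coll 𝕜 → E) :
    ∑ x ∈ parts (ind 1 i) (ind j n) (extend t 1 n z),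
        F (x.1 ∪ str 0 1 z) (x.2 ∪ str n (n + 1) z) =
      ∑ x ∈ parts (ind 0 i) (ind j (n + 1)) (extend t 0 (n + 1) z), F x.1 x.2 := by
  have hcol : ∀ {p : ℕ × 𝕜}, p ∈ extend t 1 n z → 1 ≤ p.1 ∧ p.1 < n := by
    intro p hp
    rcases mem_extend.1 hp with h | h
    · exact ht p h
    · exact h.1
  have hd0 : ∀ {X : Coll 𝕜}, X ⊆ extend t 1 n z → Disjoint X (str 0 1 z) := fun hX =>
    Finset.disjoint_left.2 fun p hp hp' => by
      have := hcol (hX hp)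
      rw [mem_str] at hp'
      omega
  have hdn : ∀ {X : Coll 𝕜}, X ⊆ extend t 1 n z → Disjoint X (str n (n + 1) z) := fun hX =>
    Finset.disjoint_left.2 fun p hp hp' => by
      have := hcol (hX hp)
      rw [mem_str] at hp'
      omega
  have h1 : 1 ≤ n + 1 := by omega
  have hsub : extend t 1 n z ⊆ extend t 0 (n + 1) z := by
    intro p hp
    rw [mem_extend] at hp ⊢
    rcases hp with h | h
    · exact Or.inl h
    · exact Or.inr ⟨by omega, h.2⟩
  have hstr : ∀ {p : ℕ × 𝕜} {l k : ℕ}, k ≤ n + 1 → p ∈ str l k z → p ∈ extend t 0 (n + 1) z := by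
    intro p l k hk hp
    rw [mem_str] at hp
    exact mem_extend.2 (Or.inr ⟨by omega, hp.2⟩)
  refine Finset.sum_bij' (fun x _ => (x.1 ∪ str 0 1 z, x.2 ∪ str n (n + 1) z))
    (fun x _ => (x.1 \ str 0 1 z, x.2 \ str n (n + 1) z)) ?_ ?_ ?_ ?_ ?_
  · rintro ⟨I, III⟩ hx
    obtain ⟨hI, hIII, hd, hc1, hc3⟩ := mem_parts.1 hx
    refine mem_parts.2 ⟨Finset.union_subset (hI.trans hsub) fun p hp => hstr h1 hp,
      Finset.union_subset (hIII.trans hsub) fun p hp => hstr le_rfl hp, ?_,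
      (hasCards_union_str_zero hi (hd0 hI)).2 hc1,
      (hasCards_union_str_top hj le_rfl (hdn hIII)).2 hc3⟩
    rw [Finset.disjoint_union_left, Finset.disjoint_union_right, Finset.disjoint_union_right]
    exact ⟨⟨hd, hdn hI⟩, (hd0 hIII).symm, str_disjoint z hn⟩
  · rintro ⟨I, III⟩ hx
    obtain ⟨hI, hIII, hd, hc1, hc3⟩ := mem_parts.1 hx
    have m0 := zero_mem_of_hasCards hi (fun p hp => (ht p hp).1) hc1 hI
    have mn := top_mem_of_hasCards hj (fun p hp => (ht p hp).2) hc3 hIII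
    have s0 : str 0 1 z ⊆ I := by
      rw [str_succ le_rfl, str_self]
      simpa using m0
    have sn : str n (n + 1) z ⊆ III := by
      rw [str_succ le_rfl, str_self]
      simpa using mn
    refine mem_parts.2 ⟨?_, ?_, hd.mono Finset.sdiff_subset Finset.sdiff_subset, ?_, ?_⟩
    · intro p hp
      rw [Finset.mem_sdiff] at hp
      refine mem_extend_of_mem_extend_full (hI hp.1) ?_ ?_
      · rintro rfl
        exact hp.2 (by simp [mem_str])
      · rintro rfl
        exact Finset.disjoint_left.1 hd hp.1 mn
    · intro p hp
      rw [Finset.mem_sdiff] at hp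
      refine mem_extend_of_mem_extend_full (hIII hp.1) ?_ ?_
      · rintro rfl
        exact Finset.disjoint_left.1 hd m0 hp.1
      · rintro rfl
        exact hp.2 (by simp [mem_str])
    · rw [← hasCards_union_str_zero hi Finset.sdiff_disjoint, Finset.sdiff_union_of_subset s0]
      exact hc1
    · rw [← hasCards_union_str_top hj le_rfl Finset.sdiff_disjoint,
        Finset.sdiff_union_of_subset sn]
      exact hc3
  · rintro ⟨I, III⟩ hx
    obtain ⟨hI, hIII, -⟩ := mem_parts.1 hx
    simp only [Finset.union_sdiff_cancel_right (hd0 hI),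
      Finset.union_sdiff_cancel_right (hdn hIII)]
  · rintro ⟨I, III⟩ hx
    obtain ⟨hI, hIII, hd, hc1, hc3⟩ := mem_parts.1 hx
    have m0 := zero_mem_of_hasCards hi (fun p hp => (ht p hp).1) hc1 hI
    have mn := top_mem_of_hasCards hj (fun p hp => (ht p hp).2) hc3 hIII
    have s0 : str 0 1 z ⊆ I := by
      rw [str_succ le_rfl, str_self]
      simpa using m0
    have sn : str n (n + 1) z ⊆ III := by
      rw [str_succ le_rfl, str_self]
      simpa using mn
    simp only [Finset.sdiff_union_of_subset s0, Finset.sdiff_union_of_subset sn]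
  · intro x _
    rfl

/-- The second part is not affected when `z` of the colors `0` and `n` is added to the outer
parts. -/
lemma sdiff_outer_extend {z : 𝕜} {t I III : Coll 𝕜} {n : ℕ}
    (ht : ∀ p ∈ t, 1 ≤ p.1 ∧ p.1 < n) :
    extend t 0 (n + 1) z \ (I ∪ str 0 1 z ∪ (III ∪ str n (n + 1) z)) =
      extend t 1 n z \ (I ∪ III) := by
  ext p
  simp only [Finset.mem_sdiff, Finset.mem_union, mem_extend, mem_str]
  constructor
  · rintro ⟨h1, h2⟩
    refine ⟨?_, by tauto⟩
    rcases h1 with h1 | h1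
    · exact Or.inl h1
    · refine Or.inr ⟨⟨?_, ?_⟩, h1.2⟩
      · by_contra h
        exact h2 (Or.inl (Or.inr ⟨by omega, h1.2⟩))
      · by_contra h
        exact h2 (Or.inr (Or.inr ⟨by omega, h1.2⟩))
  · rintro ⟨h1, h2⟩
    have hp : 1 ≤ p.1 ∧ p.1 < n := by
      rcases h1 with h1 | h1
      · exact ht p h1
      · exact h1.1
    refine ⟨?_, ?_⟩
    · rcases h1 with h1 | h1
      · exact Or.inl h1
      · exact Or.inr ⟨by omega, h1.2⟩
    · rintro ((h | h) | h | h)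
      · exact h2 (Or.inl h)
      · omega
      · exact h2 (Or.inr h)
      · omega

lemma parts_zero (a b : ℕ) (u : Coll 𝕜) : parts (ind a a) (ind b b) u = {(∅, ∅)} := by
  ext ⟨I, III⟩
  rw [mem_parts, ind_empty le_rfl, ind_empty le_rfl, hasCards_zero, hasCards_zero,
    Finset.mem_singleton, Prod.mk.injEq]
  constructor
  · rintro ⟨-, -, -, h⟩
    exact h
  · rintro ⟨rfl, rfl⟩
    simp

end Partitions

/-! ### Weights of partitions that contain strings -/

section Weights

variable {𝕜 : Type*} [Field 𝕜] {c : 𝕜}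

lemma Omega_str_str (hc : c ≠ 0) {a b a' b' : ℕ} (h : b ≤ a') (z : 𝕜) :
    Omega c (str a b z) (str a' b' z) = 1 := by
  refine Finset.prod_eq_one fun p hp => Finset.prod_eq_one fun q hq => ?_
  rw [mem_str] at hp hq
  rw [hp.2, hq.2]
  by_cases e : q.1 = p.1 + 1
  · rw [e, gam_succ hc, h_self hc]
  · exact gam_far _ _ (by omega) e (by omega)

lemma psi_ne_zero (hc : c ≠ 0) {n l : ℕ} (hl : 1 ≤ l) {z : 𝕜} {X : Coll 𝕜} (hX : Away c n z X) :
    psi c l z X ≠ 0 := by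
  rw [psi_eq_prod l hl]
  refine Finset.prod_ne_zero_iff.2 fun q hq => ?_
  obtain ⟨-, h2, h3, h4⟩ := hX q hq
  split_ifs
  · exact h_ne_zero hc h4
  · exact g_ne_zero hc h2.symm
  · exact one_ne_zero

lemma phi_ne_zero (hc : c ≠ 0) {n l : ℕ} (hl : 1 ≤ l) {z : 𝕜} {X : Coll 𝕜} (hX : Away c n z X) :
    phi c l z X ≠ 0 := by
  rw [phi_eq_prod l hl]
  refine Finset.prod_ne_zero_iff.2 fun q hq => ?_
  obtain ⟨-, h2, h3, h4⟩ := hX q hq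
  split_ifs
  · exact g_ne_zero hc h2
  · exact h_ne_zero hc h3
  · exact one_ne_zero

/-- The weight of a partition in which `z` is in the first part for the colors below `l`, in the
second part for the colors `l, …, k - 1` and in the third part from the color `k` on. -/
lemma wt_strings (hc : c ≠ 0) {n l k : ℕ} (hl : 1 ≤ l) (hlk : l ≤ k) (hkn : k ≤ n) {z : 𝕜}
    {X Y W : Coll 𝕜} (hX : Away c n z X) (hY : Away c n z Y) (hW : Away c n z W)
    (al : ℕ × 𝕜 → 𝕜) :
    wt c al (X ∪ str 0 l z) (Y ∪ str l k z) (W ∪ str k (n + 1) z) =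
      wt c al X Y W * phi c l z X * mu c l k z Y * psi c k z W *
        ∏ p ∈ str k (n + 1) z, al p := by
  have hd : ∀ {S : Coll 𝕜}, Away c n z S → ∀ a b, Disjoint S (str a b z) :=
    fun hS => disjoint_str fun p hp => (hS p hp).2.1
  have e1 : phi c l z X = Omega c X (str l k z) * Omega c X (str k (n + 1) z) := by
    rw [← phi_eq_Omega hc hX hl (hlk.trans hkn), ← str_union z hlk (by omega : k ≤ n + 1),
      Omega_union_right _ (str_disjoint z le_rfl)]
  have e2 : psi c k z W = Omega c (str 0 l z) W * Omega c (str l k z) W := by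
    rw [← psi_eq_Omega hc hW (hl.trans hlk), ← str_union z (Nat.zero_le l) hlk,
      Omega_union_left (str_disjoint z le_rfl)]
  have e3 : mu c l k z Y = Omega c (str 0 l z) Y * Omega c Y (str k (n + 1) z) := by
    rw [mu, psi_eq_Omega hc hY hl, phi_eq_Omega hc hY (hl.trans hlk) hkn]
  rw [e1, e2, e3]
  simp only [wt, Omega₃, Omega_union_left (hd hX _ _), Omega_union_left (hd hY _ _),
    Omega_union_right _ (hd hY _ _), Omega_union_right _ (hd hW _ _),
    Finset.prod_union (hd hW _ _), Omega_str_str hc le_rfl, Omega_str_str hc hlk]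
  ring

end Weights

/-! ### The action formula with `z` in all colors -/

namespace Model

variable {𝕜 : Type*} [NontriviallyNormedField 𝕜] {H : Type*} [AddCommGroup H]
    [Module 𝕜 H] [TopologicalSpace H] {n : ℕ} {c : 𝕜} {M : Model 𝕜 H n c}

/-- The values of `α_a(z)` from the color `k` on telescope to `λ_k(z) / λ_n(z)`. -/
lemma prod_alphaHat_str {z : 𝕜} (hz : z ∈ M.dom) {k : ℕ} (hk : 1 ≤ k) (hkn : k ≤ n) :
    ∏ p ∈ str k (n + 1) z, M.alphaHat p = M.lam k z / M.lam n z := by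
  have hlam : ∀ i, 1 ≤ i → i ≤ n → M.lam i z ≠ 0 := fun i h1 h2 =>
    M.lam_ne i (Finset.mem_Icc.2 ⟨h1, h2⟩) z hz
  induction hkn using Nat.decreasingInduction with
  | self =>
    rw [str_succ le_rfl, str_self, insert_empty_eq, Finset.prod_singleton, alphaHat, if_pos rfl,
      div_self (hlam n hk le_rfl)]
  | of_succ k hkn ih =>
    rw [str_pred (by omega), Finset.prod_insert (by simp [mem_str]), ih (by omega), alphaHat,
      if_neg (by simp; omega), alpha]
    exact div_mul_div_cancel₀ (hlam (k + 1) (by omega) hkn)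

lemma Extendable.psi_one_ne_zero (hn : 2 ≤ n) (hc : c ≠ 0) {z : 𝕜} {t X : Coll 𝕜}
    (ht : M.Extendable z t) (hX : X ⊆ extend t 1 n z) : psi c 1 z X ≠ 0 := by
  rw [psi_eq_prod 1 le_rfl]
  refine Finset.prod_ne_zero_iff.2 fun q hq => ?_
  have hq' := hX hq
  have h1 := ht.1.color hq'
  split_ifs with e e'
  · exact h_ne_zero hc (ht.1.2 (1, z) (mem_extend.2 (Or.inr ⟨⟨le_rfl, hn⟩, rfl⟩)) q hq' e.symm)
  · omega
  · exact one_ne_zero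

lemma Extendable.phi_top_ne_zero (hn : 2 ≤ n) (hc : c ≠ 0) {z : 𝕜} {t X : Coll 𝕜}
    (ht : M.Extendable z t) (hX : X ⊆ extend t 1 n z) : phi c n z X ≠ 0 := by
  rw [phi_eq_prod n (by omega)]
  refine Finset.prod_ne_zero_iff.2 fun q hq => ?_
  have hq' := hX hq
  have h1 := ht.1.color hq'
  split_ifs with e e'
  · omega
  · exact h_ne_zero hc (ht.1.2 q hq' (n - 1, z)
      (mem_extend.2 (Or.inr ⟨⟨by simp; omega, by simp; omega⟩, rfl⟩)) (by simp; omega))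
  · exact one_ne_zero

/-- The factors with `ψ_1`, `φ_n` and `μ^n_1` of the action formula place `z` in the color `0` of
the first part and in the color `n` of the third part. -/
lemma mu_mul_weight (hn : 2 ≤ n) (hc : c ≠ 0) {z : 𝕜} {t I II III : Coll 𝕜}
    (ht : M.Extendable z t) (hu : I ∪ II ∪ III = extend t 1 n z) (h12 : Disjoint I II)
    (h13 : Disjoint I III) (h23 : Disjoint II III) :
    mu c 1 n z t * (Omega₃ c I II III * M.alphaProd III / (psi c 1 z I * phi c n z III)) =
      wt c M.alphaHat (I ∪ str 0 1 z) II (III ∪ str n (n + 1) z) := by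
  have hI : I ⊆ extend t 1 n z := by
    rw [← hu]
    exact Finset.subset_union_left.trans Finset.subset_union_left
  have hII : II ⊆ extend t 1 n z := by
    rw [← hu]
    exact Finset.subset_union_right.trans Finset.subset_union_left
  have hIII : III ⊆ extend t 1 n z := by
    rw [← hu]
    exact Finset.subset_union_right
  have hcol : ∀ {X : Coll 𝕜}, X ⊆ extend t 1 n z → ∀ p ∈ X, 1 ≤ p.1 ∧ p.1 < n :=
    fun hX p hp => ht.1.color (hX hp)
  have hd : ∀ {X : Coll 𝕜}, X ⊆ extend t 1 n z → Disjoint X (str 0 1 z) ∧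
      Disjoint X (str n (n + 1) z) := by
    intro X hX
    constructor <;>
    · refine Finset.disjoint_left.2 fun p hp hp' => ?_
      have := hcol hX p hp
      rw [mem_str] at hp'
      omega
  have hdt : Disjoint t (str 1 n z) := disjoint_str ht.2 _ _
  have s0 : str 0 1 z = {(0, z)} := by rw [str_succ le_rfl, str_self, insert_empty_eq]
  have sn : str n (n + 1) z = {(n, z)} := by rw [str_succ le_rfl, str_self, insert_empty_eq]
  have hd' : Disjoint (I ∪ II) III := Finset.disjoint_union_left.2 ⟨h13, h23⟩
  have emu : mu c 1 n z t = psi c 1 z I * psi c 1 z II * psi c 1 z III *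
      (phi c n z I * phi c n z II * phi c n z III) := by
    rw [← psi_union 1 le_rfl z h12, ← psi_union 1 le_rfl z hd', ← phi_union n (by omega) z h12,
      ← phi_union n (by omega) z hd', hu, extend_eq, psi_union 1 le_rfl z hdt,
      phi_union n (by omega) z hdt, psi_one_str hc, phi_top_str hc z (by omega), mul_one, mul_one,
      mu]
  have eL : ∀ {X : Coll 𝕜}, X ⊆ extend t 1 n z → Omega c (str 0 1 z) X = psi c 1 z X :=
    fun hX => by rw [s0, Omega_zero_left hc fun p hp => (hcol hX p hp).1]
  have eR : ∀ {X : Coll 𝕜}, X ⊆ extend t 1 n z → Omega c X (str n (n + 1) z) = phi c n z X :=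
    fun hX => by rw [sn, Omega_top_right hc (hcol hX)]
  have eal : ∏ p ∈ str n (n + 1) z, M.alphaHat p = 1 := by
    rw [sn, Finset.prod_singleton, alphaHat, if_pos rfl]
  have n1 := ht.psi_one_ne_zero hn hc hI
  have n2 := ht.phi_top_ne_zero hn hc hIII
  rw [emu]
  simp only [wt, Omega₃, Omega_union_left (hd hI).1, Omega_union_right _ (hd hIII).2,
    Finset.prod_union (hd hIII).2, eL hII, eL hIII, eR hI, eR hII,
    Omega_str_str hc (show 1 ≤ n by omega), eal, prod_alphaHat fun p hp => (hcol hIII p hp).2]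
  field_simp

variable {B : Coll 𝕜 → H}

/-- The right hand side of the action formula as a sum over the pairs of outer parts. -/
lemma action_eq_sum_parts {i j : ℕ} (hi : i ∈ Finset.Icc 1 n)
    (hj : j ∈ Finset.Icc 1 n) {z : 𝕜} {t : Coll 𝕜} (ht : M.Extendable z t) :
    M.action B i j z t = (M.lam n z * mu c 1 n z t) •
      ∑ x ∈ parts (ind 1 i) (ind j n) (extend t 1 n z),
        (Omega₃ c x.1 (extend t 1 n z \ (x.1 ∪ x.2)) x.2 * M.alphaProd x.2 /
          (psi c 1 z x.1 * phi c n z x.2)) • B (extend t 1 n z \ (x.1 ∪ x.2)) := by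
  rw [Finset.mem_Icc] at hi hj
  have hcol : ∀ p ∈ extend t 1 n z, 1 ≤ p.1 ∧ p.1 < n := fun p hp => ht.1.color hp
  rw [action, sum_partitions (r₁' := ind 1 i) (r₃' := ind j n) hcol (fun s h1 _ => theta_first h1)
      (fun s hs => by simp only [ind]; rw [if_neg]; omega) (fun s _ h2 => theta_third h2)
      (fun s hs => by simp only [ind]; rw [if_neg]; omega)
      (fun I II III => (Omega₃ c I II III * M.alphaProd III / (psi c 1 z I * phi c n z III)) •
        B II)]

lemma action_eq_actionHat (hn : 2 ≤ n) (hc : c ≠ 0) {i j : ℕ} (hi : i ∈ Finset.Icc 1 n)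
    (hj : j ∈ Finset.Icc 1 n) {z : 𝕜} {t : Coll 𝕜} (ht : M.Extendable z t) :
    M.action B i j z t = M.actionHat B i j z t := by
  have hcol : ∀ p ∈ t, 1 ≤ p.1 ∧ p.1 < n := fun p hp => ht.color hp
  rw [action_eq_sum_parts hi hj ht, actionHat, actSum, partSum,
    ← sum_parts_extend_full (by omega) (Finset.mem_Icc.1 hi).1 (Finset.mem_Icc.1 hj).2 hcol z
      (fun I III => wt c M.alphaHat I (extend t 0 (n + 1) z \ (I ∪ III)) III •
        B (extend t 0 (n + 1) z \ (I ∪ III))), mul_smul, Finset.smul_sum]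
  congr 1
  refine Finset.sum_congr rfl fun x hx => ?_
  obtain ⟨hI, hIII, hd, -⟩ := mem_parts.1 hx
  obtain ⟨hu, hd1, hd2⟩ := partition_sdiff hI hIII
  rw [smul_smul, mu_mul_weight hn hc ht hu hd1 hd hd2, sdiff_outer_extend hcol]

end Model

/-! ### The defect above and on the diagonal -/

namespace Model

variable {𝕜 : Type*} [NontriviallyNormedField 𝕜] {H : Type*} [AddCommGroup H]
    [Module 𝕜 H] [TopologicalSpace H] {n : ℕ} {c : 𝕜} {M : Model 𝕜 H n c} {B : Coll 𝕜 → H}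

lemma highest_eq (hB : M.IsOffShell B) {z : 𝕜} {t : Coll 𝕜} (ht : M.Extendable z t) :
    M.T 1 n z (B t) = (M.lam n z * mu c 1 n z t) • B (extend t 1 n z) := by
  rw [hB.highest t z ht.2 ht.1]
  have h0 : color t 0 = ∅ := color_eq_empty fun p hp => by
    have := ht.color hp
    omega
  have hn : color t n = ∅ := color_eq_empty fun p hp => (ht.color hp).2.ne
  have e1 : setProd (g c) {z} ∅ = 1 := by simp [setProd]
  have e2 : setProd (g c) ∅ {z} = 1 := by simp [setProd]
  rw [mu, psi, phi, h0, hn, e1, e2, mul_one, one_mul, mul_assoc]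

/-- The action formula for `T_{1,n}(z)`: both outer parts are empty, and the formula is the
defining relation of the Bethe vectors. -/
lemma defect_highest (hn : 2 ≤ n) (hc : c ≠ 0) (hB : M.IsOffShell B) {z : 𝕜} {t : Coll 𝕜}
    (ht : M.Extendable z t) : M.defect B 1 n z t = 0 := by
  have h1 : 1 ∈ Finset.Icc 1 n := Finset.mem_Icc.2 ⟨le_rfl, by omega⟩
  have h2 : n ∈ Finset.Icc 1 n := Finset.mem_Icc.2 ⟨by omega, le_rfl⟩
  rw [defect, ← action_eq_actionHat hn hc h1 h2 ht, action_eq_sum_parts h1 h2 ht, highest_eq hB ht,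
    parts_zero, Finset.sum_singleton]
  simp [Omega₃, alphaProd]

variable [IsTopologicalAddGroup H] [ContinuousSMul 𝕜 H] [T2Space H]

/-- Commutators with zero modes lower the second index of the action formula above the diagonal. -/
lemma defect_lower_right (hc : c ≠ 0) (hB : M.IsOffShell B) {i j : ℕ} (hi : 1 ≤ i) (hij : i < j)
    (hj : j < n) (h : ∀ z t, M.Extendable z t → M.defect B i (j + 1) z t = 0) :
    ∀ z t, M.Extendable z t → M.defect B i j z t = 0 := by
  intro z t ht
  have key := defect_commutator hc hB (i := i) (j := j + 1) (a := j)
    (Finset.mem_Icc.2 ⟨hi, by omega⟩) (Finset.mem_Icc.2 ⟨by omega, hj⟩) (by omega) hj ht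
  rw [if_neg hij.ne, if_pos rfl, h z t ht, map_zero, Finset.sum_eq_zero fun p _ => by
    rw [h z _ (ht.mono (Finset.erase_subset _ _)), smul_zero], sub_zero, zero_sub] at key
  exact neg_eq_zero.1 key.symm

/-- Commutators with zero modes raise the first index of the action formula above the diagonal. -/
lemma defect_raise_left (hc : c ≠ 0) (hB : M.IsOffShell B) {i j : ℕ} (hi : 1 ≤ i) (hij : i + 1 < j)
    (hj : j ≤ n) (h : ∀ z t, M.Extendable z t → M.defect B i j z t = 0) :
    ∀ z t, M.Extendable z t → M.defect B (i + 1) j z t = 0 := by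
  intro z t ht
  have key := defect_commutator hc hB (i := i) (j := j) (a := i)
    (Finset.mem_Icc.2 ⟨hi, by omega⟩) (Finset.mem_Icc.2 ⟨by omega, hj⟩) hi (by omega) ht
  rw [if_pos rfl, if_neg hij.ne', h z t ht, map_zero, Finset.sum_eq_zero fun p _ => by
    rw [h z _ (ht.mono (Finset.erase_subset _ _)), smul_zero], sub_zero, sub_zero] at key
  exact key.symm

/-- The action formula holds above the diagonal. -/
lemma defect_eq_zero_of_lt (hn : 2 ≤ n) (hc : c ≠ 0) (hB : M.IsOffShell B) {i j : ℕ} (hi : 1 ≤ i)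
    (hij : i < j) (hj : j ≤ n) : ∀ z t, M.Extendable z t → M.defect B i j z t = 0 := by
  have h1 : ∀ i, 1 ≤ i → i < n → ∀ z t, M.Extendable z t → M.defect B i n z t = 0 := by
    intro i hi
    induction i, hi using Nat.le_induction with
    | base => exact fun _ z t ht => defect_highest hn hc hB ht
    | succ i hi ih => exact fun h => defect_raise_left hc hB hi h le_rfl (ih (by omega))
  induction hj using Nat.decreasingInduction with
  | self => exact h1 i hi hij
  | of_succ j hj ih => exact defect_lower_right hc hB hi hij hj (ih (by omega))

/-- The defects of the action formula for the diagonal entries are all equal. -/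
lemma defect_diag_succ (hn : 2 ≤ n) (hc : c ≠ 0) (hB : M.IsOffShell B) {i : ℕ} (hi : 1 ≤ i)
    (hin : i < n) {z : 𝕜} {t : Coll 𝕜} (ht : M.Extendable z t) :
    M.defect B i i z t = M.defect B (i + 1) (i + 1) z t := by
  have key := defect_commutator hc hB (i := i) (j := i + 1) (a := i)
    (Finset.mem_Icc.2 ⟨hi, by omega⟩) (Finset.mem_Icc.2 ⟨by omega, hin⟩) hi hin ht
  have h := defect_eq_zero_of_lt hn hc hB hi (Nat.lt_succ_self i) hin
  rw [if_pos rfl, if_pos rfl, h z t ht, map_zero, Finset.sum_eq_zero fun p _ => by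
    rw [h z _ (ht.mono (Finset.erase_subset _ _)), smul_zero], sub_zero] at key
  exact (sub_eq_zero.1 key.symm).symm

lemma defect_diag (hn : 2 ≤ n) (hc : c ≠ 0) (hB : M.IsOffShell B) {i : ℕ} (hi : 1 ≤ i)
    (hin : i ≤ n) {z : 𝕜} {t : Coll 𝕜} (ht : M.Extendable z t) :
    M.defect B i i z t = M.defect B n n z t := by
  induction hin using Nat.decreasingInduction with
  | self => rfl
  | of_succ i hin ih => rw [defect_diag_succ hn hc hB hi hin ht, ih (by omega)]

/-- For `n ≥ 3` there is a diagonal entry that commutes with a given zero mode, so the common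
defect of the diagonal entries has no commutators with zero modes at all. -/
lemma defect_diag_commutator (hn : 3 ≤ n) (hc : c ≠ 0) (hB : M.IsOffShell B) {a : ℕ} (ha : 1 ≤ a)
    (han : a < n) {z : 𝕜} {t : Coll 𝕜} (ht : M.Extendable z t) :
    ∑ p ∈ t.filter (fun p => p.1 = a),
        coef c M.alphaHat p (t.erase p) • M.defect B n n z (t.erase p) =
      M.mode (a + 1) a 0 (M.defect B n n z t) := by
  obtain ⟨i, hi1, hin, hia, hia'⟩ : ∃ i, 1 ≤ i ∧ i ≤ n ∧ i ≠ a ∧ i ≠ a + 1 := by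
    by_cases h1 : a = 1
    · exact ⟨3, by omega⟩
    · exact ⟨1, by omega⟩
  have key := defect_commutator hc hB (i := i) (j := i)
    (Finset.mem_Icc.2 ⟨hi1, hin⟩) (Finset.mem_Icc.2 ⟨hi1, hin⟩) ha han ht
  rw [if_neg hia, if_neg hia', sub_zero, sub_eq_zero,
    defect_diag (by omega) hc hB hi1 hin ht] at key
  rw [← key]
  refine Finset.sum_congr rfl fun p _ => ?_
  rw [defect_diag (by omega) hc hB hi1 hin (ht.mono (Finset.erase_subset _ _))]

end Model

/-! ### The coefficients of the exchange relation -/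

section ExchangeTerms

variable {𝕜 : Type*} [Field 𝕜] {c : 𝕜}

lemma psi_one_of_filter {X : Coll 𝕜} {x : 𝕜} (z : 𝕜) (hX : ∀ p ∈ X, 1 ≤ p.1)
    (hx : X.filter (fun p => p.1 = 1) = {(1, x)}) : psi c 1 z X = h c x z := by
  rw [psi, color_eq_empty (s := 1 - 1) fun p hp => by have := hX p hp; omega, color, hx]
  simp [setProd]

lemma Omega_zero_right_of_filter {X : Coll 𝕜} {x : 𝕜} (z : 𝕜) (hX : ∀ p ∈ X, 1 ≤ p.1)
    (hx : X.filter (fun p => p.1 = 1) = {(1, x)}) : Omega c X (str 0 1 z) = (x - z) / c := by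
  rw [str_succ le_rfl, str_self, insert_empty_eq, Omega_single_right,
    ← Finset.prod_filter_mul_prod_filter_not X (fun p => p.1 = 1), hx, Finset.prod_singleton,
    Finset.prod_eq_one, mul_one]
  · exact gam_pred 0 x z
  · intro p hp
    rw [Finset.mem_filter] at hp
    have := hX p hp.1
    exact gam_far _ _ (by simp; omega) (by simp) (by simpa using hp.2)

/-- If `I` contains `z` in some color but not in the color `1`, then somewhere `z` of color `a + 1`
is in `I` and `z` of color `a` is not. -/
lemma Omega_sdiff_eq_zero {n a : ℕ} {z : 𝕜} {I v : Coll 𝕜}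
    (hv : str 1 n z ⊆ v) (ha : 1 ≤ a) (han : a < n) (haI : (a, z) ∈ I) (h1 : (1, z) ∉ I) :
    Omega c I (v \ I) = 0 := by
  induction a, ha using Nat.le_induction with
  | base => exact absurd haI h1
  | succ a ha ih =>
    by_cases hI : (a, z) ∈ I
    · exact ih (by omega) hI
    · exact Omega_eq_zero haI (Finset.mem_sdiff.2
        ⟨hv (mem_str.2 ⟨⟨ha, by simp; omega⟩, rfl⟩), hI⟩)

lemma mu_union {l k : ℕ} (hl : 1 ≤ l) (hk : 1 ≤ k) (z : 𝕜) {X Y : Coll 𝕜} (hXY : Disjoint X Y) :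
    mu c l k z (X ∪ Y) = mu c l k z X * mu c l k z Y := by
  rw [mu, mu, mu, psi_union l hl z hXY, phi_union k hk z hXY]
  ring

lemma mu_str {n : ℕ} (hn : 2 ≤ n) (z w : 𝕜) : mu c 1 n z (str 1 n w) = h c w z * h c z w := by
  have h1 : (str 1 n w).filter (fun p => p.1 = 1) = {(1, w)} := by
    ext p
    simp only [Finset.mem_filter, mem_str, Finset.mem_singleton, Prod.ext_iff]
    constructor
    · exact fun hp => ⟨hp.2, hp.1.2⟩
    · exact fun hp => ⟨⟨by omega, hp.2⟩, hp.1⟩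
  have h2 : (str 1 n w).filter (fun p => p.1 = n - 1) = {(n - 1, w)} := by
    ext p
    simp only [Finset.mem_filter, mem_str, Finset.mem_singleton, Prod.ext_iff]
    constructor
    · exact fun hp => ⟨hp.2, hp.1.2⟩
    · exact fun hp => ⟨⟨by omega, hp.2⟩, hp.1⟩
  rw [mu, psi_one_of_filter z (fun p hp => (mem_str.1 hp).1.1) h1, phi,
    color_eq_empty (s := n) fun p hp => (mem_str.1 hp).1.2.ne, color, h2]
  simp [setProd]

/-- The coefficient that arises when `T_{n,n}(z)` acts first and `T_{1,n}(w)` second, in a form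
without case distinction: the right hand side vanishes unless `I` avoids `w`. If `I` contains `w`
in the color `1`, this is due to the factor `x - w`, where `x` is the parameter of color `1` in
`I`; otherwise it is due to `Ω(I, ·)`. -/
lemma exchange_term (hn : 2 ≤ n) (hc : c ≠ 0) {z w : 𝕜} {t I : Coll 𝕜}
    (hw : Away c n w (extend t 1 n z)) (hz : ∀ p ∈ t, p.2 ≠ z)
    (hI : I ⊆ extend (extend t 1 n z) 1 n w) (hcard : HasCards (ind 1 n) I) {x : 𝕜}
    (hx : I.filter (fun p => p.1 = 1) = {(1, x)}) (hxz : h c x z ≠ 0) (hxw : h c x w ≠ 0) :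
    (if I ⊆ extend t 1 n z then
        mu c 1 n z t * (Omega c I (extend t 1 n z \ I) / psi c 1 z I) *
          mu c 1 n w (extend t 1 n z \ I) else 0) =
      mu c 1 n z t * mu c 1 n w t * (h c w z * h c z w) *
        Omega c I (extend (extend t 1 n z) 1 n w \ I) / (h c x z * h c x w) * ((x - w) / c) := by
  have hcol : ∀ p ∈ I, 1 ≤ p.1 ∧ p.1 < n := fun p hp => hcard.mem_range hp
  split_ifs with hIz
  · have hwI : Away c n w I := hw.mono hIz
    have hwd : ∀ {X : Coll 𝕜}, X ⊆ extend t 1 n z → ∀ a b, Disjoint X (str a b w) := fun hX =>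
      disjoint_str fun p hp => (hw p (hX hp)).2.1
    have e1 : extend (extend t 1 n z) 1 n w \ I = extend t 1 n z \ I ∪ str 1 n w := by
      rw [extend_eq _ 1 n w, Finset.union_sdiff_distrib, Finset.sdiff_eq_self_of_disjoint
        (hwd hIz _ _).symm]
    have e2 : Omega c I (str 1 n w) * (phi c n w I * ((x - w) / c)) = 1 := by
      rw [← Omega_full_right hc hwI, ← str_union w (Nat.zero_le 1) (by omega : 1 ≤ n + 1),
        ← str_union w (by omega : 1 ≤ n) (by omega : n ≤ n + 1),
        Omega_union_right _ (Finset.disjoint_union_right.2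
          ⟨str_disjoint w le_rfl, str_disjoint w (by omega)⟩),
        Omega_union_right _ (str_disjoint w le_rfl),
        Omega_zero_right_of_filter w (fun p hp => (hcol p hp).1) hx,
        phi_eq_Omega hc hwI (by omega) le_rfl]
      ring
    have e3 : mu c 1 n w (extend t 1 n z \ I) * (h c x w * phi c n w I) =
        mu c 1 n w t * (h c w z * h c z w) := by
      rw [← psi_one_of_filter w (fun p hp => (hcol p hp).1) hx]
      change _ * mu c 1 n w I = _
      rw [← mu_union le_rfl (by omega) w Finset.sdiff_disjoint,
        Finset.sdiff_union_of_subset hIz, extend_eq, mu_union le_rfl (by omega) w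
        (disjoint_str hz _ _), mu_str hn]
      ring
    have hphi : phi c n w I ≠ 0 := phi_ne_zero hc (by omega) hwI
    have e4 : mu c 1 n w (extend t 1 n z \ I) =
        mu c 1 n w t * (h c w z * h c z w) / (h c x w * phi c n w I) := by
      rw [← e3]
      field_simp
    rw [e1, Omega_union_right _ (hwd Finset.sdiff_subset _ _), e4,
      psi_one_of_filter z (fun p hp => (hcol p hp).1) hx]
    have e5 : Omega c I (str 1 n w) * ((x - w) / c) = (phi c n w I)⁻¹ := by
      refine eq_inv_of_mul_eq_one_left ?_
      rw [← e2]
      ring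
    calc _ = mu c 1 n z t * mu c 1 n w t * (h c w z * h c z w) * Omega c I (extend t 1 n z \ I) /
          (h c x z * h c x w) * (phi c n w I)⁻¹ := by field_simp
      _ = _ := by rw [← e5]; ring
  · obtain ⟨p, hp, hpz⟩ := Finset.not_subset.1 hIz
    have hpw : p.2 = w := by
      rcases mem_extend.1 (hI hp) with h | h
      · exact absurd h hpz
      · exact h.2
    by_cases h1 : (1, w) ∈ I
    · have : (1, w) ∈ I.filter (fun p => p.1 = 1) := Finset.mem_filter.2 ⟨h1, rfl⟩
      rw [hx, Finset.mem_singleton, Prod.mk.injEq] at this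
      rw [this.2]
      simp
    · have hpI : (p.1, w) ∈ I := by rw [← hpw]; exact hp
      have hsub : str 1 n w ⊆ extend (extend t 1 n z) 1 n w := Finset.subset_union_right
      rw [Omega_sdiff_eq_zero hsub (hcol p hp).1 (hcol p hp).2 hpI h1]
      simp

end ExchangeTerms

/-! ### The exchange relation of `T_{n,n}(z)` and `T_{1,n}(w)` -/

namespace Model

variable {𝕜 : Type*} [NontriviallyNormedField 𝕜] {H : Type*} [AddCommGroup H]
    [Module 𝕜 H] [TopologicalSpace H] {n : ℕ} {c : 𝕜} {M : Model 𝕜 H n c} {B : Coll 𝕜 → H}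

/-- For `T_{n,n}(z)` the third part is empty. -/
lemma action_last (hn : 2 ≤ n) {z : 𝕜} {t : Coll 𝕜} (ht : M.Extendable z t) :
    M.action B n n z t = (M.lam n z * mu c 1 n z t) •
      ∑ I ∈ (extend t 1 n z).powerset.filter (HasCards (ind 1 n)),
        (Omega c I (extend t 1 n z \ I) / psi c 1 z I) • B (extend t 1 n z \ I) := by
  have h1 : n ∈ Finset.Icc 1 n := Finset.mem_Icc.2 ⟨by omega, le_rfl⟩
  rw [action_eq_sum_parts h1 h1 ht]
  congr 1
  symm
  refine Finset.sum_bij (fun I _ => (I, ∅)) ?_ ?_ ?_ ?_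
  · intro I hI
    rw [Finset.mem_filter, Finset.mem_powerset] at hI
    refine mem_parts.2 ⟨hI.1, Finset.empty_subset _, Finset.disjoint_empty_right _, hI.2, ?_⟩
    rw [ind_empty le_rfl]
    exact hasCards_zero.2 rfl
  · intro I _ J _ h
    exact (Prod.mk.injEq _ _ _ _ ▸ h).1
  · rintro ⟨I, III⟩ hx
    obtain ⟨hI, -, -, h1, h3⟩ := mem_parts.1 hx
    rw [ind_empty le_rfl, hasCards_zero] at h3
    simp only at h3
    subst h3
    exact ⟨I, Finset.mem_filter.2 ⟨Finset.mem_powerset.2 hI, h1⟩, rfl⟩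
  · intro I _
    simp [Omega₃, alphaProd]

/-- The action of `T_{1,n}(w)` on the right hand side of the action formula for `T_{n,n}(z)`. -/
lemma highest_action_last (hn : 2 ≤ n) (hB : M.IsOffShell B) {z w : 𝕜} {t : Coll 𝕜}
    (hw : M.Extendable w (extend t 1 n z)) (ht : M.Extendable z t) :
    M.T 1 n w (M.action B n n z t) = (M.lam n z * M.lam n w) •
      ∑ I ∈ (extend (extend t 1 n z) 1 n w).powerset.filter (HasCards (ind 1 n)),
        (if I ⊆ extend t 1 n z then
          mu c 1 n z t * (Omega c I (extend t 1 n z \ I) / psi c 1 z I) *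
            mu c 1 n w (extend t 1 n z \ I) else 0) •
          B (extend (extend t 1 n z) 1 n w \ I) := by
  have hsub : extend t 1 n z ⊆ extend (extend t 1 n z) 1 n w := Finset.subset_union_left
  have hset : (extend t 1 n z).powerset.filter (HasCards (ind 1 n)) =
      ((extend (extend t 1 n z) 1 n w).powerset.filter (HasCards (ind 1 n))).filter
        (fun I => I ⊆ extend t 1 n z) := by
    ext I
    simp only [Finset.mem_filter, Finset.mem_powerset]
    exact ⟨fun h => ⟨⟨h.1.trans hsub, h.2⟩, h.1⟩, fun h => ⟨h.2, h.1.2⟩⟩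
  simp only [ite_smul, zero_smul]
  rw [action_last hn ht, hset, Finset.sum_filter, map_smul, map_sum, Finset.smul_sum,
    Finset.smul_sum]
  refine Finset.sum_congr rfl fun I hI => ?_
  split_ifs with hIz
  · have hwI : M.Extendable w (extend t 1 n z \ I) := hw.mono Finset.sdiff_subset
    have e1 : extend (extend t 1 n z \ I) 1 n w = extend (extend t 1 n z) 1 n w \ I := by
      have hd : Disjoint (str 1 n w) I := (disjoint_str (fun p hp => hw.2 p (hIz hp)) _ _).symm
      rw [extend_eq, extend_eq _ 1 n w, Finset.union_sdiff_distrib,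
        Finset.sdiff_eq_self_of_disjoint hd]
    rw [map_smul, highest_eq hB hwI, e1]
    simp only [smul_smul]
    congr 1
    ring
  · simp

/-- The exchange relation between `T_{n,n}(z)` and `T_{1,n}(w)` carries the action formula for
`T_{n,n}` from `t̄` to `{t̄, w}`. -/
lemma defect_last_extend (hn : 2 ≤ n) (hc : c ≠ 0) (hB : M.IsOffShell B) {z w : 𝕜} {t : Coll 𝕜}
    (hz : M.Extendable z (extend t 1 n w)) (hw : ∀ p ∈ t, p.2 ≠ w)
    (hDz : M.defect B n n z t = 0) (hDw : M.defect B n n w t = 0) :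
    M.defect B n n z (extend t 1 n w) = 0 := by
  have h1n : (1, w) ∈ extend t 1 n w := mem_extend.2 (Or.inr ⟨⟨le_rfl, hn⟩, rfl⟩)
  have hwz : w ≠ z := hz.2 _ h1n
  have m1 : 1 ∈ Finset.Icc 1 n := Finset.mem_Icc.2 ⟨le_rfl, by omega⟩
  have mn : n ∈ Finset.Icc 1 n := Finset.mem_Icc.2 ⟨by omega, le_rfl⟩
  have hzt : M.Extendable z t := hz.mono Finset.subset_union_left
  have hwt : M.Extendable w t := ⟨hz.regular, hw⟩
  have hwzt : M.Extendable w (extend t 1 n z) := by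
    refine ⟨by rw [extend_comm]; exact hz.1, fun p hp => ?_⟩
    rcases mem_extend.1 hp with h | h
    · exact hw p h
    · rw [h.2]
      exact hwz.symm
  have hκ : M.lam n w * mu c 1 n w t ≠ 0 :=
    mul_ne_zero (M.lam_ne n mn w (hwt.mem_dom hn)) (mul_ne_zero
      (hwt.psi_one_ne_zero hn hc Finset.subset_union_left)
      (hwt.phi_top_ne_zero hn hc Finset.subset_union_left))
  -- the exchange relation, applied to `B t`, expresses `T_{n,n}(z) T_{1,n}(w)` by
  -- `T_{1,n}(w) T_{n,n}(z)` and `T_{1,n}(z) T_{n,n}(w)`, whose action is known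
  have hr := M.rtt n mn n mn 1 m1 n mn z (hz.mem_dom hn) w (hwt.mem_dom hn) hwz.symm (B t)
  rw [defect, sub_eq_zero, ← action_eq_actionHat hn hc mn mn hzt] at hDz
  rw [defect, sub_eq_zero, ← action_eq_actionHat hn hc mn mn hwt] at hDw
  rw [hDz, hDw, highest_eq hB hwt, map_smul, highest_action_last hn hB hwzt hzt,
    highest_action_last hn hB hz hwt, extend_comm t 1 n 1 n w z] at hr
  rw [defect, sub_eq_zero, ← action_eq_actionHat hn hc mn mn hz]
  refine smul_right_injective H hκ ?_
  simp only
  rw [sub_eq_iff_eq_add] at hr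
  rw [hr, action_last hn hz, extend_comm t 1 n 1 n w z]
  simp only [Finset.smul_sum, ← Finset.sum_sub_distrib, ← Finset.sum_add_distrib, smul_smul,
    ← sub_smul, ← add_smul]
  refine Finset.sum_congr rfl fun I hI => ?_
  rw [Finset.mem_filter, Finset.mem_powerset] at hI
  congr 1
  obtain ⟨x, hx⟩ := filter_eq_singleton hI.2 (s := 1) (by simp [ind]; omega)
  have hxI : (1, x) ∈ I := by
    have : (1, x) ∈ I.filter (fun p => p.1 = 1) := by rw [hx]; simp
    exact (Finset.mem_filter.1 this).1
  have hxv := hI.1 hxI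
  have hxz : h c x z ≠ 0 := h_ne_zero hc (hwzt.1.2 (1, z)
    (mem_extend.2 (Or.inl (mem_extend.2 (Or.inr ⟨⟨le_rfl, hn⟩, rfl⟩)))) _ hxv rfl)
  have hxw : h c x w ≠ 0 := h_ne_zero hc (hwzt.1.2 (1, w)
    (mem_extend.2 (Or.inr ⟨⟨le_rfl, hn⟩, rfl⟩)) _ hxv rfl)
  have hI' := hI.1
  rw [extend_comm] at hI'
  rw [exchange_term hn hc hwzt.away hzt.2 hI.1 hI.2 hx hxz hxw,
    exchange_term hn hc hz.away hwt.2 hI' hI.2 hx hxw hxz, extend_comm t 1 n 1 n w z,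
    psi_one_of_filter z (fun p hp => (hI.2.mem_range hp).1) hx, extend_eq t 1 n w,
    mu_union le_rfl (by omega) z (disjoint_str hw _ _), mu_str hn]
  have hzw : z - w ≠ 0 := sub_ne_zero.2 hwz.symm
  generalize Omega c I (extend (extend t 1 n z) 1 n w \ I) = O
  -- the coefficients of the two known actions add up to `h(x, w)`, which cancels against the
  -- denominator
  have e1 : h c x w = (x - w) / c + 1 := by rw [h]; field_simp
  have e2 : h c x w = (x - w) / c + c / (z - w) * ((x - w) / c - (x - z) / c) := by
    rw [e1]; field_simp; ring
  generalize mu c 1 n z t = m1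
  generalize mu c 1 n w t = m2
  have e3 : O / h c x z = O / (h c x z * h c x w) *
      ((x - w) / c + c / (z - w) * ((x - w) / c - (x - z) / c)) := by
    rw [← e2]; field_simp
  rw [e3]
  ring

end Model

/-! ### Induction on the number of parameters -/

namespace Model

variable {𝕜 : Type*} [NontriviallyNormedField 𝕜] {H : Type*} [AddCommGroup H]
    [Module 𝕜 H] [TopologicalSpace H] {n : ℕ} {c : 𝕜} {M : Model 𝕜 H n c} {B : Coll 𝕜 → H}

lemma Generic.mono {t t' : Coll 𝕜} (ht : M.Generic t) (h : t' ⊆ t) : M.Generic t' :=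
  ⟨ht.1.mono h, fun p hp q hq => ht.2 p (h hp) q (h hq)⟩

lemma GenericAt.mono {t t' : Coll 𝕜} {z : 𝕜} (hz : M.GenericAt t z) (h : t' ⊆ t) :
    M.GenericAt t' z :=
  ⟨hz.1, fun p hp => hz.2 p (h hp)⟩

lemma GenericAt.extendable (hc : c ≠ 0) {t : Coll 𝕜} {z : 𝕜} (hz : M.GenericAt t z)
    (ht : M.Regular t) : M.Extendable z t := by
  refine ⟨⟨fun p hp => ?_, fun p hp q hq hpq => ?_⟩, fun p hp => (hz.2 p hp).1⟩
  · rcases mem_extend.1 hp with h | h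
    · exact ht.1 p h
    · exact ⟨Finset.mem_Icc.2 (by omega), h.2 ▸ hz.1⟩
  · rcases mem_extend.1 hp with h | h <;> rcases mem_extend.1 hq with h' | h'
    · exact ht.2 p h q h' hpq
    · rw [h'.2]
      exact (hz.2 p h).2.1
    · rw [h.2]
      exact (hz.2 q h').2.2
    · rw [h.2, h'.2, sub_self]
      exact hc.symm

lemma GenericAt.extend {t : Coll 𝕜} {z w : 𝕜} (hz : M.GenericAt t z) (hwz : w ≠ z)
    (h1 : w - z ≠ c) (h2 : z - w ≠ c) (l k : ℕ) : M.GenericAt (extend t l k w) z := by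
  refine ⟨hz.1, fun p hp => ?_⟩
  rcases mem_extend.1 hp with h | h
  · exact hz.2 p h
  · rw [h.2]
    exact ⟨hwz, h1, h2⟩

lemma alphaHat_ne_zero {a : ℕ} {w : 𝕜} (hw : w ∈ M.dom) (ha : 1 ≤ a) (han : a < n) :
    M.alphaHat (a, w) ≠ 0 := by
  rw [alphaHat, if_neg (by simp; omega)]
  exact div_ne_zero (M.lam_ne a (Finset.mem_Icc.2 ⟨ha, han.le⟩) w hw)
    (M.lam_ne (a + 1) (Finset.mem_Icc.2 ⟨by omega, han⟩) w hw)

/-- The last parameter of a string of equal parameters can be removed by a zero mode. -/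
lemma coef_last_ne_zero (hc : c ≠ 0) {t : Coll 𝕜} {w : 𝕜} (hw : M.GenericAt t w) {l k : ℕ}
    (hl : 1 ≤ l) (hlk : l < k) (hkn : k < n) :
    coef c M.alphaHat (k, w) (extend t l k w) ≠ 0 := by
  obtain ⟨b, rfl⟩ : ∃ b, k = b + 1 := ⟨k - 1, by omega⟩
  have h1 : Omega c {(b + 1, w)} (extend t l (b + 1) w) = 0 :=
    Omega_eq_zero (Finset.mem_singleton_self _)
      (mem_extend.2 (Or.inr ⟨⟨by simp; omega, by simp⟩, rfl⟩))
  have h2 : Omega c (str l (b + 1) w) {(b + 1, w)} = 1 := by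
    have := Omega_str_str hc (a := l) (b' := b + 1 + 1) (le_refl (b + 1)) w
    rwa [str_succ le_rfl, str_self, insert_empty_eq] at this
  rw [coef, h1, sub_zero, extend_eq,
    Omega_union_left (disjoint_str (fun p hp => (hw.2 p hp).1) _ _), h2, mul_one]
  refine mul_ne_zero (alphaHat_ne_zero hw.1 (by omega) hkn) (Omega_ne_zero hc fun p hp q hq => ?_)
  rw [Finset.mem_singleton.1 hq]
  exact ⟨(hw.2 p hp).1, (hw.2 p hp).2.1⟩

/-- The first parameter of a string of equal parameters can be removed by a zero mode. -/
lemma coef_first_ne_zero (hc : c ≠ 0) {t : Coll 𝕜} {w : 𝕜} (hw : M.GenericAt t w) {l k : ℕ}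
    (hlk : l + 1 < k) :
    coef c M.alphaHat (l, w) (extend t (l + 1) k w) ≠ 0 := by
  have h1 : Omega c (extend t (l + 1) k w) {(l, w)} = 0 :=
    Omega_eq_zero (mem_extend.2 (Or.inr ⟨⟨by simp, by simpa using hlk⟩, rfl⟩))
      (Finset.mem_singleton_self _)
  have h2 : Omega c {(l, w)} (str (l + 1) k w) = 1 := by
    have := Omega_str_str hc (a := l) (b' := k) (le_refl (l + 1)) w
    rwa [str_succ (le_refl l), str_self, insert_empty_eq] at this
  rw [coef, h1, mul_zero, zero_sub, neg_ne_zero, extend_eq,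
    Omega_union_right _ (disjoint_str (fun p hp => (hw.2 p hp).1) _ _), h2, mul_one]
  refine Omega_ne_zero hc fun p hp q hq => ?_
  rw [Finset.mem_singleton.1 hp]
  exact ⟨(hw.2 q hq).1.symm, (hw.2 q hq).2.2⟩

/-- On the vacuum only the partition in which all copies of `z` are in the first part occurs. -/
lemma defect_empty (hn : 2 ≤ n) (hc : c ≠ 0) (hB : M.IsOffShell B) {z : 𝕜} (hz : z ∈ M.dom) :
    M.defect B n n z ∅ = 0 := by
  have mn : n ∈ Finset.Icc 1 n := Finset.mem_Icc.2 ⟨by omega, le_rfl⟩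
  have hz' : M.GenericAt ∅ z := ⟨hz, by simp⟩
  have ht : M.Extendable z ∅ := hz'.extendable hc ⟨by simp, by simp⟩
  have he : extend (∅ : Coll 𝕜) 1 n z = str 1 n z := by rw [extend_eq, Finset.empty_union]
  have hf : (str 1 n z).powerset.filter (HasCards (ind 1 n)) = {str 1 n z} := by
    ext I
    rw [Finset.mem_filter, Finset.mem_powerset, Finset.mem_singleton]
    constructor
    · rintro ⟨hI, hcard⟩
      refine hI.antisymm fun p hp => ?_
      rw [mem_str] at hp
      obtain ⟨x, hx⟩ := filter_eq_singleton hcard (s := p.1) (if_pos hp.1)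
      have hxI : (p.1, x) ∈ I := by
        have : (p.1, x) ∈ I.filter (fun q => q.1 = p.1) := by rw [hx]; simp
        exact (Finset.mem_filter.1 this).1
      have : p = (p.1, x) := Prod.ext rfl (hp.2.trans (mem_str.1 (hI hxI)).2.symm)
      rwa [this]
    · rintro rfl
      exact ⟨subset_rfl, hasCards_str 1 n z⟩
  rw [defect, ← action_eq_actionHat hn hc mn mn ht, action_last hn ht, he, hf,
    Finset.sum_singleton, sdiff_self, Finset.bot_eq_empty, hB.vac, M.vac_diag n mn z hz,
    psi_one_str hc]
  simp [mu]

variable [IsTopologicalAddGroup H] [ContinuousSMul 𝕜 H] [T2Space H]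

/-- If the action formula holds after a string of equal parameters is added to the subcollections
of `t`, it holds for the string without the parameter of color `a`, provided that a zero mode can
remove this parameter. -/
lemma defect_extend_step (hn : 3 ≤ n) (hc : c ≠ 0) (hB : M.IsOffShell B) {z w : 𝕜} {t : Coll 𝕜}
    (hz : M.Extendable z (extend t 1 n w)) (hw : M.GenericAt t w) {a l k l' k' : ℕ} (ha : 1 ≤ a)
    (han : a < n) (hl : 1 ≤ l) (hk : k ≤ n)
    (hstr : str l k w = insert (a, w) (str l' k' w)) (hb : (a, w) ∉ str l' k' w)
    (hcoef : ∀ s ⊆ t, coef c M.alphaHat (a, w) (extend s l' k' w) ≠ 0)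
    (h : ∀ s ⊆ t, M.defect B n n z (extend s l k w) = 0) :
    ∀ s ⊆ t, M.defect B n n z (extend s l' k' w) = 0 := by
  intro s hs
  have hsub : extend s l k w ⊆ extend t 1 n w := by
    intro p hp
    rw [mem_extend] at hp ⊢
    rcases hp with hp | hp
    · exact Or.inl (hs hp)
    · exact Or.inr ⟨by omega, hp.2⟩
  have key := defect_diag_commutator hn hc hB ha han (hz.mono hsub)
  have hsw : ∀ p ∈ s, p.2 ≠ w := fun p hp => (hw.2 p (hs hp)).1
  have hmem : (a, w) ∈ (extend s l k w).filter (fun p => p.1 = a) := by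
    refine Finset.mem_filter.2 ⟨Finset.mem_union_right _ ?_, rfl⟩
    change _ ∈ str l k w
    rw [hstr]
    exact Finset.mem_insert_self _ _
  rw [h s hs, map_zero, Finset.sum_eq_single_of_mem (a, w) hmem,
    extend_erase_self hsw hstr hb] at key
  · exact (smul_eq_zero.1 key).resolve_left (hcoef s hs)
  · intro p hp hpa
    rw [Finset.mem_filter] at hp
    have hpw : p.2 ≠ w := fun h0 => hpa (Prod.ext hp.2 h0)
    rw [extend_erase_of_ne hpw, h _ ((Finset.erase_subset _ _).trans hs), smul_zero]

/-- Zero modes shorten a string of equal parameters from both ends. -/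
lemma defect_extend (hc : c ≠ 0) (hB : M.IsOffShell B) {z w : 𝕜} {t : Coll 𝕜}
    (hz : M.Extendable z (extend t 1 n w)) (hw : M.GenericAt t w)
    (h : ∀ s ⊆ t, M.defect B n n z (extend s 1 n w) = 0) {l k : ℕ} (hl : 1 ≤ l) (hlk : l < k)
    (hk : k ≤ n) : ∀ s ⊆ t, M.defect B n n z (extend s l k w) = 0 := by
  have h1 : 1 < k → ∀ s ⊆ t, M.defect B n n z (extend s 1 k w) = 0 := by
    induction hk using Nat.decreasingInduction with
    | self => exact fun _ => h
    | of_succ k hkn ih =>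
      intro hk
      exact defect_extend_step (by omega) hc hB hz hw hk.le hkn le_rfl hkn (str_succ hk.le w)
        (by simp [mem_str]) (fun s hs => coef_last_ne_zero hc (hw.mono hs) le_rfl hk hkn)
        (ih (by omega) (by omega))
  induction l, hl using Nat.le_induction with
  | base => exact h1 hlk
  | succ l hl ih =>
    exact defect_extend_step (by omega) hc hB hz hw hl (by omega) hl hk (str_pred (by omega) w)
      (by simp [mem_str]) (fun s hs => coef_first_ne_zero hc (hw.mono hs) hlk)
      (ih (by omega))

/-- The action formula holds for the diagonal entries. -/
lemma defect_last_eq_zero (hn : 2 ≤ n) (hc : c ≠ 0) (hB : M.IsOffShell B) (t : Coll 𝕜) :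
    M.Generic t → ∀ z, M.GenericAt t z → M.defect B n n z t = 0 := by
  induction t using Finset.strongInduction with
  | H t ih =>
    intro ht z hz
    rcases t.eq_empty_or_nonempty with rfl | ⟨⟨a, w⟩, hp⟩
    · exact defect_empty hn hc hB hz.1
    · obtain ⟨h1, h2, h3⟩ := hz.2 _ hp
      have hsub : t.erase (a, w) ⊆ t := Finset.erase_subset _ _
      have hw : M.GenericAt (t.erase (a, w)) w := by
        refine ⟨(ht.1.1 _ hp).2, fun q hq => ?_⟩
        rw [Finset.mem_erase] at hq
        have e1 := ht.2 q hq.2 _ hp hq.1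
        have e2 := ht.2 _ hp q hq.2 hq.1.symm
        exact ⟨e1.1, e1.2, e2.2⟩
      have hzw : M.Extendable z (extend (t.erase (a, w)) 1 n w) :=
        ((hz.mono hsub).extend h1 h2 h3 1 n).extendable hc
          (hw.extendable hc (ht.1.mono hsub)).1
      have han := ht.1.color hp
      have hlt : ∀ s ⊆ t.erase (a, w), s ⊂ t := fun s hs =>
        lt_of_le_of_lt hs (Finset.erase_ssubset hp)
      -- `t = t₀ ∪ {(a, w)}`: add `w` to `t₀` in all colors, then shorten the string to `a`
      have key := defect_extend hc hB hzw hw (fun s hs => ?_) han.1 (Nat.lt_succ_self a) han.2 _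
        subset_rfl
      · rwa [extend_eq, str_succ le_rfl, str_self, insert_empty_eq, Finset.union_comm,
          ← Finset.insert_eq, Finset.insert_erase hp] at key
      · exact defect_last_extend hn hc hB (hzw.mono (Finset.union_subset_union_left hs))
          (fun q hq => (hw.2 q (hs hq)).1)
          (ih s (hlt s hs) (ht.mono (hs.trans hsub)) z (hz.mono (hs.trans hsub)))
          (ih s (hlt s hs) (ht.mono (hs.trans hsub)) w (hw.mono hs))

/-- The action formula for the diagonal entries. -/
lemma T_diag_eq_action (hn : 2 ≤ n) (hc : c ≠ 0) (hB : M.IsOffShell B) {t : Coll 𝕜}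
    (ht : M.Generic t) {z : 𝕜} (hz : M.GenericAt t z) {i : ℕ} (hi : i ∈ Finset.Icc 1 n) :
    M.T i i z (B t) = M.action B i i z t := by
  have hzt := hz.extendable hc ht.1
  rw [action_eq_actionHat hn hc hi hi hzt, ← sub_eq_zero]
  rw [Finset.mem_Icc] at hi
  exact (defect_diag hn hc hB hi.1 hi.2 hzt).trans (defect_last_eq_zero hn hc hB t ht z hz)

end Model

/-! ### Labels of the copies of `z` -/

section Labels

variable {𝕜 : Type*}

lemma disjoint_union_str {X Y : Coll 𝕜} {z : 𝕜} {l k l' k' : ℕ} (hXY : Disjoint X Y)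
    (hX : ∀ p ∈ X, p.2 ≠ z) (hY : ∀ p ∈ Y, p.2 ≠ z) (h : k ≤ l') :
    Disjoint (X ∪ str l k z) (Y ∪ str l' k' z) := by
  rw [Finset.disjoint_union_left, Finset.disjoint_union_right, Finset.disjoint_union_right]
  exact ⟨⟨hXY, disjoint_str hX _ _⟩, (disjoint_str hY _ _).symm, str_disjoint z h⟩

/-- The second part of a partition with `z` in the first part for the colors below `l` and in the
third part from the color `k` on. -/
lemma sdiff_labels {t X W : Coll 𝕜} {z : 𝕜} {n l k : ℕ} (ht : ∀ p ∈ t, p.2 ≠ z) (hX : X ⊆ t)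
    (hW : W ⊆ t) (hkn : k ≤ n + 1) :
    extend t 0 (n + 1) z \ (X ∪ str 0 l z ∪ (W ∪ str k (n + 1) z)) =
      extend (t \ (X ∪ W)) l k z := by
  ext p
  by_cases hp : p.2 = z
  · have h1 : p ∉ t := fun h => ht p h hp
    have h2 : p ∉ X := fun h => h1 (hX h)
    have h3 : p ∉ W := fun h => h1 (hW h)
    simp only [Finset.mem_sdiff, Finset.mem_union, mem_extend, mem_str, h1, h2, h3, hp, and_true,
      false_or, false_and]
    omega
  · simp only [Finset.mem_sdiff, Finset.mem_union, mem_extend, mem_str, hp, and_false, or_false]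

lemma mem_union_str_iff {X : Coll 𝕜} {z : 𝕜} (hX : ∀ p ∈ X, p.2 ≠ z) {l k s : ℕ} :
    (s, z) ∈ X ∪ str l k z ↔ l ≤ s ∧ s < k := by
  rw [Finset.mem_union, mem_str]
  constructor
  · rintro (h | h)
    · exact absurd rfl (hX _ h)
    · exact h.1
  · exact fun h => Or.inr ⟨h, rfl⟩

end Labels

section Vanishing

variable {𝕜 : Type*} [Field 𝕜] {c : 𝕜}

/-- In a partition of non-zero weight, the colors in which `z` is in the first part form an initial
interval, and those in which it is in the third part form a final interval. -/
lemma exists_labels {n i : ℕ} (hi : 1 ≤ i) (hin : i ≤ n) {z : 𝕜} {t I III : Coll 𝕜}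
    (ht : ∀ p ∈ t, (1 ≤ p.1 ∧ p.1 < n) ∧ p.2 ≠ z) {al : ℕ × 𝕜 → 𝕜}
    (hx : (I, III) ∈ parts (ind 0 i) (ind i (n + 1)) (extend t 0 (n + 1) z))
    (hwt : wt c al I (extend t 0 (n + 1) z \ (I ∪ III)) III ≠ 0) :
    ∃ l k, (1 ≤ l ∧ l ≤ i) ∧ (i ≤ k ∧ k ≤ n) ∧
      ∃ X W, (X, W) ∈ parts (ind l i) (ind i k) t ∧ X ∪ str 0 l z = I ∧
        W ∪ str k (n + 1) z = III := by
  obtain ⟨hI, hIII, hd, h1, h3⟩ := mem_parts.1 hx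
  simp only at hI hIII hd h1 h3
  have m0 := zero_mem_of_hasCards hi (fun p hp => (ht p hp).1.1) h1 hI
  have mn := top_mem_of_hasCards hin (fun p hp => (ht p hp).1.2) h3 hIII
  have hz : ∀ s ≤ n, (s, z) ∈ extend t 0 (n + 1) z := fun s hs =>
    mem_extend.2 (Or.inr ⟨⟨Nat.zero_le _, Nat.lt_succ_of_le hs⟩, rfl⟩)
  have hΩ : Omega c I (extend t 0 (n + 1) z \ (I ∪ III)) ≠ 0 ∧ Omega c I III ≠ 0 ∧
      Omega c (extend t 0 (n + 1) z \ (I ∪ III)) III ≠ 0 := by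
    rw [wt, Omega₃] at hwt
    exact ⟨fun h => hwt (by rw [h]; ring), fun h => hwt (by rw [h]; ring),
      fun h => hwt (by rw [h]; ring)⟩
  -- if `z` of color `s + 1` is in an earlier part than `z` of color `s`, the weight vanishes
  have hdown : ∀ s, s + 1 ≤ n → (s + 1, z) ∈ I → (s, z) ∈ I := by
    intro s hs hsI
    by_contra hcon
    by_cases hsIII : (s, z) ∈ III
    · exact hΩ.2.1 (Omega_eq_zero hsI hsIII)
    · refine hΩ.1 (Omega_eq_zero hsI (Finset.mem_sdiff.2 ⟨hz s (by omega), ?_⟩))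
      rw [Finset.mem_union]
      exact not_or.2 ⟨hcon, hsIII⟩
  have hup : ∀ s, s + 1 ≤ n → (s, z) ∈ III → (s + 1, z) ∈ III := by
    intro s hs hsIII
    by_contra hcon
    by_cases hsI : (s + 1, z) ∈ I
    · exact hΩ.2.1 (Omega_eq_zero hsI hsIII)
    · refine hΩ.2.2 (Omega_eq_zero (Finset.mem_sdiff.2 ⟨hz (s + 1) hs, ?_⟩) hsIII)
      rw [Finset.mem_union]
      exact not_or.2 ⟨hsI, hcon⟩
  have hiI : (i, z) ∉ I := fun h => (h1.mem_range h).2.ne rfl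
  have hexl : ∃ s, (s, z) ∉ I := ⟨i, hiI⟩
  have hexk : ∃ s, (s, z) ∈ III := ⟨n, mn⟩
  -- `l` is the first color in which `z` is not in `I`, `k` the first one in which it is in `III`
  set l := Nat.find hexl with hldef
  set k := Nat.find hexk with hkdef
  have hl1 : 1 ≤ l := by
    rw [Nat.one_le_iff_ne_zero]
    intro h0
    exact Nat.find_spec hexl (by rw [← hldef, h0]; exact m0)
  have hli : l ≤ i := Nat.find_min' hexl hiI
  have hkn : k ≤ n := Nat.find_min' hexk mn
  have hik : i ≤ k := (h3.mem_range (Nat.find_spec hexk)).1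
  have hIiff : ∀ s, (s, z) ∈ I ↔ s < l := by
    intro s
    constructor
    · intro hs
      by_contra hcon
      have hle : l ≤ s := not_lt.1 hcon
      clear hcon
      induction s, hle using Nat.le_induction with
      | base => exact Nat.find_spec hexl hs
      | succ s hs' ih =>
        exact ih (hdown s (by have := (h1.mem_range hs).2; simp only at this; omega) hs)
    · intro hs
      by_contra hcon
      exact Nat.find_min hexl hs hcon
  have hIIIiff : ∀ s, (s, z) ∈ III ↔ k ≤ s ∧ s < n + 1 := by
    intro s
    constructor
    · intro hs
      exact ⟨Nat.find_min' hexk hs, (h3.mem_range hs).2⟩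
    · rintro ⟨hs, hsn⟩
      induction s, hs using Nat.le_induction with
      | base => exact Nat.find_spec hexk
      | succ s hs ih => exact hup s (by omega) (ih (by omega))
  have sI : str 0 l z ⊆ I := by
    rintro ⟨s, y⟩ hp
    rw [mem_str] at hp
    obtain ⟨hp1, rfl⟩ := hp
    exact (hIiff s).2 hp1.2
  have sIII : str k (n + 1) z ⊆ III := by
    rintro ⟨s, y⟩ hp
    rw [mem_str] at hp
    obtain ⟨hp1, rfl⟩ := hp
    exact (hIIIiff s).2 hp1
  refine ⟨l, k, ⟨hl1, hli⟩, ⟨hik, hkn⟩, I \ str 0 l z, III \ str k (n + 1) z,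
    mem_parts.2 ⟨?_, ?_, hd.mono Finset.sdiff_subset Finset.sdiff_subset, ?_, ?_⟩,
    Finset.sdiff_union_of_subset sI, Finset.sdiff_union_of_subset sIII⟩
  · rintro ⟨s, y⟩ hp
    rw [Finset.mem_sdiff] at hp
    rcases mem_extend.1 (hI hp.1) with h | ⟨-, rfl⟩
    · exact h
    · exact absurd (mem_str.2 ⟨⟨Nat.zero_le _, (hIiff s).1 hp.1⟩, rfl⟩) hp.2
  · rintro ⟨s, y⟩ hp
    rw [Finset.mem_sdiff] at hp
    rcases mem_extend.1 (hIII hp.1) with h | ⟨-, rfl⟩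
    · exact h
    · exact absurd (mem_str.2 ⟨(hIIIiff s).1 hp.1, rfl⟩) hp.2
  · rw [← hasCards_union_str_zero hli Finset.sdiff_disjoint, Finset.sdiff_union_of_subset sI]
    exact h1
  · rw [← hasCards_union_str_top hik hkn Finset.sdiff_disjoint,
      Finset.sdiff_union_of_subset sIII]
    exact h3

end Vanishing

/-! ### The action formula in the original parameters -/

namespace Model

variable {𝕜 : Type*} [NontriviallyNormedField 𝕜] {H : Type*} [AddCommGroup H]
    [Module 𝕜 H] [TopologicalSpace H] {n : ℕ} {c : 𝕜} {M : Model 𝕜 H n c} {B : Coll 𝕜 → H}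

/-- The coefficient of a term of the action formula with `z` distributed over the three parts. -/
lemma lam_mul_mu_mul_Upsilon (hn : 2 ≤ n) (hc : c ≠ 0) {z : 𝕜} {t X Y W : Coll 𝕜}
    (ht : M.Extendable z t) (hu : X ∪ Y ∪ W = t) (h12 : Disjoint X Y) (h13 : Disjoint X W)
    (h23 : Disjoint Y W) {l k : ℕ} (hl : 1 ≤ l) (hlk : l ≤ k) (hkn : k ≤ n) :
    M.lam k z * mu c l k z Y * M.Upsilon l k z X Y W =
      M.lam n z * wt c M.alphaHat (X ∪ str 0 l z) (Y ∪ str l k z) (W ∪ str k (n + 1) z) := by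
  have hXt : X ⊆ t := by
    rw [← hu]; exact Finset.subset_union_left.trans Finset.subset_union_left
  have hYt : Y ⊆ t := by
    rw [← hu]; exact Finset.subset_union_right.trans Finset.subset_union_left
  have hWt : W ⊆ t := by
    rw [← hu]; exact Finset.subset_union_right
  have hX := fun p hp => ht.2 p (hXt hp)
  have hY := fun p hp => ht.2 p (hYt hp)
  have hW := fun p hp => ht.2 p (hWt hp)
  have hYa := ht.away.mono hYt
  have hlam : M.lam k z ≠ 0 :=
    M.lam_ne k (Finset.mem_Icc.2 ⟨by omega, hkn⟩) z (ht.mem_dom hn)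
  have hmu : mu c l k z Y ≠ 0 :=
    mul_ne_zero (psi_ne_zero hc hl hYa) (phi_ne_zero hc (by omega) hYa)
  have hu' : extend X 1 l z ∪ extend Y l k z ∪ extend W k n z = extend t 1 n z := by
    simp only [extend_eq]
    rw [← hu, ← str_union z hl (hlk.trans hkn), ← str_union z hlk hkn]
    ac_rfl
  have eI : extend X 1 l z ∪ str 0 1 z = X ∪ str 0 l z := by
    rw [extend_eq, Finset.union_assoc, Finset.union_comm (str 1 l z),
      str_union z (Nat.zero_le 1) hl]
  have eIII : extend W k n z ∪ str n (n + 1) z = W ∪ str k (n + 1) z := by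
    rw [extend_eq, Finset.union_assoc, str_union z hkn (by omega)]
  have key := mu_mul_weight hn hc ht hu' (disjoint_union_str h12 hX hY le_rfl)
    (disjoint_union_str h13 hX hW hlk) (disjoint_union_str h23 hY hW le_rfl)
  rw [eI, eIII] at key
  change _ = wt c M.alphaHat _ (Y ∪ str l k z) _ at key
  rw [← key, Upsilon, hu]
  field_simp

/-- The explicit form of the functions `Υ`. -/
lemma Upsilon_eq (hn : 2 ≤ n) (hc : c ≠ 0) {z : 𝕜} {t X Y W : Coll 𝕜}
    (ht : M.Extendable z t) (hu : X ∪ Y ∪ W = t) (h12 : Disjoint X Y) (h13 : Disjoint X W)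
    (h23 : Disjoint Y W) {l k : ℕ} (hl : 1 ≤ l) (hlk : l ≤ k) (hkn : k ≤ n) :
    M.Upsilon l k z X Y W = wt c M.alphaHat X Y W * phi c l z X * psi c k z W := by
  have hXt : X ⊆ t := by
    rw [← hu]; exact Finset.subset_union_left.trans Finset.subset_union_left
  have hYt : Y ⊆ t := by
    rw [← hu]; exact Finset.subset_union_right.trans Finset.subset_union_left
  have hWt : W ⊆ t := by
    rw [← hu]; exact Finset.subset_union_right
  have hYa := ht.away.mono hYt
  have hz := ht.mem_dom hn
  have hlam : M.lam k z ≠ 0 := M.lam_ne k (Finset.mem_Icc.2 ⟨by omega, hkn⟩) z hz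
  have hlam' : M.lam n z ≠ 0 := M.lam_ne n (Finset.mem_Icc.2 ⟨by omega, le_rfl⟩) z hz
  have hmu : mu c l k z Y ≠ 0 :=
    mul_ne_zero (psi_ne_zero hc hl hYa) (phi_ne_zero hc (by omega) hYa)
  have key := lam_mul_mu_mul_Upsilon hn hc ht hu h12 h13 h23 hl hlk hkn
  rw [wt_strings hc hl hlk hkn (ht.away.mono hXt) hYa (ht.away.mono hWt),
    prod_alphaHat_str hz (by omega) hkn] at key
  refine mul_left_cancel₀ (mul_ne_zero hlam hmu) (key.trans ?_)
  field_simp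

lemma diagTerm_eq_sum_parts {i l k : ℕ} {z : 𝕜} {t : Coll 𝕜} (hl : 1 ≤ l) (hi : 1 ≤ i)
    (hin : i ≤ n) (hkn : k ≤ n) (ht : ∀ p ∈ t, 1 ≤ p.1 ∧ p.1 < n) :
    M.diagTerm B i l k z t = ∑ x ∈ parts (ind l i) (ind i k) t,
      (M.lam k z * mu c l k z (t \ (x.1 ∪ x.2)) * M.Upsilon l k z x.1 (t \ (x.1 ∪ x.2)) x.2) •
        B (extend (t \ (x.1 ∪ x.2)) l k z) := by
  rw [diagTerm, sum_partitions (r₁' := ind l i) (r₃' := ind i k) ht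
    (fun s _ _ => theta_mul l i s) (fun s hs => by simp only [ind]; rw [if_neg]; omega)
    (fun s _ _ => theta_mul' i k s) (fun s hs => by simp only [ind]; rw [if_neg]; omega)
    (fun X Y W => (M.lam k z * mu c l k z Y * M.Upsilon l k z X Y W) • B (extend Y l k z))]

/-- The action formula as a sum over partitions of the original Bethe parameters. -/
lemma action_eq_sum_diagTerm (hn : 2 ≤ n) (hc : c ≠ 0) {z : 𝕜} {t : Coll 𝕜}
    (ht : M.Extendable z t) {i : ℕ} (hi : i ∈ Finset.Icc 1 n) :
    M.action B i i z t =
      ∑ l ∈ Finset.Icc 1 i, ∑ k ∈ Finset.Icc i n, M.diagTerm B i l k z t := by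
  rw [action_eq_actionHat hn hc hi hi ht, actionHat, actSum, partSum, Finset.smul_sum]
  rw [Finset.mem_Icc] at hi
  have hne := ht.2
  have hdiag : ∀ l ∈ Finset.Icc 1 i, ∀ k ∈ Finset.Icc i n, M.diagTerm B i l k z t =
      ∑ x ∈ parts (ind l i) (ind i k) t,
        (M.lam n z * wt c M.alphaHat (x.1 ∪ str 0 l z)
          (extend t 0 (n + 1) z \ (x.1 ∪ str 0 l z ∪ (x.2 ∪ str k (n + 1) z)))
          (x.2 ∪ str k (n + 1) z)) •
          B (extend t 0 (n + 1) z \ (x.1 ∪ str 0 l z ∪ (x.2 ∪ str k (n + 1) z))) := by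
    intro l hl k hk
    rw [Finset.mem_Icc] at hl hk
    rw [diagTerm_eq_sum_parts hl.1 hi.1 hi.2 hk.2 fun p hp => ht.color hp]
    refine Finset.sum_congr rfl fun x hx => ?_
    obtain ⟨hX, hW, hd, -⟩ := mem_parts.1 hx
    obtain ⟨hu, h12, h23⟩ := partition_sdiff hX hW
    rw [lam_mul_mu_mul_Upsilon hn hc ht hu h12 hd h23 hl.1 (hl.2.trans hk.1) hk.2,
      sdiff_labels hne hX hW (by omega)]
    rfl
  rw [Finset.sum_congr rfl fun l hl => Finset.sum_congr rfl (hdiag l hl), ← Finset.sum_product',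
    Finset.sum_sigma']
  symm
  -- the partitions that are not of this form have weight zero
  refine Finset.sum_of_injOn
    (fun y => (y.2.1 ∪ str 0 y.1.1 z, y.2.2 ∪ str y.1.2 (n + 1) z)) ?_ ?_ ?_ ?_
  · rintro ⟨⟨l, k⟩, X, W⟩ hy ⟨⟨l', k'⟩, X', W'⟩ hy' heq
    simp only [Finset.coe_sigma, Set.mem_sigma_iff, Finset.mem_coe, Finset.mem_product,
      Finset.mem_Icc, mem_parts] at hy hy'
    simp only [Prod.mk.injEq] at heq
    obtain ⟨⟨hl, hk⟩, hX, hW, -⟩ := hy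
    obtain ⟨⟨hl', hk'⟩, hX', hW', -⟩ := hy'
    have eX : ∀ s, (s, z) ∈ X ∪ str 0 l z ↔ (s, z) ∈ X' ∪ str 0 l' z := fun s => by rw [heq.1]
    have eW : ∀ s, (s, z) ∈ W ∪ str k (n + 1) z ↔ (s, z) ∈ W' ∪ str k' (n + 1) z :=
      fun s => by rw [heq.2]
    simp only [mem_union_str_iff fun p hp => hne p (hX hp),
      mem_union_str_iff fun p hp => hne p (hX' hp)] at eX
    simp only [mem_union_str_iff fun p hp => hne p (hW hp),
      mem_union_str_iff fun p hp => hne p (hW' hp)] at eW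
    have hll : l = l' := by
      have a1 := eX l
      have a2 := eX l'
      omega
    have hkk : k = k' := by
      have a1 := eW k
      have a2 := eW k'
      omega
    subst hll hkk
    have hXX : X = X' := by
      rw [← Finset.union_sdiff_cancel_right (disjoint_str (fun p hp => hne p (hX hp)) 0 l),
        heq.1, Finset.union_sdiff_cancel_right (disjoint_str (fun p hp => hne p (hX' hp)) 0 l)]
    have hWW : W = W' := by
      rw [← Finset.union_sdiff_cancel_right (disjoint_str (fun p hp => hne p (hW hp)) k (n + 1)),
        heq.2,
        Finset.union_sdiff_cancel_right (disjoint_str (fun p hp => hne p (hW' hp)) k (n + 1))]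
    rw [hXX, hWW]
  · rintro ⟨⟨l, k⟩, X, W⟩ hy
    simp only [Finset.coe_sigma, Set.mem_sigma_iff, Finset.mem_coe, Finset.mem_product,
      Finset.mem_Icc, mem_parts] at hy
    obtain ⟨⟨hl, hk⟩, hX, hW, hd, h1, h3⟩ := hy
    have hX' := fun p hp => hne p (hX hp)
    have hW' := fun p hp => hne p (hW hp)
    refine mem_parts.2 ⟨?_, ?_, disjoint_union_str hd hX' hW' (hl.2.trans hk.1),
      (hasCards_union_str_zero hl.2 (disjoint_str hX' _ _)).2 h1,
      (hasCards_union_str_top hk.1 hk.2 (disjoint_str hW' _ _)).2 h3⟩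
    · refine Finset.union_subset_union hX fun p hp => ?_
      rw [mem_str] at hp
      have hpl : p.1 < l := hp.1.2
      exact mem_str.2 ⟨by omega, hp.2⟩
    · refine Finset.union_subset_union hW fun p hp => ?_
      rw [mem_str] at hp
      exact mem_str.2 ⟨by omega, hp.2⟩
  · rintro ⟨I, III⟩ hx hnot
    by_cases hw : wt c M.alphaHat I (extend t 0 (n + 1) z \ (I ∪ III)) III = 0
    · simp only [hw, zero_smul, smul_zero]
    · obtain ⟨l, k, hl, hk, X, W, hXW, h1, h3⟩ :=
        exists_labels hi.1 hi.2 (fun p hp => ⟨ht.color hp, ht.2 p hp⟩) hx hw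
      refine absurd ⟨⟨(l, k), (X, W)⟩, ?_, Prod.ext h1 h3⟩ hnot
      simp only [Finset.coe_sigma, Set.mem_sigma_iff, Finset.mem_coe, Finset.mem_product,
        Finset.mem_Icc]
      exact ⟨⟨hl, hk⟩, hXW⟩
  · rintro ⟨⟨l, k⟩, X, W⟩ _
    simp only [mul_smul]

end Model

/-! ### Cuts of a collection -/

section OnShellWeights

variable {𝕜 : Type*}

lemma hasCards_filter_lt {l i k : ℕ} (hik : i ≤ k) {r : Coll 𝕜}
    (hr : HasCards (ind l k) r) : HasCards (ind l i) (r.filter fun p => p.1 < i) := by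
  intro s
  by_cases hs : s < i
  · have : (r.filter fun p => p.1 < i).filter (fun p => p.1 = s) =
        r.filter fun p => p.1 = s := by
      rw [Finset.filter_filter]
      exact Finset.filter_congr fun p _ => ⟨fun h => h.2, fun h => ⟨by omega, h⟩⟩
    rw [this, hr s]
    simp only [ind]
    split_ifs <;> omega
  · rw [ind, if_neg (by omega), Finset.card_eq_zero, Finset.filter_eq_empty_iff]
    intro p hp hps
    have := (Finset.mem_filter.1 hp).2
    omega

lemma hasCards_filter_ge {l i k : ℕ} (hli : l ≤ i) {r : Coll 𝕜}
    (hr : HasCards (ind l k) r) : HasCards (ind i k) (r.filter fun p => i ≤ p.1) := by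
  intro s
  by_cases hs : i ≤ s
  · have : (r.filter fun p => i ≤ p.1).filter (fun p => p.1 = s) =
        r.filter fun p => p.1 = s := by
      rw [Finset.filter_filter]
      exact Finset.filter_congr fun p _ => ⟨fun h => h.2, fun h => ⟨by omega, h⟩⟩
    rw [this, hr s]
    simp only [ind]
    split_ifs <;> omega
  · rw [ind, if_neg (by omega), Finset.card_eq_zero, Finset.filter_eq_empty_iff]
    intro p hp hps
    have := (Finset.mem_filter.1 hp).2
    omega

lemma filter_lt_union_filter_ge (r : Coll 𝕜) (i : ℕ) :
    (r.filter fun p => p.1 < i) ∪ (r.filter fun p => i ≤ p.1) = r := by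
  simpa only [not_lt] using Finset.filter_union_filter_not_eq (fun p : ℕ × 𝕜 => p.1 < i) r

lemma disjoint_filter_lt_filter_ge (r : Coll 𝕜) (i : ℕ) :
    Disjoint (r.filter fun p => p.1 < i) (r.filter fun p => i ≤ p.1) :=
  Finset.disjoint_filter.2 fun _ _ h => not_le.2 h

/-- A pair of outer parts with one parameter in each of the colors `l, …, i - 1` and
`i, …, k - 1` is a collection with one parameter in each of the colors `l, …, k - 1`. -/
lemma sum_parts_ind {E : Type*} [AddCommMonoid E] {l i k : ℕ} (hli : l ≤ i) (hik : i ≤ k)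
    (t : Coll 𝕜) (F : Coll 𝕜 → Coll 𝕜 → E) :
    ∑ x ∈ parts (ind l i) (ind i k) t, F x.1 x.2 =
      ∑ r ∈ t.powerset.filter (HasCards (ind l k)),
        F (r.filter fun p => p.1 < i) (r.filter fun p => i ≤ p.1) := by
  have hsplit : ∀ {X W : Coll 𝕜}, HasCards (ind l i) X → HasCards (ind i k) W →
      ((X ∪ W).filter fun p => p.1 < i) = X ∧ ((X ∪ W).filter fun p => i ≤ p.1) = W := by
    intro X W hX hW
    constructor <;> ext p <;> simp only [Finset.mem_filter, Finset.mem_union]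
    · constructor
      · rintro ⟨h | h, hp⟩
        · exact h
        · have := (hW.mem_range h).1
          omega
      · exact fun h => ⟨Or.inl h, (hX.mem_range h).2⟩
    · constructor
      · rintro ⟨h | h, hp⟩
        · have := (hX.mem_range h).2
          omega
        · exact h
      · exact fun h => ⟨Or.inr h, (hW.mem_range h).1⟩
  refine Finset.sum_bij' (fun x _ => x.1 ∪ x.2)
    (fun r _ => (r.filter fun p => p.1 < i, r.filter fun p => i ≤ p.1)) ?_ ?_ ?_ ?_ ?_
  · rintro ⟨X, W⟩ hx
    obtain ⟨hX, hW, hd, h1, h3⟩ := mem_parts.1 hx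
    rw [Finset.mem_filter, Finset.mem_powerset]
    refine ⟨Finset.union_subset hX hW, ?_⟩
    have := (hasCards_union hd h3).2 h1
    convert this using 1
    funext s
    simp only [ind]
    split_ifs <;> omega
  · intro r hr
    rw [Finset.mem_filter, Finset.mem_powerset] at hr
    exact mem_parts.2 ⟨(Finset.filter_subset _ _).trans hr.1,
      (Finset.filter_subset _ _).trans hr.1, disjoint_filter_lt_filter_ge r i,
      hasCards_filter_lt hik hr.2, hasCards_filter_ge hli hr.2⟩
  · rintro ⟨X, W⟩ hx
    obtain ⟨-, -, -, h1, h3⟩ := mem_parts.1 hx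
    simp only [(hsplit h1 h3).1, (hsplit h1 h3).2]
  · intro r _
    exact filter_lt_union_filter_ge r i
  · rintro ⟨X, W⟩ hx
    obtain ⟨-, -, -, h1, h3⟩ := mem_parts.1 hx
    simp only [(hsplit h1 h3).1, (hsplit h1 h3).2]

end OnShellWeights

/-! ### The on-shell cancellation -/

section Telescope

variable {𝕜 : Type*} [Field 𝕜] {c : 𝕜}

/-- The interactions inside a collection, with either orientation, have the same product. -/
lemma prod_single_erase_comm (W : Coll 𝕜) :
    ∏ p ∈ W, Omega c {p} (W.erase p) = ∏ p ∈ W, Omega c (W.erase p) {p} := by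
  simp only [Omega_single_left, Omega_single_right]
  refine Finset.prod_comm' fun p q => ?_
  simp only [Finset.mem_erase]
  exact ⟨fun h => ⟨⟨h.2.1.symm, h.1⟩, h.2.2⟩, fun h => ⟨h.1.2, h.1.1.symm, h.2⟩⟩

/-- If `α` takes on-shell values on `W`, its product over `W` is the ratio of the interactions of
`W` with the other parameters: the interactions inside `W` cancel. -/
lemma prod_onShell (hc : c ≠ 0) {V W : Coll 𝕜} (hVW : Disjoint V W) {al : ℕ × 𝕜 → 𝕜}
    (hW : ∀ p ∈ W, ∀ q ∈ W, p ≠ q → p.2 ≠ q.2 ∧ p.2 - q.2 ≠ c)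
    (hal : ∀ p ∈ W, al p = Omega c {p} ((V ∪ W).erase p) / Omega c ((V ∪ W).erase p) {p}) :
    ∏ p ∈ W, al p = Omega c W V / Omega c V W := by
  have he : ∀ p ∈ W, (V ∪ W).erase p = V ∪ W.erase p := fun p hp => by
    rw [Finset.erase_union_distrib, Finset.erase_eq_of_notMem (Finset.disjoint_right.1 hVW hp)]
  have hd : ∀ p, Disjoint V (W.erase p) := fun p => hVW.mono_right (Finset.erase_subset _ _)
  have hne : ∏ p ∈ W, Omega c (W.erase p) {p} ≠ 0 := by
    refine Finset.prod_ne_zero_iff.2 fun p hp => Omega_ne_zero hc fun q hq r hr => ?_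
    rw [Finset.mem_singleton.1 hr]
    rw [Finset.mem_erase] at hq
    exact hW q hq.2 p hp hq.1
  calc ∏ p ∈ W, al p = ∏ p ∈ W, Omega c {p} V * Omega c {p} (W.erase p) /
        (Omega c V {p} * Omega c (W.erase p) {p}) :=
        Finset.prod_congr rfl fun p hp => by
          rw [hal p hp, he p hp, Omega_union_left (hd p), Omega_union_right _ (hd p)]
    _ = _ := by
      rw [Finset.prod_div_distrib, Finset.prod_mul_distrib, Finset.prod_mul_distrib,
        prod_single_erase_comm, ← Omega_eq_prod_left, ← Omega_eq_prod_right,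
        mul_div_mul_right _ _ hne]

/-- The sum over the ways of cutting a collection with one parameter in each of the colors
`l, …, k - 1` telescopes to zero. -/
lemma sum_cut_eq_zero (hc : c ≠ 0) {l k : ℕ} (hl : 1 ≤ l) (hlk : l < k) {z : 𝕜} {r : Coll 𝕜}
    (hr : HasCards (ind l k) r) (hz : ∀ p ∈ r, p.2 ≠ z) :
    ∑ i ∈ Finset.Icc l k,
      Omega c (r.filter fun p => i ≤ p.1) (r.filter fun p => p.1 < i) *
        phi c l z (r.filter fun p => p.1 < i) * psi c k z (r.filter fun p => i ≤ p.1) = 0 := by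
  obtain ⟨x, rfl⟩ := hr.exists_image
  have hxz : ∀ s, l ≤ s → s < k → x s ≠ z := fun s h1 h2 =>
    hz (s, x s) (Finset.mem_image.2 ⟨s, Finset.mem_Ico.2 ⟨h1, h2⟩, rfl⟩)
  have hinj : ∀ s : Finset ℕ, Set.InjOn (fun s => (s, x s)) (s : Set ℕ) :=
    fun s a _ b _ h => (Prod.mk.inj h).1
  have hlt : ∀ i ∈ Finset.Icc l k, ((Finset.Ico l k).image fun s => (s, x s)).filter
      (fun p => p.1 < i) = (Finset.Ico l i).image fun s => (s, x s) := by
    intro i hi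
    rw [Finset.mem_Icc] at hi
    rw [Finset.filter_image]
    congr 1
    ext s
    simp only [Finset.mem_filter, Finset.mem_Ico]
    omega
  have hge : ∀ i ∈ Finset.Icc l k, ((Finset.Ico l k).image fun s => (s, x s)).filter
      (fun p => i ≤ p.1) = (Finset.Ico i k).image fun s => (s, x s) := by
    intro i hi
    rw [Finset.mem_Icc] at hi
    rw [Finset.filter_image]
    congr 1
    ext s
    simp only [Finset.mem_filter, Finset.mem_Ico]
    omega
  -- with `z` placed below the color `l` and above the color `k - 1`, every cut contributes a
  -- difference of two neighbours
  set y : ℕ → 𝕜 := fun m => if m = l ∨ m = k + 1 then z else x (m - 1) with hy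
  have hterm : ∀ i ∈ Finset.Icc l k,
      Omega c ((Finset.Ico i k).image fun s => (s, x s))
          ((Finset.Ico l i).image fun s => (s, x s)) *
        phi c l z ((Finset.Ico l i).image fun s => (s, x s)) *
        psi c k z ((Finset.Ico i k).image fun s => (s, x s)) =
      g c (x l) z * g c z (x (k - 1)) / c * (y (i + 1) - y i) := by
    intro i hi
    rw [Finset.mem_Icc] at hi
    have hphi : phi c l z ((Finset.Ico l i).image fun s => (s, x s)) =
        if l < i then g c (x l) z else 1 := by
      rw [phi_eq_prod l hl, Finset.prod_image (hinj _)]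
      have : ∀ s ∈ Finset.Ico l i, (if s = l then g c (x s) z else
          if s + 1 = l then h c z (x s) else 1) = if s = l then g c (x l) z else 1 := by
        intro s hs
        rw [Finset.mem_Ico] at hs
        by_cases e : s = l
        · rw [if_pos e, if_pos e, e]
        · rw [if_neg e, if_neg e, if_neg (by omega)]
      simp only
      rw [Finset.prod_congr rfl this, Finset.prod_ite_eq' (Finset.Ico l i) l]
      simp
    have hpsi : psi c k z ((Finset.Ico i k).image fun s => (s, x s)) =
        if i < k then g c z (x (k - 1)) else 1 := by
      rw [psi_eq_prod k (by omega), Finset.prod_image (hinj _)]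
      have : ∀ s ∈ Finset.Ico i k, (if s = k then h c (x s) z else
          if s + 1 = k then g c z (x s) else 1) = if s = k - 1 then g c z (x (k - 1)) else 1 := by
        intro s hs
        rw [Finset.mem_Ico] at hs
        by_cases e : s = k - 1
        · rw [if_neg (by omega), if_pos (by omega), if_pos e, e]
        · rw [if_neg (by omega), if_neg (by omega), if_neg e]
      simp only
      rw [Finset.prod_congr rfl this, Finset.prod_ite_eq' (Finset.Ico i k) (k - 1)]
      congr 1
      rw [Finset.mem_Ico, eq_iff_iff]
      omega
    have hOmega : Omega c ((Finset.Ico i k).image fun s => (s, x s))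
        ((Finset.Ico l i).image fun s => (s, x s)) =
        if l < i ∧ i < k then (x i - x (i - 1)) / c else 1 := by
      rw [Omega, Finset.prod_image (hinj _)]
      simp only [Finset.prod_image (hinj _)]
      split_ifs with e
      · rw [Finset.prod_eq_single_of_mem i (Finset.mem_Ico.2 ⟨le_rfl, e.2⟩),
          Finset.prod_eq_single_of_mem (i - 1) (Finset.mem_Ico.2 ⟨by omega, by omega⟩)]
        · obtain ⟨b, rfl⟩ : ∃ b, i = b + 1 := ⟨i - 1, by omega⟩
          exact gam_pred _ _ _
        · intro s hs hne
          rw [Finset.mem_Ico] at hs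
          exact gam_far _ _ (by omega) (by omega) (by omega)
        · intro s hs hne
          rw [Finset.mem_Ico] at hs
          refine Finset.prod_eq_one fun s' hs' => ?_
          rw [Finset.mem_Ico] at hs'
          exact gam_far _ _ (by omega) (by omega) (by omega)
      · refine Finset.prod_eq_one fun s hs => Finset.prod_eq_one fun s' hs' => ?_
        rw [Finset.mem_Ico] at hs hs'
        omega
    have d1 : x l - z ≠ 0 := sub_ne_zero.2 (hxz l le_rfl hlk)
    have d2 : z - x (k - 1) ≠ 0 := sub_ne_zero.2 (hxz (k - 1) (by omega) (by omega)).symm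
    have hy1 : y (i + 1) = if i = k then z else x i := by
      simp only [hy]
      by_cases e : i = k
      · rw [if_pos (by omega), if_pos e]
      · rw [if_neg (by omega), if_neg e, Nat.add_sub_cancel]
    have hy2 : y i = if i = l then z else x (i - 1) := by
      simp only [hy]
      by_cases e : i = l
      · rw [if_pos (by omega), if_pos e]
      · rw [if_neg (by omega), if_neg e]
    rw [hphi, hpsi, hOmega, hy1, hy2]
    by_cases e1 : i = l
    · subst e1
      rw [if_neg (by omega), if_neg (by omega), if_pos hlk, if_neg (by omega), if_pos rfl, g, g]
      field_simp
    · by_cases e2 : i = k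
      · subst e2
        rw [if_neg (by omega), if_pos hlk, if_neg (by omega), if_pos rfl, if_neg e1, g, g]
        field_simp
      · rw [if_pos (by omega), if_pos (by omega), if_pos (by omega), if_neg e2, if_neg e1, g, g]
        field_simp
  have hsum : ∑ i ∈ Finset.Icc l k, (y (i + 1) - y i) = 0 := by
    have h1 : Finset.Icc l k = Finset.Ico l (k + 1) := by
      ext s
      simp only [Finset.mem_Icc, Finset.mem_Ico]
      omega
    rw [h1, Finset.sum_Ico_sub y (by omega)]
    simp [hy]
  rw [Finset.sum_congr rfl fun i hi => by rw [hlt i hi, hge i hi, hterm i hi], ← Finset.mul_sum,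
    hsum, mul_zero]

end Telescope

/-- The sum over `ℓ ≤ i ≤ k`, split into the terms with `ℓ = k` and those with `ℓ < k`. -/
lemma sum_triangle {E : Type*} [AddCommMonoid E] (n : ℕ) (F : ℕ → ℕ → ℕ → E) :
    ∑ i ∈ Finset.Icc 1 n, ∑ l ∈ Finset.Icc 1 i, ∑ k ∈ Finset.Icc i n, F i l k =
      ∑ i ∈ Finset.Icc 1 n, F i i i +
        ∑ l ∈ Finset.Icc 1 (n - 1), ∑ k ∈ Finset.Icc (l + 1) n, ∑ i ∈ Finset.Icc l k, F i l k := by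
  have h1 : ∑ i ∈ Finset.Icc 1 n, ∑ l ∈ Finset.Icc 1 i, ∑ k ∈ Finset.Icc i n, F i l k =
      ∑ l ∈ Finset.Icc 1 n, ∑ k ∈ Finset.Icc l n, ∑ i ∈ Finset.Icc l k, F i l k := by
    rw [Finset.sum_comm' (t' := Finset.Icc 1 n) (s' := fun l => Finset.Icc l n)]
    · refine Finset.sum_congr rfl fun l hl => Finset.sum_comm' fun i k => ?_
      simp only [Finset.mem_Icc]
      omega
    · intro i l
      simp only [Finset.mem_Icc]
      omega
  have h2 : ∀ l ∈ Finset.Icc 1 n, ∑ k ∈ Finset.Icc l n, ∑ i ∈ Finset.Icc l k, F i l k =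
      F l l l + ∑ k ∈ Finset.Icc (l + 1) n, ∑ i ∈ Finset.Icc l k, F i l k := by
    intro l hl
    rw [← Finset.insert_Icc_add_one_left_eq_Icc (Finset.mem_Icc.1 hl).2,
      Finset.sum_insert (by simp), Finset.Icc_self, Finset.sum_singleton]
  rw [h1, Finset.sum_congr rfl h2, Finset.sum_add_distrib]
  congr 1
  refine (Finset.sum_subset (Finset.Icc_subset_Icc_right (Nat.sub_le n 1)) ?_).symm
  intro l hl hl'
  rw [Finset.mem_Icc] at hl hl'
  rw [Finset.Icc_eq_empty (by omega), Finset.sum_empty]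

/-! ### Wanted and unwanted terms -/

namespace Model

variable {𝕜 : Type*} [NontriviallyNormedField 𝕜] {H : Type*} [AddCommGroup H]
    [Module 𝕜 H] [TopologicalSpace H] {n : ℕ} {c : 𝕜} {M : Model 𝕜 H n c} {B : Coll 𝕜 → H}

/-- The wanted terms, in which `z` is in no second part. -/
lemma diagTerm_self (hn : 2 ≤ n) (hc : c ≠ 0) {z : 𝕜} {t : Coll 𝕜} (ht : M.Extendable z t) {i : ℕ}
    (hi : i ∈ Finset.Icc 1 n) :
    M.diagTerm B i i i z t = (M.lam i z * setProd (f c) {z} (color t (i - 1)) *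
      setProd (f c) (color t i) {z}) • B t := by
  rw [Finset.mem_Icc] at hi
  rw [diagTerm_eq_sum_parts hi.1 hi.1 hi.2 hi.2 fun p hp => ht.color hp, parts_zero,
    Finset.sum_singleton]
  simp only [Finset.empty_union, Finset.sdiff_empty]
  have hu : (∅ : Coll 𝕜) ∪ t ∪ ∅ = t := by simp
  rw [Upsilon_eq hn hc ht hu (by simp) (by simp) (by simp) hi.1 le_rfl hi.2, extend_eq, str_self,
    Finset.union_empty]
  congr 1
  have hf : ∀ X Y : Finset 𝕜, setProd (f c) X Y = setProd (h c) X Y * setProd (g c) X Y := by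
    intro X Y
    simp only [setProd, f, Finset.prod_mul_distrib]
  simp only [wt, Omega₃, Omega_empty_left, Omega_empty_right, Finset.prod_empty, phi_empty,
    psi_empty]
  simp only [mu, psi, phi, hf]
  ring

/-- On shell, the weights of the partitions with a given second part differ only by the way in
which the other parameters are cut into the first and the third part. -/
lemma Upsilon_cut (hn : 2 ≤ n) (hc : c ≠ 0) {z : 𝕜} {t r : Coll 𝕜} (hg : M.Generic t)
    (ht : M.Extendable z t) (hon : M.OnShell t) (hr : r ⊆ t) {i l k : ℕ} (hl : 1 ≤ l)
    (hlk : l ≤ k) (hkn : k ≤ n) :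
    M.Upsilon l k z (r.filter fun p => p.1 < i) (t \ r) (r.filter fun p => i ≤ p.1) =
      Omega c r (t \ r) *
        (Omega c (r.filter fun p => i ≤ p.1) (r.filter fun p => p.1 < i) *
          phi c l z (r.filter fun p => p.1 < i) * psi c k z (r.filter fun p => i ≤ p.1)) := by
  have hXW := filter_lt_union_filter_ge r i
  have hd := disjoint_filter_lt_filter_ge r i
  have hXr : (r.filter fun p => p.1 < i) ⊆ r := Finset.filter_subset _ _
  have hWr : (r.filter fun p => i ≤ p.1) ⊆ r := Finset.filter_subset _ _
  generalize (r.filter fun p => p.1 < i) = X at *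
  generalize (r.filter fun p => i ≤ p.1) = W at *
  have h12 : Disjoint X (t \ r) := Finset.disjoint_sdiff.mono_left hXr
  have h23 : Disjoint (t \ r) W := (Finset.disjoint_sdiff.mono_left hWr).symm
  have hu : X ∪ (t \ r) ∪ W = t := by
    rw [Finset.union_right_comm, hXW, Finset.union_sdiff_of_subset hr]
  have hdV : Disjoint (X ∪ t \ r) W := Finset.disjoint_union_left.2 ⟨hd, h23⟩
  have hWt : W ⊆ t := hWr.trans hr
  have hne : ∀ {P Q : Coll 𝕜}, P ⊆ t → Q ⊆ t → Disjoint P Q → Omega c P Q ≠ 0 :=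
    fun hP hQ hPQ => Omega_ne_zero hc fun p hp q hq =>
      hg.2 p (hP hp) q (hQ hq) fun e => Finset.disjoint_left.1 hPQ hp (e ▸ hq)
  have hal : ∏ p ∈ W, M.alphaHat p = Omega c W (X ∪ t \ r) / Omega c (X ∪ t \ r) W := by
    refine prod_onShell hc hdV (fun p hp q hq => hg.2 p (hWt hp) q (hWt hq)) fun p hp => ?_
    rw [hu, alphaHat, if_neg (ht.color (hWt hp)).2.ne, hon p (hWt hp)]
  have n1 := hne (hXr.trans hr) hWt hd
  have n2 := hne Finset.sdiff_subset hWt h23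
  have eO : Omega c r (t \ r) = Omega c X (t \ r) * Omega c W (t \ r) := by
    rw [← Omega_union_left hd, hXW]
  rw [Upsilon_eq hn hc ht hu h12 hd h23 hl hlk hkn, wt, hal, Omega₃, Omega_union_left h12,
    Omega_union_right _ h12, eO]
  field_simp

lemma sum_Upsilon_eq_zero (hn : 2 ≤ n) (hc : c ≠ 0) {z : 𝕜} {t r : Coll 𝕜} (hg : M.Generic t)
    (ht : M.Extendable z t) (hon : M.OnShell t) (hr : r ⊆ t) {l k : ℕ} (hl : 1 ≤ l)
    (hlk : l < k) (hkn : k ≤ n) (hcard : HasCards (ind l k) r) :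
    ∑ i ∈ Finset.Icc l k,
      M.Upsilon l k z (r.filter fun p => p.1 < i) (t \ r) (r.filter fun p => i ≤ p.1) = 0 := by
  rw [Finset.sum_congr rfl fun i _ => Upsilon_cut hn hc hg ht hon hr hl hlk.le hkn,
    ← Finset.mul_sum, sum_cut_eq_zero hc hl hlk hcard fun p hp => ht.2 p (hr hp), mul_zero]

/-- On shell, the unwanted terms vanish. -/
lemma sum_diagTerm_eq_zero (hn : 2 ≤ n) (hc : c ≠ 0) {z : 𝕜} {t : Coll 𝕜} (hg : M.Generic t)
    (ht : M.Extendable z t) (hon : M.OnShell t) {l k : ℕ} (hl : 1 ≤ l)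
    (hlk : l < k) (hkn : k ≤ n) :
    ∑ i ∈ Finset.Icc l k, M.diagTerm B i l k z t = 0 := by
  have hterm : ∀ i ∈ Finset.Icc l k, M.diagTerm B i l k z t =
      ∑ r ∈ t.powerset.filter (HasCards (ind l k)), (M.lam k z * mu c l k z (t \ r) *
        M.Upsilon l k z (r.filter fun p => p.1 < i) (t \ r) (r.filter fun p => i ≤ p.1)) •
          B (extend (t \ r) l k z) := by
    intro i hi
    rw [Finset.mem_Icc] at hi
    rw [diagTerm_eq_sum_parts hl (hl.trans hi.1) (hi.2.trans hkn) hkn fun p hp => ht.color hp,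
      sum_parts_ind hi.1 hi.2 t (fun X W => (M.lam k z * mu c l k z (t \ (X ∪ W)) *
        M.Upsilon l k z X (t \ (X ∪ W)) W) • B (extend (t \ (X ∪ W)) l k z))]
    simp only [filter_lt_union_filter_ge]
  rw [Finset.sum_congr rfl hterm, Finset.sum_comm]
  refine Finset.sum_eq_zero fun r hr => ?_
  rw [Finset.mem_filter, Finset.mem_powerset] at hr
  rw [← Finset.sum_smul, ← Finset.mul_sum,
    sum_Upsilon_eq_zero hn hc hg ht hon hr.1 hl hlk hkn hr.2, mul_zero, zero_smul]

end Model

end GLBethe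

theorem mainTheorem6 {𝕜 : Type*} [NontriviallyNormedField 𝕜] [CharZero 𝕜]
    {H : Type*} [AddCommGroup H] [Module 𝕜 H] [TopologicalSpace H] [IsTopologicalAddGroup H]
    [ContinuousSMul 𝕜 H] [T2Space H]
    (n : ℕ) (hn : 2 ≤ n) (c : 𝕜) (hc : c ≠ 0) (M : GLBethe.Model 𝕜 H n c)
    (B : GLBethe.Coll 𝕜 → H) (hB : M.IsOffShell B)
    (t : GLBethe.Coll 𝕜) (ht : M.Generic t) (z : 𝕜) (hz : M.GenericAt t z) :
    -- the action of the diagonal entries and its rewriting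
    (∀ i ∈ Finset.Icc 1 n,
      M.T i i z (B t) = M.action B i i z t ∧
      M.action B i i z t =
        ∑ l ∈ Finset.Icc 1 i, ∑ k ∈ Finset.Icc i n, M.diagTerm B i l k z t) ∧
    -- the decomposition of the action of the transfer matrix into wanted and unwanted terms
    (∑ i ∈ Finset.Icc 1 n, M.T i i z (B t) =
      M.tau z t • B t +
        ∑ l ∈ Finset.Icc 1 (n - 1), ∑ k ∈ Finset.Icc (l + 1) n,
          ∑ i ∈ Finset.Icc l k, M.diagTerm B i l k z t) ∧
    -- on shell, the unwanted terms cancel and `B t` has the eigenvalue `τ`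
    (M.OnShell t →
      (∀ l ∈ Finset.Icc 1 (n - 1), ∀ k ∈ Finset.Icc (l + 1) n,
        (∀ r ⊆ t, (∀ s ∈ Finset.Icc 1 (n - 1),
            (GLBethe.color r s).card = if l ≤ s ∧ s < k then 1 else 0) →
          ∑ i ∈ Finset.Icc l k,
            M.Upsilon l k z (r.filter fun p => p.1 < i) (t \ r) (r.filter fun p => i ≤ p.1) = 0) ∧
        ∑ i ∈ Finset.Icc l k, M.diagTerm B i l k z t = 0) ∧
      ∑ i ∈ Finset.Icc 1 n, M.T i i z (B t) = M.tau z t • B t) := by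
  have hzt := hz.extendable hc ht.1
  have haction : ∀ i ∈ Finset.Icc 1 n, M.T i i z (B t) = M.action B i i z t := fun i hi =>
    GLBethe.Model.T_diag_eq_action hn hc hB ht hz hi
  have hrewrite : ∀ i ∈ Finset.Icc 1 n, M.action B i i z t =
      ∑ l ∈ Finset.Icc 1 i, ∑ k ∈ Finset.Icc i n, M.diagTerm B i l k z t := fun i hi =>
    GLBethe.Model.action_eq_sum_diagTerm hn hc hzt hi
  have hdecomp : ∑ i ∈ Finset.Icc 1 n, M.T i i z (B t) =
      M.tau z t • B t +
        ∑ l ∈ Finset.Icc 1 (n - 1), ∑ k ∈ Finset.Icc (l + 1) n,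
          ∑ i ∈ Finset.Icc l k, M.diagTerm B i l k z t := by
    rw [Finset.sum_congr rfl fun i hi => (haction i hi).trans (hrewrite i hi),
      GLBethe.sum_triangle n fun i l k => M.diagTerm B i l k z t,
      Finset.sum_congr rfl fun i hi => GLBethe.Model.diagTerm_self hn hc hzt hi,
      ← Finset.sum_smul]
    rfl
  refine ⟨fun i hi => ⟨haction i hi, hrewrite i hi⟩, hdecomp, fun hon => ?_⟩
  have hzero : ∀ l ∈ Finset.Icc 1 (n - 1), ∀ k ∈ Finset.Icc (l + 1) n,
      ∑ i ∈ Finset.Icc l k, M.diagTerm B i l k z t = 0 := by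
    intro l hl k hk
    rw [Finset.mem_Icc] at hl hk
    exact GLBethe.Model.sum_diagTerm_eq_zero hn hc ht hzt hon hl.1 hk.1 hk.2
  refine ⟨fun l hl k hk => ⟨fun r hr hcard => ?_, hzero l hl k hk⟩, ?_⟩
  · rw [Finset.mem_Icc] at hl hk
    refine GLBethe.Model.sum_Upsilon_eq_zero hn hc ht hzt hon hr hl.1 hk.1 hk.2 ?_
    refine (GLBethe.forall_card_color_iff (fun p hp => hzt.color (hr hp)) (fun s _ _ => rfl)
      fun s hs => ?_).1 hcard
    rw [GLBethe.ind, if_neg]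
    omega
  · rw [hdecomp, Finset.sum_eq_zero fun l hl => Finset.sum_eq_zero fun k hk => hzero l hl k hk,
      add_zero]
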